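/- Let $w[1..n]$, $n\ge 1$, be a word over an arbitrary alphabet whose symbols can only be tested for equality. For $i,j\in[1..n]$ let $\mathrm{LCE}(i,j)$ be the largest $\ell\ge 0$ such that $w[i..i+\ell-1]$ and $w[j..j+\ell-1]$ are factors of $w$ and are equal, and let $\mathrm{ShortLCE}_t(i,j)=\min(\mathrm{LCE}(i,j),t)$. Define, for positive integers, $$A(1,j)=2^j,\qquad A(i,1)=A(i-1,2)\ (i>1),\qquad A(i,j)=A(i-1,A(i,j-1))\ (i,j>1),$$ and $\alpha(m,n)=\min\{i\ge 1: A(i,\lfloor m/n\rfloor)>\log_2 n\}$ for $m\ge n\ge 1$; let $\log^* n$ be the least number of applications of $\log_2$ that takes $n$ to a value at most $1$. Then there is an on-line algorithm on the word RAM (with words of $\Theta(\log n)$ bits, or longer, large enough to hold the numbers $k_i$ below, zero-initialised memory, and constant-time tests whether $w[p]=w[r]$; the algorithm depends neither on $w$ and $n$ nor on the queries) which, given $n$ and any sequence of queries $\mathrm{ShortLCE}_{4^{k_1}}(i_1,j_1),\dots,\mathrm{ShortLCE}_{4^{k_q}}(i_q,j_q)$ with $k_r\ge 0$ and $i_r,j_r\in[1..n]$,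 presented one by one, answers each query correctly before the next one is presented, in total time, including preprocessing, $$\mathcal{O}\bigl((n+s)\cdot\alpha(n+s,n)\bigr),\qquad\text{where } s=\sum_{r=1}^{q}(k_r+1).$$ Moreover, $(n+s)\cdot\alpha(n+s,n)=\mathcal{O}(n\log^* n+s)$ for all integers $n\ge1$, $s\ge0$ with $(n,s)\ne(1,0)$. The constants in both bounds are absolute. -/

import Mathlib

namespace LCE

/-! ### Words, `LCE` and `ShortLCE`

A word `w[1..n]` over an arbitrary alphabet `S` is given by its length `n` and a function
`w : ℕ → S`; only the values of `w` at the positions `1, …, n` matter. -/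

/-- `LCE(i,j)`: the largest `l` such that `w[i..i+l-1]` and `w[j..j+l-1]` are factors of `w[1..n]`
and are equal. For `1 ≤ i, j ≤ n` the set contains `0` and is bounded by `n`. -/
noncomputable def lce {S : Type*} (n : ℕ) (w : ℕ → S) (i j : ℕ) : ℕ :=
  sSup {l : ℕ | i + l ≤ n + 1 ∧ j + l ≤ n + 1 ∧ ∀ d < l, w (i + d) = w (j + d)}

/-- `ShortLCE_t(i,j) = min(LCE(i,j), t)`. -/
noncomputable def shortLCE {S : Type*} (n : ℕ) (w : ℕ → S) (t i j : ℕ) : ℕ :=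
  min (lce n w i j) t

/-- The query `ShortLCE_{4^k}(i,j)`, given by the numbers `i`, `j`, `k`. -/
structure Query where
  i : ℕ
  j : ℕ
  k : ℕ

/-- The positions of the query lie in `[1..n]`. -/
def Query.Valid (n : ℕ) (Q : Query) : Prop :=
  (1 ≤ Q.i ∧ Q.i ≤ n) ∧ (1 ≤ Q.j ∧ Q.j ≤ n)

/-- The correct answer to a query. -/
noncomputable def Query.answer {S : Type*} (n : ℕ) (w : ℕ → S) (Q : Query) : ℕ :=
  shortLCE n w (4 ^ Q.k) Q.i Q.j

/-- `s = ∑ (kᵢ + 1)`. -/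
def totalSize (Qs : List Query) : ℕ := (Qs.map fun Q => Q.k + 1).sum

/-! ### The functions `A`, `α` and `log*` -/

/-- The Ackermann function in Tarjan's and van Leeuwen's variant, for `i, j ≥ 1`
(the value is irrelevant, and set to `0`, when an argument that must be positive is `0`). -/
def ackermannA : ℕ → ℕ → ℕ
  | 0, _ => 0
  | 1, j => 2 ^ j
  | _ + 2, 0 => 0
  | i + 2, 1 => ackermannA (i + 1) 2
  | i + 2, j + 2 => ackermannA (i + 1) (ackermannA (i + 2) (j + 1))
termination_by i j => (i, j)

/-- `α(m,n) = min {i ≥ 1 : A(i, ⌊m/n⌋) > log₂ n}`, for `m ≥ n ≥ 1`. -/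
noncomputable def inverseAckermann (m n : ℕ) : ℕ :=
  sInf {i : ℕ | 1 ≤ i ∧ Real.logb 2 n < (ackermannA i (m / n) : ℝ)}

/-- `log* n`: how often the binary logarithm has to be applied to `n` to reach a value `≤ 1`. -/
noncomputable def logStar (n : ℕ) : ℕ :=
  sInf {r : ℕ | (Real.logb 2)^[r] (n : ℝ) ≤ 1}

/-! ### A word RAM with equality tests on the symbols of `w`

Programs are finite and structured. A machine word is a natural number `< W`. There are
registers and a memory that is divided into arrays, all holding words; a program names finitely
many registers and arrays, while array indices are computed. The word `w` is accessible only by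
tests `w[p] = w[r]`. A step that would produce a value `≥ W`, or a test outside `[1..n]`, blocks
the machine: it then has no execution. -/

/-- Arithmetic operations on machine words. -/
inductive BinOp
  | plus
  | monus
  | times
  | quot
  | rem
  | less
  | equal

/-- The result of an operation, before the check that it fits in a machine word. -/
def BinOp.eval : BinOp → ℕ → ℕ → ℕ
  | plus, a, b => a + b
  | monus, a, b => a - b
  | times, a, b => a * b
  | quot, a, b => a / b
  | rem, a, b => a % b
  | less, a, b => if a < b then 1 else 0
  | equal, a, b => if a = b then 1 else 0

/-- Expressions: constants, registers, array cells, operations. -/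
inductive Expr
  | const (c : ℕ)
  | reg (x : ℕ)
  | cell (a : ℕ) (e : Expr)
  | op (o : BinOp) (e₁ e₂ : Expr)

/-- A memory state: the contents of register `x`, and of cell `p` of array `a`. -/
structure State where
  reg : ℕ → ℕ
  arr : ℕ → ℕ → ℕ

/-- The value of an expression. -/
def Expr.eval (m : State) : Expr → ℕ
  | const c => c
  | reg x => m.reg x
  | cell a e => m.arr a (e.eval m)
  | op o e₁ e₂ => o.eval (e₁.eval m) (e₂.eval m)

/-- All values that occur in the evaluation of an expression are machine words. -/
def Expr.Fits (W : ℕ) (m : State) : Expr → Prop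
  | const c => c < W
  | reg x => m.reg x < W
  | cell a e => e.Fits W m ∧ m.arr a (e.eval m) < W
  | op o e₁ e₂ => e₁.Fits W m ∧ e₂.Fits W m ∧ o.eval (e₁.eval m) (e₂.eval m) < W

/-- The number of steps in the evaluation of an expression. -/
def Expr.cost : Expr → ℕ
  | const _ => 1
  | reg _ => 1
  | cell _ e => e.cost + 1
  | op _ e₁ e₂ => e₁.cost + e₂.cost + 1

/-- Writing a register. -/
def State.setReg (m : State) (x v : ℕ) : State :=
  { m with reg := Function.update m.reg x v }

/-- Writing an array cell. -/
def State.setCell (m : State) (a p v : ℕ) : State :=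
  { m with arr := Function.update m.arr a (Function.update (m.arr a) p v) }

/-- Programs. `assign x e` is `x := e`; `store a e₁ e₂` is `a[e₁] := e₂`; `test x e₁ e₂` sets `x`
to `1` if `w[e₁] = w[e₂]` and to `0` otherwise; a nonzero value counts as true. -/
inductive Program
  | skip
  | assign (x : ℕ) (e : Expr)
  | store (a : ℕ) (e₁ e₂ : Expr)
  | test (x : ℕ) (e₁ e₂ : Expr)
  | seq (P₁ P₂ : Program)
  | ite (e : Expr) (P₁ P₂ : Program)
  | loop (e : Expr) (P : Program)

/-- `Exec W n w P m m' T`: on a machine with words `< W`, and with access to `w[1..n]` by equality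
tests, the program `P` started in state `m` halts in state `m'` after `T` steps. -/
inductive Exec {S : Type*} (W n : ℕ) (w : ℕ → S) : Program → State → State → ℕ → Prop
  | skip (m : State) : Exec W n w Program.skip m m 1
  | assign (x : ℕ) (e : Expr) (m : State) (hf : e.Fits W m) :
      Exec W n w (Program.assign x e) m (m.setReg x (e.eval m)) (e.cost + 1)
  | store (a : ℕ) (e₁ e₂ : Expr) (m : State) (hf₁ : e₁.Fits W m) (hf₂ : e₂.Fits W m) :
      Exec W n w (Program.store a e₁ e₂) m (m.setCell a (e₁.eval m) (e₂.eval m))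
        (e₁.cost + e₂.cost + 1)
  | test_eq (x : ℕ) (e₁ e₂ : Expr) (m : State) (hf₁ : e₁.Fits W m) (hf₂ : e₂.Fits W m)
      (h₁ : 1 ≤ e₁.eval m ∧ e₁.eval m ≤ n) (h₂ : 1 ≤ e₂.eval m ∧ e₂.eval m ≤ n)
      (h : w (e₁.eval m) = w (e₂.eval m)) :
      Exec W n w (Program.test x e₁ e₂) m (m.setReg x 1) (e₁.cost + e₂.cost + 1)
  | test_ne (x : ℕ) (e₁ e₂ : Expr) (m : State) (hf₁ : e₁.Fits W m) (hf₂ : e₂.Fits W m)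
      (h₁ : 1 ≤ e₁.eval m ∧ e₁.eval m ≤ n) (h₂ : 1 ≤ e₂.eval m ∧ e₂.eval m ≤ n)
      (h : w (e₁.eval m) ≠ w (e₂.eval m)) :
      Exec W n w (Program.test x e₁ e₂) m (m.setReg x 0) (e₁.cost + e₂.cost + 1)
  | seq (P₁ P₂ : Program) (m m₁ m₂ : State) (T₁ T₂ : ℕ)
      (h₁ : Exec W n w P₁ m m₁ T₁) (h₂ : Exec W n w P₂ m₁ m₂ T₂) :
      Exec W n w (Program.seq P₁ P₂) m m₂ (T₁ + T₂)
  | ite_true (e : Expr) (P₁ P₂ : Program) (m m₁ : State) (T : ℕ) (hf : e.Fits W m)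
      (h : e.eval m ≠ 0) (h₁ : Exec W n w P₁ m m₁ T) :
      Exec W n w (Program.ite e P₁ P₂) m m₁ (e.cost + 1 + T)
  | ite_false (e : Expr) (P₁ P₂ : Program) (m m₁ : State) (T : ℕ) (hf : e.Fits W m)
      (h : e.eval m = 0) (h₁ : Exec W n w P₂ m m₁ T) :
      Exec W n w (Program.ite e P₁ P₂) m m₁ (e.cost + 1 + T)
  | loop_true (e : Expr) (P : Program) (m m₁ m₂ : State) (T₁ T₂ : ℕ) (hf : e.Fits W m)
      (h : e.eval m ≠ 0) (h₁ : Exec W n w P m m₁ T₁)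
      (h₂ : Exec W n w (Program.loop e P) m₁ m₂ T₂) :
      Exec W n w (Program.loop e P) m m₂ (e.cost + 1 + T₁ + T₂)
  | loop_false (e : Expr) (P : Program) (m : State) (hf : e.Fits W m) (h : e.eval m = 0) :
      Exec W n w (Program.loop e P) m m (e.cost + 1)

/-! ### On-line algorithms -/

/-- An on-line algorithm: a preprocessing program, and a program that is run once for each query.
Neither depends on the word, its length, the alphabet, the word size or the queries. -/
structure OnlineAlgorithm where
  preprocess : Program
  query : Program

/-- Initially register `0` holds `n`, and all other registers and all array cells hold `0`. -/
def initialState (n : ℕ) : State where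
  reg := fun x => if x = 0 then n else 0
  arr := fun _ _ => 0

/-- A query is presented in the registers `1`, `2`, `3`. -/
def State.present (m : State) (Q : Query) : State :=
  ((m.setReg 1 Q.i).setReg 2 Q.j).setReg 3 Q.k

/-- `Serves W n w P m Qs As T`: started in state `m`, the program `P` is run on the queries `Qs`
one after another, in total time `T`, and gives the answers `As`. A query is presented only after
the previous one has been answered; an answer is given in register `4`. -/
inductive Serves {S : Type*} (W n : ℕ) (w : ℕ → S) (P : Program) :
    State → List Query → List ℕ → ℕ → Prop
  | nil (m : State) : Serves W n w P m [] [] 0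
  | cons (m m₁ : State) (Q : Query) (Qs : List Query) (As : List ℕ) (T₁ T₂ : ℕ)
      (h₁ : Exec W n w P (m.present Q) m₁ T₁) (h₂ : Serves W n w P m₁ Qs As T₂) :
      Serves W n w P m (Q :: Qs) (m₁.reg 4 :: As) (T₁ + T₂)

/-- On the word `w[1..n]`, the algorithm gives the answers `As` to the on-line sequence of queries
`Qs`, in total time `T` including the preprocessing. -/
def OnlineAlgorithm.Run {S : Type*} (alg : OnlineAlgorithm) (W n : ℕ) (w : ℕ → S)
    (Qs : List Query) (As : List ℕ) (T : ℕ) : Prop :=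
  ∃ (m : State) (T₁ T₂ : ℕ), Exec W n w alg.preprocess (initialState n) m T₁ ∧
    Serves W n w alg.query m Qs As T₂ ∧ T = T₁ + T₂

end LCE

namespace LCE

/-! ### Executions with postconditions -/

/-! The nodes of a disjoint-set forest are blocks: factors of length `4 ^ l`, `l ≥ 1`, that begin at
positions whose lowest `l` base-4 digits avoid 3. About a fraction `(3/4)^l` of the positions is
sparse in this sense, so there are only `O(n)` nodes (`card_sparseBlocks_le`). Nevertheless two
positions that are sparse at level `l` become sparse at level `l + 1` together after at most two
common steps of length `4 ^ l` (`inSparse_stepsUp`). A query therefore climbs from `i` and `j`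
through the levels with at most two block comparisons on each, makes one more at the top level `K`,
and has then matched `4 ^ K` symbols, unless a mismatch or the end of the word has stopped it.

Two blocks are known to be equal when their nodes have the same root. Otherwise they are cut into
four blocks of the next lower level, which are sparse there; at level 0 symbols are tested. If all
four parts agree, the two trees are linked. A link destroys a root, so there are `O(n)` links, and
each pays for the comparison of its four parts. Cuts that a mismatch leaves unfinished are nested,
hence at most one per level. This yields `O(n + s)` finds altogether; `queryPotential` and the count
of roots carry out the accounting (`reach_step`).

With path compression and union by rank, the amortised cost of a find or a link is `O(a)`, where `a
= α(n + s, n)`. The values of the Ackermann rows partition the ranks into intervals, coarser from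
level to level. A node is charged for the boundaries that its parent's rank has yet to pass. On a
find path all but at most `a + 1` nodes pass one (`nodePotential_lt`, `Forest.compress_potential`),
and a link raises the potential by at most `a` (`link_potential`). All nodes of a tree are equal
blocks of one level, so ranks are at most `log₂ n < A(a, d)` with `d = ⌊(n + s)/n⌋`, and the initial
potential `O(n (a + d))` is `O((n + s) a)`. The numbers `a` and `d` occur in the analysis only; the
program computes neither.

The comparison with `log*` is independent of this: row 2 of the Ackermann function is a tower of
exponentials, and minimality of `α` gives `α * d ≤ log* n` once `α > 4` (`inverseAckermann_bound`).
-/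

@[simp] theorem State.setReg_reg (m : State) (x v y : ℕ) :
    (m.setReg x v).reg y = if y = x then v else m.reg y := by
  simp [State.setReg, Function.update_apply]

@[simp] theorem State.setReg_arr (m : State) (x v : ℕ) : (m.setReg x v).arr = m.arr := rfl

@[simp] theorem State.setCell_reg (m : State) (a p v : ℕ) : (m.setCell a p v).reg = m.reg := rfl

@[simp] theorem State.setCell_arr (m : State) (a p v b : ℕ) :
    (m.setCell a p v).arr b = if b = a then Function.update (m.arr a) p v else m.arr b := by
  simp only [State.setCell, Function.update_apply]

theorem BinOp.less_eval_eq_zero (a b : ℕ) : BinOp.less.eval a b = 0 ↔ b ≤ a := by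
  simp [BinOp.eval]

theorem BinOp.equal_eval_eq_zero (a b : ℕ) : BinOp.equal.eval a b = 0 ↔ a ≠ b := by
  simp [BinOp.eval]

theorem BinOp.less_eval_lt {W : ℕ} (h : 1 < W) (a b : ℕ) : BinOp.less.eval a b < W := by
  simp only [BinOp.eval]
  split_ifs <;> omega

theorem BinOp.equal_eval_lt {W : ℕ} (h : 1 < W) (a b : ℕ) : BinOp.equal.eval a b < W := by
  simp only [BinOp.eval]
  split_ifs <;> omega

/-- From state `m`, the program halts in a state and after a time that satisfy `Q`. -/
def Reach {S : Type*} (W n : ℕ) (w : ℕ → S) (P : Program) (m : State)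
    (Q : State → ℕ → Prop) : Prop :=
  ∃ m' T, Exec W n w P m m' T ∧ Q m' T

section Reach

variable {S : Type*} {W n : ℕ} {w : ℕ → S} {P P₁ P₂ : Program} {m : State}
  {Q Q' : State → ℕ → Prop}

theorem Reach.mono (h : Reach W n w P m Q) (hQ : ∀ m' T, Q m' T → Q' m' T) :
    Reach W n w P m Q' := by
  obtain ⟨m', T, h, hq⟩ := h
  exact ⟨m', T, h, hQ _ _ hq⟩

theorem Reach.skip (h : Q m 1) : Reach W n w .skip m Q :=
  ⟨m, 1, .skip m, h⟩

theorem Reach.assign {x : ℕ} {e : Expr} (hf : e.Fits W m)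
    (h : Q (m.setReg x (e.eval m)) (e.cost + 1)) : Reach W n w (.assign x e) m Q :=
  ⟨_, _, .assign x e m hf, h⟩

theorem Reach.store {a : ℕ} {e₁ e₂ : Expr} (hf₁ : e₁.Fits W m) (hf₂ : e₂.Fits W m)
    (h : Q (m.setCell a (e₁.eval m) (e₂.eval m)) (e₁.cost + e₂.cost + 1)) :
    Reach W n w (.store a e₁ e₂) m Q :=
  ⟨_, _, .store a e₁ e₂ m hf₁ hf₂, h⟩

open Classical in
theorem Reach.test {x : ℕ} {e₁ e₂ : Expr} (hf₁ : e₁.Fits W m) (hf₂ : e₂.Fits W m)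
    (h₁ : 1 ≤ e₁.eval m ∧ e₁.eval m ≤ n) (h₂ : 1 ≤ e₂.eval m ∧ e₂.eval m ≤ n)
    (h : Q (m.setReg x (if w (e₁.eval m) = w (e₂.eval m) then 1 else 0))
      (e₁.cost + e₂.cost + 1)) :
    Reach W n w (.test x e₁ e₂) m Q := by
  by_cases hw : w (e₁.eval m) = w (e₂.eval m)
  · rw [if_pos hw] at h
    exact ⟨_, _, .test_eq x e₁ e₂ m hf₁ hf₂ h₁ h₂ hw, h⟩
  · rw [if_neg hw] at h
    exact ⟨_, _, .test_ne x e₁ e₂ m hf₁ hf₂ h₁ h₂ hw, h⟩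

theorem Reach.seq
    (h : Reach W n w P₁ m fun m₁ T₁ => Reach W n w P₂ m₁ fun m₂ T₂ => Q m₂ (T₁ + T₂)) :
    Reach W n w (.seq P₁ P₂) m Q := by
  obtain ⟨m₁, T₁, h₁, m₂, T₂, h₂, hq⟩ := h
  exact ⟨m₂, _, .seq P₁ P₂ m m₁ m₂ T₁ T₂ h₁ h₂, hq⟩

theorem Reach.ite {e : Expr} (hf : e.Fits W m)
    (h₁ : e.eval m ≠ 0 → Reach W n w P₁ m fun m' T => Q m' (e.cost + 1 + T))
    (h₂ : e.eval m = 0 → Reach W n w P₂ m fun m' T => Q m' (e.cost + 1 + T)) :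
    Reach W n w (.ite e P₁ P₂) m Q := by
  by_cases h : e.eval m = 0
  · obtain ⟨m', T, hx, hq⟩ := h₂ h
    exact ⟨m', _, .ite_false e P₁ P₂ m m' T hf h hx, hq⟩
  · obtain ⟨m', T, hx, hq⟩ := h₁ h
    exact ⟨m', _, .ite_true e P₁ P₂ m m' T hf h hx, hq⟩

/-- A loop halts if every iteration is paid for by a potential: `I N m` says that the invariant
holds in state `m`, with potential `N`. The drop of the potential bounds the running time. -/
theorem Reach.loop {e : Expr} (I : ℕ → State → Prop) {N : ℕ}
    (hf : ∀ N m, I N m → e.Fits W m)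
    (hP : ∀ N m, I N m → e.eval m ≠ 0 →
      Reach W n w P m fun m' T => ∃ N', I N' m' ∧ e.cost + 1 + T + N' ≤ N)
    (hm : I N m)
    (hQ : ∀ N' m' T, I N' m' → e.eval m' = 0 → T + N' ≤ N + e.cost + 1 → Q m' T) :
    Reach W n w (.loop e P) m Q := by
  have key : ∀ (N : ℕ) (m : State), I N m →
      Reach W n w (.loop e P) m fun m' T =>
        ∃ N', I N' m' ∧ e.eval m' = 0 ∧ T + N' ≤ N + e.cost + 1 := by
    intro N
    induction N using Nat.strong_induction_on with
    | _ N ih =>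
      intro m hm
      by_cases h : e.eval m = 0
      · exact ⟨m, _, .loop_false e P m (hf N m hm) h, N, hm, h, by omega⟩
      · obtain ⟨m', T, hx, N', hm', hT⟩ := hP N m hm h
        obtain ⟨m'', T', hx', N'', hm'', he, hT'⟩ := ih N' (by omega) m' hm'
        exact ⟨m'', _, .loop_true e P m m' m'' T T' (hf N m hm) h hx hx', N'', hm'', he, by omega⟩
  obtain ⟨m', T, hx, N', hm', he, hT⟩ := key N m hm
  exact ⟨m', T, hx, hQ _ _ _ hm' he hT⟩

end Reach

/-! ### The Ackermann function -/

theorem ackermannA_one (j : ℕ) : ackermannA 1 j = 2 ^ j := by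
  rw [ackermannA]

theorem ackermannA_add_two_zero (i : ℕ) : ackermannA (i + 2) 0 = 0 := by
  rw [ackermannA]

theorem ackermannA_add_two_one (i : ℕ) : ackermannA (i + 2) 1 = ackermannA (i + 1) 2 := by
  rw [ackermannA]

theorem ackermannA_add_two_add_two (i j : ℕ) :
    ackermannA (i + 2) (j + 2) = ackermannA (i + 1) (ackermannA (i + 2) (j + 1)) := by
  rw [ackermannA]

theorem ackermannA_strictMono_and_lt (i : ℕ) :
    StrictMono (ackermannA (i + 1)) ∧ ∀ j, 1 ≤ j → j < ackermannA (i + 1) j := by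
  induction i with
  | zero =>
    refine ⟨fun a b h => ?_, fun j _ => ?_⟩
    · simpa only [zero_add, ackermannA_one] using Nat.pow_lt_pow_right (by omega) h
    · simpa [ackermannA_one] using Nat.lt_two_pow_self
  | succ i ih =>
    obtain ⟨hm, hl⟩ := ih
    have hlt : ∀ j, j + 1 < ackermannA (i + 2) (j + 1) ∧
        ackermannA (i + 2) j < ackermannA (i + 2) (j + 1) := by
      intro j
      induction j with
      | zero =>
        rw [ackermannA_add_two_zero, ackermannA_add_two_one]
        have := hl 2 (by omega)
        omega
      | succ j ihj =>
        rw [ackermannA_add_two_add_two]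
        have := hl (ackermannA (i + 2) (j + 1)) (by omega)
        omega
    refine ⟨strictMono_nat_of_lt_succ fun j => (hlt j).2, fun j hj => ?_⟩
    obtain ⟨j, rfl⟩ : ∃ k, j = k + 1 := ⟨j - 1, by omega⟩
    exact (hlt j).1

theorem ackermannA_strictMono {i : ℕ} (hi : 1 ≤ i) : StrictMono (ackermannA i) := by
  obtain ⟨i, rfl⟩ : ∃ k, i = k + 1 := ⟨i - 1, by omega⟩
  exact (ackermannA_strictMono_and_lt i).1

theorem lt_ackermannA {i j : ℕ} (hi : 1 ≤ i) (hj : 1 ≤ j) : j < ackermannA i j := by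
  obtain ⟨i, rfl⟩ : ∃ k, i = k + 1 := ⟨i - 1, by omega⟩
  exact (ackermannA_strictMono_and_lt i).2 j hj

/-- A crude bound that serves twice: it makes `α` well defined, and it absorbs the factor `i + 1` in
`ackermannA_two_le`. -/
theorem two_pow_le_ackermannA (i j : ℕ) : 2 ^ (i + j + 1) ≤ ackermannA (i + 1) (j + 1) := by
  induction i generalizing j with
  | zero => simp [ackermannA_one]
  | succ i ih =>
    induction j with
    | zero =>
      rw [ackermannA_add_two_one]
      exact (Nat.pow_le_pow_right (by omega) (by omega)).trans (ih 1)
    | succ j ihj =>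
      rw [ackermannA_add_two_add_two]
      have h1 : 2 ^ (i + 1 + j + 1) ≤ ackermannA (i + 2) (j + 1) := ihj
      obtain ⟨a, ha⟩ : ∃ a, ackermannA (i + 2) (j + 1) = a + 1 :=
        ⟨_, (Nat.sub_add_cancel (Nat.one_le_two_pow.trans h1)).symm⟩
      rw [ha] at h1 ⊢
      refine (Nat.pow_le_pow_right (by omega) ?_).trans (ih a)
      have : i + 1 + j + 1 < 2 ^ (i + 1 + j + 1) := Nat.lt_two_pow_self
      omega

theorem ackermannA_le_succ (i : ℕ) {j : ℕ} (hj : 1 ≤ j) :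
    ackermannA (i + 1) j ≤ ackermannA (i + 2) j := by
  obtain ⟨j, rfl⟩ : ∃ k, j = k + 1 := ⟨j - 1, by omega⟩
  have hm := (ackermannA_strictMono (i := i + 1) (by omega)).monotone
  cases j with
  | zero =>
    rw [ackermannA_add_two_one]
    exact hm (by omega)
  | succ j =>
    rw [ackermannA_add_two_add_two]
    exact hm (lt_ackermannA (by omega) (by omega))

theorem ackermannA_mono_left {i i' j : ℕ} (hi : 1 ≤ i) (hii : i ≤ i') (hj : 1 ≤ j) :
    ackermannA i j ≤ ackermannA i' j := by
  induction i', hii using Nat.le_induction with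
  | base => exact le_rfl
  | succ k hk ih =>
    obtain ⟨k, rfl⟩ : ∃ a, k = a + 1 := ⟨k - 1, by omega⟩
    exact ih.trans (ackermannA_le_succ k hj)

/-- The fourth and all later rows outgrow the second one by far. -/
theorem ackermannA_two_le {i d : ℕ} (hi : 4 ≤ i) (hd : 1 ≤ d) :
    ackermannA 2 ((i + 1) * d) ≤ ackermannA i d := by
  obtain ⟨i, rfl⟩ : ∃ k, i = k + 4 := ⟨i - 4, by omega⟩
  have h2 : ∀ k : ℕ, k < 2 ^ k := fun k => Nat.lt_two_pow_self
  have hmono := (ackermannA_strictMono (i := 2) (by omega)).monotone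
  obtain rfl | hd : d = 1 ∨ 2 ≤ d := by omega
  -- Two unfoldings descend two rows, which still leaves row 2 or a later one. The inner argument is
  -- at least `2 ^ (i + 3)` and so exceeds the required column of row 2.
  · have e : ackermannA (i + 4) 1 = ackermannA (i + 2) (ackermannA (i + 3) 1) := by
      rw [ackermannA_add_two_one, ackermannA_add_two_add_two]
    rw [e]
    have h1 : 2 ^ (i + 2 + 0 + 1) ≤ ackermannA (i + 3) 1 := two_pow_le_ackermannA (i + 2) 0
    have h3 := h2 i
    have h4 : (i + 4 + 1) * 1 ≤ ackermannA (i + 3) 1 := by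
      rw [show i + 2 + 0 + 1 = i + 3 by omega, pow_add] at h1
      omega
    exact (hmono h4).trans (ackermannA_mono_left (by omega) (by omega) (by omega))
  · obtain ⟨d, rfl⟩ : ∃ k, d = k + 2 := ⟨d - 2, by omega⟩
    rw [show i + 4 = (i + 2) + 2 by omega, ackermannA_add_two_add_two]
    have h1 : 2 ^ (i + 3 + d + 1) ≤ ackermannA (i + 2 + 2) (d + 1) :=
      two_pow_le_ackermannA (i + 3) d
    have h4 : (i + 2 + 2 + 1) * (d + 2) ≤ ackermannA (i + 2 + 2) (d + 1) := by
      refine le_trans ?_ h1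
      have h5 : (i + 2 + 2 + 1) ≤ 2 ^ (i + 3) := by
        have := h2 i
        rw [pow_add]; omega
      have h6 : d + 2 ≤ 2 ^ (d + 1) := h2 (d + 1)
      calc _ ≤ 2 ^ (i + 3) * 2 ^ (d + 1) := Nat.mul_le_mul h5 h6
        _ = _ := by rw [← pow_add]; congr 1
    refine (hmono h4).trans (ackermannA_mono_left (by omega) (by omega) ?_)
    exact Nat.one_le_two_pow.trans h1

theorem inverseAckermann_mem {m n : ℕ} (h : n ≤ m) (hn : 1 ≤ n) :
    1 ≤ inverseAckermann m n ∧
      Real.logb 2 n < (ackermannA (inverseAckermann m n) (m / n) : ℝ) := by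
  refine Nat.sInf_mem (s := {i : ℕ | 1 ≤ i ∧ Real.logb 2 n < (ackermannA i (m / n) : ℝ)}) ?_
  -- Row `n + 1` exceeds `n`, and hence `log₂ n`, at every positive column.
  refine ⟨n + 1, by omega, ?_⟩
  have hd : 1 ≤ m / n := (Nat.one_le_div_iff (by omega)).2 h
  have h1 : 2 ^ (n + 0 + 1) ≤ ackermannA (n + 1) 1 := two_pow_le_ackermannA n 0
  have h2 := (ackermannA_strictMono (i := n + 1) (by omega)).monotone hd
  have h3 : n < 2 ^ (n + 0 + 1) := (Nat.lt_two_pow_self (n := n)).trans_le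
    (Nat.pow_le_pow_right (by omega) (by omega))
  have h4 : (n : ℝ) < ackermannA (n + 1) (m / n) := by exact_mod_cast h3.trans_le (h1.trans h2)
  refine lt_of_le_of_lt ?_ h4
  rw [Real.logb_le_iff_le_rpow (by norm_num) (by exact_mod_cast hn), Real.rpow_natCast]
  exact_mod_cast (Nat.lt_two_pow_self (n := n)).le

theorem log_lt_ackermannA {m n : ℕ} (h : n ≤ m) (hn : 1 ≤ n) :
    Nat.log 2 n < ackermannA (inverseAckermann m n) (m / n) := by
  have h1 := (inverseAckermann_mem h hn).2
  have h2 : (Nat.log 2 n : ℝ) ≤ Real.logb 2 n := by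
    simpa using Real.natLog_le_logb n 2
  exact_mod_cast h2.trans_lt h1

/-! ### The iterated logarithm -/

/-- Above 2 a logarithm loses at least 1, so the bound `m + 1` falls to `m`. The loss follows from
`ln y ≤ y - 1` at `y = x / 2`, together with `ln 2 > 1 / 2`. -/
theorem exists_iterate_logb_le_one (m : ℕ) (x : ℝ) (hx : x ≤ m + 1) :
    ∃ r, (Real.logb 2)^[r] x ≤ 1 := by
  induction m generalizing x with
  | zero => exact ⟨0, by simpa using hx⟩
  | succ m ih =>
    by_cases h1 : x ≤ 1
    · exact ⟨0, h1⟩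
    have hpos : 0 < x := by linarith
    by_cases h2 : x ≤ 2
    · refine ⟨1, ?_⟩
      rw [Function.iterate_one, Real.logb_le_iff_le_rpow (by norm_num) hpos]
      simpa using h2
    · obtain ⟨r, hr⟩ := ih (Real.logb 2 x) <| by
        have h3 : Real.logb 2 (x / 2) ≤ x / 2 * 2 - 2 := by
          have h4 : Real.log (x / 2) ≤ x / 2 - 1 := Real.log_le_sub_one_of_pos (by linarith)
          have h5 : (1 / 2 : ℝ) < Real.log 2 := by have := Real.log_two_gt_d9; linarith
          rw [Real.logb, div_le_iff₀ (by linarith)]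
          nlinarith
        have h6 : Real.logb 2 x = Real.logb 2 (x / 2) + 1 := by
          rw [Real.logb_div hpos.ne' (by norm_num)]
          simp
        have h7 : Real.logb 2 x ≤ x - 1 := by linarith
        push_cast at hx
        linarith
      exact ⟨r + 1, by simpa using hr⟩

theorem logStar_mem (n : ℕ) : (Real.logb 2)^[logStar n] (n : ℝ) ≤ 1 :=
  Nat.sInf_mem (s := {r : ℕ | (Real.logb 2)^[r] (n : ℝ) ≤ 1})
    (exists_iterate_logb_le_one n n (by linarith))

/-- Since `A(2, j + 1) = 2 ^ A(2, j)`, every further logarithm lowers the column by one. -/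
theorem le_iterate_logb {j : ℕ} {x : ℝ} (h : (ackermannA 2 j : ℝ) ≤ Real.logb 2 x)
    (r : ℕ) (hr : r < j) : (ackermannA 2 (j - r) : ℝ) ≤ (Real.logb 2)^[r + 1] x := by
  induction r with
  | zero => simpa using h
  | succ r ih =>
    have ih := ih (by omega)
    rw [Function.iterate_succ_apply']
    obtain ⟨a, ha⟩ : ∃ a, j - r = a + 2 := ⟨j - r - 2, by omega⟩
    rw [ha, show (2 : ℕ) = 0 + 2 from rfl, ackermannA_add_two_add_two, zero_add,
      ackermannA_one] at ih
    rw [show j - (r + 1) = a + 1 by omega]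
    push_cast at ih
    rw [Real.le_logb_iff_rpow_le (by norm_num) (lt_of_lt_of_le (by positivity) ih),
      Real.rpow_natCast]
    exact ih

/-- With fewer than `j` logarithms the column stays positive, where row 2 is larger than 1. -/
theorem le_logStar {j n : ℕ} (hn : 1 ≤ n) (h : (ackermannA 2 j : ℝ) ≤ Real.logb 2 n) :
    j ≤ logStar n := by
  by_contra! hlt
  have hmem := logStar_mem n
  obtain h0 | ⟨r, hr⟩ : logStar n = 0 ∨ ∃ r, logStar n = r + 1 := by
    rcases logStar n with _ | r
    · exact .inl rfl
    · exact .inr ⟨r, rfl⟩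
  -- Without any logarithm the iteration bound says nothing; but then `n = 1` and `log₂ n = 0`.
  · rw [h0] at hmem
    have h1 : (n : ℝ) = 1 := le_antisymm (by simpa using hmem) (by exact_mod_cast hn)
    rw [h1] at h
    have h2 := lt_ackermannA (i := 2) (j := j) (by omega) (by omega)
    have : (ackermannA 2 j : ℝ) ≤ 0 := by simpa using h
    have h3 : ackermannA 2 j ≤ 0 := by exact_mod_cast this
    omega
  · rw [hr] at hmem hlt
    have h1 := (le_iterate_logb h r (by omega)).trans hmem
    have h2 := lt_ackermannA (i := 2) (j := j - r) (by omega) (by omega)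
    have h3 : ackermannA 2 (j - r) ≤ 1 := by exact_mod_cast h1
    omega

theorem one_le_logStar {n : ℕ} (hn : 2 ≤ n) : 1 ≤ logStar n := by
  by_contra! h
  have hmem := logStar_mem n
  rw [show logStar n = 0 by omega] at hmem
  have : (n : ℝ) ≤ 1 := by simpa using hmem
  have : n ≤ 1 := by exact_mod_cast this
  omega

/-! ### Comparison of `α` with `log*` -/

/-- Let `d = ⌊(n + s)/n⌋`. If `α > 4`, minimality gives `A(α - 1, d) ≤ log₂ n`, and
`ackermannA_two_le` replaces the left side by `A(2, α d)`. Hence `α d ≤ log* n`, and `n + s ≤ 2 n d`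
finishes. -/
theorem inverseAckermann_bound :
    ∃ C : ℕ, ∀ n s : ℕ, 1 ≤ n → (2 ≤ n ∨ 1 ≤ s) →
      (n + s) * inverseAckermann (n + s) n ≤ C * (n * logStar n + s) := by
  refine ⟨8, fun n s hn hns => ?_⟩
  set α := inverseAckermann (n + s) n with hα
  -- The pair `(1, 0)` has to be excluded here, because `log* 1 = 0`.
  have hle : n ≤ n * logStar n + s := by
    obtain h | h : 2 ≤ n ∨ n = 1 := by omega
    · exact (Nat.le_mul_of_pos_right n (one_le_logStar h)).trans (Nat.le_add_right _ _)
    · omega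
  by_cases h4 : α ≤ 4
  · calc (n + s) * α ≤ (n + s) * 4 := Nat.mul_le_mul_left _ h4
      _ ≤ _ := by omega
  · have hd : 1 ≤ (n + s) / n := (Nat.one_le_div_iff (by omega)).2 (by omega)
    have hnot : ¬ (1 ≤ α - 1 ∧ Real.logb 2 n < (ackermannA (α - 1) ((n + s) / n) : ℝ)) :=
      Nat.notMem_of_lt_sInf (s := {i | 1 ≤ i ∧ Real.logb 2 n < (ackermannA i ((n + s) / n) : ℝ)})
        (show α - 1 < α by omega)
    have h1 : (ackermannA (α - 1) ((n + s) / n) : ℝ) ≤ Real.logb 2 n := by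
      by_contra! h
      exact hnot ⟨by omega, h⟩
    have h2 := ackermannA_two_le (i := α - 1) (by omega) hd
    rw [Nat.sub_add_cancel (by omega)] at h2
    have h3 : α * ((n + s) / n) ≤ logStar n :=
      le_logStar hn (le_trans (by exact_mod_cast h2) h1)
    have h5 : n + s ≤ n * ((n + s) / n) + n := by
      have := Nat.div_add_mod (n + s) n
      have := Nat.mod_lt (n + s) (show n > 0 by omega)
      omega
    have h6 : n ≤ n * ((n + s) / n) := Nat.le_mul_of_pos_right n hd
    calc (n + s) * α ≤ (2 * (n * ((n + s) / n))) * α := Nat.mul_le_mul_right _ (by omega)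
      _ = 2 * (n * (α * ((n + s) / n))) := by ring
      _ ≤ 2 * (n * logStar n) := by gcongr
      _ ≤ _ := by omega

open Finset

/-! ### The potential of a node of a disjoint-set forest

Level `0` partitions the ranks into singletons, level `i ≥ 1` into intervals that begin at the
values `A(i,1), A(i,2), …`. -/

/-- `b` begins an interval of level `i`. -/
def IsBoundary (i b : ℕ) : Prop := i = 0 ∨ ∃ j, 1 ≤ j ∧ ackermannA i j = b

theorem exists_lt_ackermannA (i r : ℕ) : ∃ j, 1 ≤ j ∧ r < ackermannA (i + 1) j :=
  ⟨r + 1, by omega, (Nat.lt_succ_self r).trans (lt_ackermannA (by omega) (by omega))⟩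

open Classical in
/-- The least boundary of level `i + 1` above `r`. -/
noncomputable def nextBoundary (i r : ℕ) : ℕ :=
  ackermannA (i + 1) (Nat.find (exists_lt_ackermannA i r))

theorem lt_nextBoundary (i r : ℕ) : r < nextBoundary i r := by
  classical
  exact (Nat.find_spec (exists_lt_ackermannA i r)).2

theorem isBoundary_nextBoundary (i r : ℕ) : IsBoundary (i + 1) (nextBoundary i r) := by
  classical
  exact .inr ⟨_, (Nat.find_spec (exists_lt_ackermannA i r)).1, rfl⟩

/-- By the recursion every value in a row is also a value of the row before, so the partitions get
coarser as the level grows. -/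
theorem IsBoundary.of_succ {i b : ℕ} (h : IsBoundary (i + 1) b) : IsBoundary i b := by
  cases i with
  | zero => exact .inl rfl
  | succ i =>
    obtain h | ⟨j, hj, rfl⟩ := h
    · omega
    · obtain ⟨j, rfl⟩ : ∃ k, j = k + 1 := ⟨j - 1, by omega⟩
      cases j with
      | zero => exact .inr ⟨2, by omega, (ackermannA_add_two_one i).symm⟩
      | succ j =>
        refine .inr ⟨_, ?_, (ackermannA_add_two_add_two i j).symm⟩
        exact (Nat.zero_le _).trans_lt
          (lt_ackermannA (i := i + 2) (j := j + 1) (by omega) (by omega))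

open Classical in
/-- The number of boundaries of level `i` in `(p, t]`. -/
noncomputable def numBoundaries (i p t : ℕ) : ℕ := #{b ∈ Ioc p t | IsBoundary i b}

theorem numBoundaries_anti (i t : ℕ) {p p' : ℕ} (h : p ≤ p') :
    numBoundaries i p' t ≤ numBoundaries i p t := by
  classical
  exact card_le_card (filter_subset_filter _ (Ioc_subset_Ioc_left h))

theorem numBoundaries_lt {i t p p' b : ℕ} (h : p < b) (h' : b ≤ p') (hb : IsBoundary i b)
    (ht : b ≤ t) : numBoundaries i p' t < numBoundaries i p t := by
  classical
  refine card_lt_card ⟨filter_subset_filter _ (Ioc_subset_Ioc_left (h.le.trans h')), fun hs => ?_⟩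
  have := hs (mem_filter.2 ⟨mem_Ioc.2 ⟨h, ht⟩, hb⟩)
  simp only [mem_filter, mem_Ioc] at this
  omega

theorem numBoundaries_le_of_lt {i p t q : ℕ} (hi : 1 ≤ i) (h : t < ackermannA i q) :
    numBoundaries i p t ≤ q - 1 := by
  classical
  have hm := ackermannA_strictMono hi
  calc numBoundaries i p t ≤ #((Icc 1 (q - 1)).image (ackermannA i)) := by
        refine card_le_card fun b hb => ?_
        simp only [mem_filter, mem_Ioc] at hb
        obtain ⟨⟨-, hbt⟩, h0 | ⟨j, hj, rfl⟩⟩ := hb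
        · omega
        · have := hm.lt_iff_lt.1 (hbt.trans_lt h)
          exact mem_image_of_mem _ (mem_Icc.2 ⟨hj, by omega⟩)
    _ ≤ #(Icc 1 (q - 1)) := card_image_le
    _ = q - 1 := by simp

/-- If `r` lies between `A(i + 1, J)` and `A(i + 1, J + 1) = A(i, A(i + 1, J))`, then the boundaries
of level `i` up to the latter are indexed by `1, …, A(i + 1, J)`, and `A(i + 1, J) ≤ r`. At level 0
this becomes the doubling `2 ^ (J + 1) = 2 * 2 ^ J`. The summand 2 covers ranks below the first
boundary. -/
theorem numBoundaries_nextBoundary_le {i r p : ℕ} (h : r < p) :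
    numBoundaries i p (nextBoundary i r) ≤ r + 2 := by
  classical
  have hspec := Nat.find_spec (exists_lt_ackermannA i r)
  obtain ⟨J, hJ⟩ : ∃ J, Nat.find (exists_lt_ackermannA i r) = J := ⟨_, rfl⟩
  have hmin : ∀ j, j < J → ¬ (1 ≤ j ∧ r < ackermannA (i + 1) j) := fun j hj =>
    Nat.find_min (exists_lt_ackermannA i r) (hJ ▸ hj)
  unfold nextBoundary
  rw [hJ] at hspec ⊢
  obtain ⟨J, rfl⟩ : ∃ k, J = k + 1 := ⟨J - 1, by omega⟩
  have hle : J = 0 ∨ 1 ≤ J ∧ ackermannA (i + 1) J ≤ r := by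
    by_contra! hc
    exact hmin J (by omega) ⟨by omega, hc.2 (by omega)⟩
  cases i with
  | zero =>
    simp only [zero_add, ackermannA_one] at hle ⊢
    refine (card_filter_le _ _).trans ?_
    rw [Nat.card_Ioc, pow_succ]
    obtain rfl | ⟨-, hle⟩ := hle <;> omega
  | succ i =>
    obtain rfl | ⟨h1, hle⟩ := hle
    · rw [ackermannA_add_two_one]
      refine (numBoundaries_le_of_lt (q := 3) (by omega)
        (ackermannA_strictMono (by omega) (by omega))).trans (by omega)
    · obtain ⟨J, rfl⟩ : ∃ k, J = k + 1 := ⟨J - 1, by omega⟩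
      rw [ackermannA_add_two_add_two]
      refine (numBoundaries_le_of_lt (q := ackermannA (i + 2) (J + 1) + 1) (by omega)
        (ackermannA_strictMono (by omega) (by omega))).trans ?_
      have : ackermannA (i + 2) (J + 1) ≤ r := hle
      omega

/-- The potential of a node of rank `r` whose parent has rank `p`, where all ranks are at most
`M`. -/
noncomputable def nodePotential (K M r p : ℕ) : ℕ :=
  ∑ i ∈ range K, numBoundaries i p (nextBoundary i r) + numBoundaries K p M

theorem nodePotential_anti (K M r : ℕ) {p p' : ℕ} (h : p ≤ p') :
    nodePotential K M r p' ≤ nodePotential K M r p :=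
  Nat.add_le_add (sum_le_sum fun _ _ => numBoundaries_anti _ _ h) (numBoundaries_anti _ _ h)

/-- The right side is the potential of a root of rank `r`, so a root loses nothing in the accounts
when it is linked below another. -/
theorem nodePotential_le {K M d r p : ℕ} (hK : 1 ≤ K) (hM : M < ackermannA K d) (h : r < p) :
    nodePotential K M r p ≤ K * (r + 2) + d := by
  refine Nat.add_le_add ?_ ((numBoundaries_le_of_lt hK hM).trans (by omega))
  simpa using sum_le_card_nsmul (range K) _ (r + 2) fun i _ =>
    numBoundaries_nextBoundary_le (i := i) h

theorem exists_level (K r p : ℕ) :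
    ∃ i, i = K + 1 ∨ ∀ b, r < b → b ≤ p → ¬ IsBoundary i b := ⟨K + 1, .inl rfl⟩

open Classical in
/-- The first level at which `r` and `p` lie in the same interval, or `K + 1`. -/
noncomputable def nodeLevel (K r p : ℕ) : ℕ := Nat.find (exists_level K r p)

theorem nodeLevel_le (K r p : ℕ) : nodeLevel K r p ≤ K + 1 := by
  classical
  exact Nat.find_min' _ (.inl rfl)

theorem one_le_nodeLevel {K r p : ℕ} (h : r < p) : 1 ≤ nodeLevel K r p := by
  classical
  have := Nat.find_spec (exists_level K r p)
  by_contra! h0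
  rw [show Nat.find (exists_level K r p) = 0 by unfold nodeLevel at h0; omega] at this
  exact this.elim (by omega) fun h' => h' p h le_rfl (.inl rfl)

/-- Two nodes of the same level on a path: the lower one loses potential when its parent becomes
the root. -/
theorem nodePotential_lt {K M r p s u t : ℕ} (hrp : r < p) (hps : p ≤ s) (hut : u ≤ t)
    (htM : t ≤ M) (hl : nodeLevel K r p = nodeLevel K s u) :
    nodePotential K M r t < nodePotential K M r p := by
  classical
  obtain ⟨i, hi⟩ : ∃ i, nodeLevel K r p = i + 1 :=
    ⟨_, (Nat.sub_add_cancel (one_le_nodeLevel hrp)).symm⟩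
  have hiK : i + 1 ≤ K + 1 := hi ▸ nodeLevel_le K r p
  -- At the level before its own, the upper node is still separated from its parent by a boundary
  -- `b`. The new parent of the lower node passes `b`.
  obtain ⟨b, hsb, hbu, hb⟩ : ∃ b, s < b ∧ b ≤ u ∧ IsBoundary i b := by
    have := Nat.find_min (exists_level K s u) (m := i) (by
      change i < nodeLevel K s u
      omega)
    push Not at this
    exact this.2
  have hpt : p ≤ t := by omega
  by_cases hiK' : i = K
  · subst hiK'
    exact Nat.add_lt_add_of_le_of_lt (sum_le_sum fun _ _ => numBoundaries_anti _ _ hpt)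
      (numBoundaries_lt (b := b) (by omega) (by omega) hb (by omega))
  · refine Nat.add_lt_add_of_lt_of_le ?_ (numBoundaries_anti _ _ hpt)
    refine sum_lt_sum (fun _ _ => numBoundaries_anti _ _ hpt) ⟨i, mem_range.2 (by omega), ?_⟩
    have hp : p < nextBoundary i r := by
      have hsp := Nat.find_spec (exists_level K r p)
      rw [show Nat.find (exists_level K r p) = i + 1 from hi] at hsp
      by_contra! hc
      exact (hsp.resolve_left (by omega)) _ (lt_nextBoundary i r) hc (isBoundary_nextBoundary i r)
    -- If `b` lies beyond the range that is counted, then the end of that range is passed, and it is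
    -- a boundary of level `i` as well.
    by_cases hbt : b ≤ nextBoundary i r
    · exact numBoundaries_lt (b := b) (by omega) (by omega) hb hbt
    · exact numBoundaries_lt hp (by omega) (isBoundary_nextBoundary i r).of_succ le_rfl

section Forest

/-! ### Disjoint-set forests with path compression and union by rank -/

/-- A forest on `V` with parents `par` (`0` at roots), ranks `rk` and roots `ρ`, whose trees
consist of nodes related by `Rel`. -/
structure Forest (V : Finset ℕ) (Rel : ℕ → ℕ → Prop) (par rk ρ : ℕ → ℕ) : Prop where
  mem_left : ∀ v, par v ≠ 0 → v ∈ V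
  mem_right : ∀ v, par v ≠ 0 → par v ∈ V
  rk_lt : ∀ v, par v ≠ 0 → rk v < rk (par v)
  root_of_eq : ∀ v, par v = 0 → ρ v = v
  root_of_ne : ∀ v, par v ≠ 0 → ρ v = ρ (par v)
  par_root : ∀ v, par (ρ v) = 0
  rk_le : ∀ v, rk v ≤ rk (ρ v)
  root_mem : ∀ v ∈ V, ρ v ∈ V
  size : ∀ v ∈ V, par v = 0 → 2 ^ rk v ≤ #{u ∈ V | ρ u = v}
  rel : ∀ v ∈ V, Rel v (ρ v)

/-- The potential of a forest. -/
noncomputable def forestPotential (V : Finset ℕ) (K d M : ℕ) (par rk : ℕ → ℕ) : ℕ :=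
  ∑ v ∈ V, if par v = 0 then K * (rk v + 2) + d else nodePotential K M (rk v) (rk (par v))

/-- The number of trees of a forest. -/
def numRoots (V : Finset ℕ) (par : ℕ → ℕ) : ℕ := #{v ∈ V | par v = 0}

variable {V : Finset ℕ} {Rel : ℕ → ℕ → Prop} {par rk ρ : ℕ → ℕ}

theorem Forest.init (hrefl : ∀ v ∈ V, Rel v v) : Forest V Rel (fun _ => 0) (fun _ => 0) id where
  mem_left := by simp
  mem_right := by simp
  rk_lt := by simp
  root_of_eq := by simp
  root_of_ne := by simp
  par_root := by simp
  rk_le := by simp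
  root_mem := by simp
  size := fun v hv _ => by
    simp only [pow_zero, id]
    exact card_pos.2 ⟨v, by simpa using hv⟩
  rel := by simpa using hrefl

theorem Forest.par_eq_zero_iff (h : Forest V Rel par rk ρ) (v : ℕ) : par v = 0 ↔ ρ v = v :=
  ⟨h.root_of_eq v, fun hv => hv ▸ h.par_root v⟩

/-- Expressed by `ρ`, the count is visibly unaffected by path compression, which preserves `ρ`. -/
theorem Forest.numRoots_eq (h : Forest V Rel par rk ρ) : numRoots V par = #{v ∈ V | ρ v = v} := by
  simp only [numRoots, h.par_eq_zero_iff]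

/-- The walk terminates because ranks increase strictly along it and never exceed the rank of the
root. -/
theorem Forest.exists_path (h : Forest V Rel par rk ρ) (x : ℕ) :
    ∃ t, par^[t] x = ρ x ∧ (∀ s < t, par (par^[s] x) ≠ 0 ∧ ρ (par^[s] x) = ρ x) ∧
      ∀ s s', s < s' → s' ≤ t → rk (par^[s] x) < rk (par^[s'] x) := by
  have h1 : ∃ t, par (par^[t] x) = 0 := by
    by_contra! hc
    have h2 : ∀ t, t ≤ rk (par^[t] x) ∧ ρ (par^[t] x) = ρ x := by
      intro t
      induction t with
      | zero => exact ⟨Nat.zero_le _, rfl⟩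
      | succ t ih =>
        have := h.rk_lt _ (hc t)
        rw [Function.iterate_succ_apply', ← h.root_of_ne _ (hc t)]
        exact ⟨by omega, ih.2⟩
    have h3 := h2 (rk (ρ x) + 1)
    have h4 := h.rk_le (par^[rk (ρ x) + 1] x)
    rw [h3.2] at h4
    omega
  classical
  have hne : ∀ s < Nat.find h1, par (par^[s] x) ≠ 0 := fun s hs => Nat.find_min h1 hs
  have hρ : ∀ s ≤ Nat.find h1, ρ (par^[s] x) = ρ x := by
    intro s hs
    induction s with
    | zero => rfl
    | succ s ih =>
      rw [Function.iterate_succ_apply', ← h.root_of_ne _ (hne s (by omega))]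
      exact ih (by omega)
  refine ⟨Nat.find h1, ?_, fun s hs => ⟨hne s hs, hρ s hs.le⟩, fun s s' hss hs' => ?_⟩
  · rw [← hρ _ le_rfl, h.root_of_eq _ (Nat.find_spec h1)]
  · induction s', hss using Nat.le_induction with
    | base =>
      rw [Function.iterate_succ_apply']
      exact h.rk_lt _ (hne s (by omega))
    | succ k hk ih =>
      rw [Function.iterate_succ_apply']
      exact (ih (by omega)).trans (h.rk_lt _ (hne k (by omega)))

theorem forestPotential_init (K d M : ℕ) :
    forestPotential V K d M (fun _ => 0) (fun _ => 0) = #V * (K * 2 + d) := by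
  simp [forestPotential]

theorem numRoots_init : numRoots V (fun _ => 0) = #V := by simp [numRoots]

/-- A root of rank `r` has at least `2 ^ r` nodes in its tree. They are all related, so `hcard`
bounds the rank by the logarithm of `n` rather than of `#V`. -/
theorem Forest.rk_le_log {n : ℕ} (h : Forest V Rel par rk ρ) (hsymm : ∀ u v, Rel u v → Rel v u)
    (hcard : ∀ v ∈ V, ∀ U ⊆ V, (∀ u ∈ U, Rel v u) → #U ≤ n) {v : ℕ} (hv : v ∈ V) :
    rk v ≤ Nat.log 2 n := by
  refine (h.rk_le v).trans ?_
  have hr := h.root_mem v hv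
  have h1 : #{u ∈ V | ρ u = ρ v} ≤ n := by
    refine hcard _ hr _ (filter_subset _ _) fun u hu => ?_
    rw [mem_filter] at hu
    rw [← hu.2]
    exact hsymm _ _ (h.rel u hu.1)
  have h2 := (h.size _ hr (h.par_root v)).trans h1
  exact Nat.le_log_of_pow_le (by omega) h2

/-! ### Path compression -/

theorem Forest.compress (h : Forest V Rel par rk ρ) (h0 : 0 ∉ V) {N : Finset ℕ} {r : ℕ}
    (hN : ∀ v ∈ N, par v ≠ 0 ∧ ρ v = r) :
    Forest V Rel (fun v => if v ∈ N then r else par v) rk ρ := by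
  have hmem : ∀ v ∈ N, r ∈ V := fun v hv => (hN v hv).2 ▸ h.root_mem v (h.mem_left v (hN v hv).1)
  have hpr : ∀ v ∈ N, par r = 0 ∧ r ∉ N := fun v hv => by
    have h1 : par r = 0 := (hN v hv).2 ▸ h.par_root v
    exact ⟨h1, fun hr => (hN r hr).1 h1⟩
  have hroot : ∀ v, par v = 0 → v ∉ N := fun v hv hn => (hN v hn).1 hv
  constructor
  · intro v hv
    split_ifs at hv with hvN
    · exact h.mem_left v (hN v hvN).1
    · exact h.mem_left v hv
  · intro v hv
    split_ifs at hv ⊢ with hvN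
    · exact hmem v hvN
    · exact h.mem_right v hv
  · intro v hv
    split_ifs at hv ⊢ with hvN
    · obtain ⟨h1, h2⟩ := hN v hvN
      refine (h.rk_lt v h1).trans_le ((h.rk_le _).trans ?_)
      rw [← h.root_of_ne v h1, h2]
    · exact h.rk_lt v hv
  · intro v hv
    split_ifs at hv with hvN
    · exact absurd (hv ▸ hmem v hvN) h0
    · exact h.root_of_eq v hv
  · intro v hv
    split_ifs at hv ⊢ with hvN
    · rw [(hN v hvN).2, h.root_of_eq r (hpr v hvN).1]
    · exact h.root_of_ne v hv
  · intro v
    rw [if_neg (hroot _ (h.par_root v)), h.par_root]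
  · exact h.rk_le
  · exact h.root_mem
  · intro v hv hp
    split_ifs at hp with hvN
    · exact absurd (hp ▸ hmem v hvN) h0
    · exact h.size v hv hp
  · exact h.rel

/-- Of two path nodes of the same level the lower one loses potential. Those that lose nothing thus
have distinct levels, which lie in `[1, K + 1]`. No other node gains, as ranks of parents only grow.
-/
theorem Forest.compress_potential (h : Forest V Rel par rk ρ) (h0 : 0 ∉ V) {N : Finset ℕ} {r : ℕ}
    {K d M : ℕ} (hM : ∀ v ∈ V, rk v ≤ M) (hN : ∀ v ∈ N, par v ≠ 0 ∧ ρ v = r)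
    (hchain : ∀ x ∈ N, ∀ y ∈ N, x ≠ y → rk (par x) ≤ rk y ∨ rk (par y) ≤ rk x) :
    forestPotential V K d M (fun v => if v ∈ N then r else par v) rk + #N ≤
      forestPotential V K d M par rk + (K + 1) := by
  classical
  have hmem : ∀ v ∈ N, r ∈ V := fun v hv => (hN v hv).2 ▸ h.root_mem v (h.mem_left v (hN v hv).1)
  have hr0 : ∀ v ∈ N, r ≠ 0 := fun v hv hr => h0 (hr ▸ hmem v hv)
  have hle : ∀ v ∈ N, rk (par v) ≤ rk r := fun v hv => by
    refine (h.rk_le _).trans ?_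
    rw [← h.root_of_ne v (hN v hv).1, (hN v hv).2]
  have hNV : N ⊆ V := fun v hv => h.mem_left v (hN v hv).1
  set bad := {v ∈ N | ¬ nodePotential K M (rk v) (rk r) < nodePotential K M (rk v) (rk (par v))}
    with hbad
  set good := {v ∈ N | nodePotential K M (rk v) (rk r) < nodePotential K M (rk v) (rk (par v))}
    with hgood
  have hcard : #good + #bad = #N := card_filter_add_card_filter_not _
  have hb : #bad ≤ K + 1 := by
    have hlow : ∀ x ∈ N, ∀ y ∈ N, rk (par x) ≤ rk y →
        nodeLevel K (rk x) (rk (par x)) = nodeLevel K (rk y) (rk (par y)) → x ∉ bad := by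
      intro x hx y hy hxy hl hxb
      exact (mem_filter.1 hxb).2 (nodePotential_lt (h.rk_lt x (hN x hx).1) hxy (hle y hy)
        (hM r (hmem x hx)) hl)
    calc #bad = #(bad.image fun v => nodeLevel K (rk v) (rk (par v))) := by
          refine (card_image_of_injOn fun x hx y hy hxy => ?_).symm
          by_contra hne
          have hx' := (mem_filter.1 hx).1
          have hy' := (mem_filter.1 hy).1
          obtain h1 | h1 := hchain x hx' y hy' hne
          · exact hlow x hx' y hy' h1 hxy hx
          · exact hlow y hy' x hx' h1 hxy.symm hy
      _ ≤ #(Icc 1 (K + 1)) := by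
          refine card_le_card fun l hl => ?_
          obtain ⟨v, hv, rfl⟩ := mem_image.1 hl
          have hv' := (mem_filter.1 hv).1
          exact mem_Icc.2 ⟨one_le_nodeLevel (h.rk_lt v (hN v hv').1), nodeLevel_le _ _ _⟩
      _ = K + 1 := by simp
  have hg : forestPotential V K d M (fun v => if v ∈ N then r else par v) rk + #good ≤
      forestPotential V K d M par rk := by
    have hgV : good ⊆ V := (filter_subset _ _).trans hNV
    have e : #good = ∑ v ∈ V, if v ∈ good then 1 else 0 := by
      rw [sum_ite_mem, inter_eq_right.2 hgV, sum_const, smul_eq_mul, mul_one]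
    rw [e, forestPotential, forestPotential, ← sum_add_distrib]
    refine sum_le_sum fun v hv => ?_
    by_cases hvN : v ∈ N
    · rw [if_pos hvN, if_neg (hr0 v hvN), if_neg (hN v hvN).1]
      by_cases hvg : v ∈ good
      · rw [if_pos hvg]
        exact (mem_filter.1 hvg).2
      · rw [if_neg hvg]
        exact nodePotential_anti _ _ _ (hle v hvN)
    · have hvg : v ∉ good := fun hvg => hvN (mem_filter.1 hvg).1
      rw [if_neg hvN, if_neg hvg, add_zero]
  omega

/-! ### Linking by rank -/

theorem Forest.link (h : Forest V Rel par rk ρ) (h0 : 0 ∉ V)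
    (htrans : ∀ u v z, Rel u v → Rel v z → Rel u z)
    {a b : ℕ} {rk' : ℕ → ℕ} (ha : a ∈ V) (hb : b ∈ V) (hpa : par a = 0) (hpb : par b = 0)
    (hab : a ≠ b) (hR : Rel a b)
    (hrk : rk a < rk b ∧ rk' = rk ∨ rk a = rk b ∧ rk' = Function.update rk b (rk b + 1)) :
    Forest V Rel (Function.update par a b) rk' (fun v => if ρ v = a then b else ρ v) := by
  classical
  have hb0 : b ≠ 0 := fun hb0 => h0 (hb0 ▸ hb)
  have hne : ∀ v, v ≠ b → rk' v = rk v := fun v hv => by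
    obtain ⟨-, rfl⟩ | ⟨-, rfl⟩ := hrk
    · rfl
    · exact Function.update_of_ne hv _ _
  have hge : ∀ v, rk v ≤ rk' v := fun v => by
    obtain ⟨-, rfl⟩ | ⟨-, rfl⟩ := hrk
    · rfl
    · rw [Function.update_apply]
      split_ifs with hvb
      · subst hvb; omega
      · rfl
  have hlt : rk a < rk' b := by
    obtain ⟨h1, rfl⟩ | ⟨h1, rfl⟩ := hrk
    · exact h1
    · rw [Function.update_self]; omega
  have hnr : ∀ v, par v ≠ 0 → v ≠ b := fun v hv hvb => hv (hvb ▸ hpb)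
  constructor
  · intro v hv
    rw [Function.update_apply] at hv
    split_ifs at hv with hva
    · exact hva ▸ ha
    · exact h.mem_left v hv
  · intro v hv
    rw [Function.update_apply] at hv ⊢
    split_ifs at hv ⊢ with hva
    · exact hb
    · exact h.mem_right v hv
  · intro v hv
    rw [Function.update_apply] at hv ⊢
    split_ifs at hv ⊢ with hva
    · rw [hva, hne a hab]
      exact hlt
    · rw [hne v (hnr v hv)]
      exact (h.rk_lt v hv).trans_le (hge _)
  · intro v hv
    rw [Function.update_apply] at hv
    split_ifs at hv with hva
    · exact absurd hv hb0
    · rw [h.root_of_eq v hv, if_neg hva]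
  · intro v hv
    rw [Function.update_apply] at hv ⊢
    split_ifs at hv with hva
    · rw [if_pos hva, hva, h.root_of_eq a hpa, h.root_of_eq b hpb, if_pos rfl, if_neg hab.symm]
    · rw [if_neg hva, h.root_of_ne v hv]
  · intro v
    split_ifs with hva
    · rw [Function.update_of_ne hab.symm, hpb]
    · rw [Function.update_of_ne hva, h.par_root]
  · intro v
    split_ifs with hva
    · by_cases hvb : v = b
      · rw [hvb]
      · rw [hne v hvb]
        exact ((h.rk_le v).trans (hva ▸ hlt.le))
    · by_cases hvb : v = b
      · rw [hvb, h.root_of_eq b hpb]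
      · rw [hne v hvb]
        exact (h.rk_le v).trans (hge _)
  · intro v hv
    split_ifs
    · exact hb
    · exact h.root_mem v hv
  · intro v hv hp
    rw [Function.update_apply] at hp
    split_ifs at hp with hva
    · exact absurd hp hb0
    by_cases hvb : v = b
    · subst hvb
      have hd : Disjoint {u ∈ V | ρ u = a} {u ∈ V | ρ u = v} := by
        refine disjoint_filter.2 fun u _ h1 h2 => hab (h1.symm.trans h2)
      have hs : {u ∈ V | ρ u = a} ∪ {u ∈ V | ρ u = v} ⊆
          {u ∈ V | (if ρ u = a then v else ρ u) = v} := by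
        intro u hu
        rw [mem_union, mem_filter, mem_filter] at hu
        rw [mem_filter]
        obtain ⟨h1, h2⟩ | ⟨h1, h2⟩ := hu
        · exact ⟨h1, if_pos h2⟩
        · exact ⟨h1, by rw [h2, if_neg hva]⟩
      have hc := card_le_card hs
      rw [card_union_of_disjoint hd] at hc
      have h1 := h.size a ha hpa
      have h2 := h.size v hb hpb
      obtain ⟨-, rfl⟩ | ⟨he, rfl⟩ := hrk
      · omega
      · rw [Function.update_self, pow_succ]
        rw [he] at h1
        omega
    · rw [hne v hvb]
      refine (h.size v hv hp).trans (card_le_card fun u hu => ?_)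
      rw [mem_filter] at hu ⊢
      exact ⟨hu.1, by rw [hu.2, if_neg hva]⟩
  · intro v hv
    split_ifs with hva
    · exact htrans _ _ _ (hva ▸ h.rel v hv) hR
    · exact h.rel v hv

/-- Only `b` can gain: its rank grows by at most one, which costs `K`. The former root `a` is
covered by `nodePotential_le`, and for the children of `b` the rank of the parent does not decrease.
-/
theorem link_potential (h0 : 0 ∉ V) {K d M : ℕ} (hK : 1 ≤ K)
    (hd : M < ackermannA K d)
    {a b : ℕ} {rk' : ℕ → ℕ} (hb : b ∈ V) (hpa : par a = 0) (hpb : par b = 0) (hab : a ≠ b)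
    (hrk : rk a < rk b ∧ rk' = rk ∨ rk a = rk b ∧ rk' = Function.update rk b (rk b + 1)) :
    forestPotential V K d M (Function.update par a b) rk' ≤ forestPotential V K d M par rk + K := by
  classical
  have hb0 : b ≠ 0 := fun hb0 => h0 (hb0 ▸ hb)
  have e : K = ∑ v ∈ V, if v = b then K else 0 := by simp [hb]
  conv_rhs => rw [e, forestPotential, ← sum_add_distrib]
  rw [forestPotential, ← e]
  refine sum_le_sum fun v hv => ?_
  have hge : ∀ v, rk v ≤ rk' v := fun v => by
    obtain ⟨-, rfl⟩ | ⟨-, rfl⟩ := hrk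
    · rfl
    · rw [Function.update_apply]
      split_ifs with hvb
      · subst hvb; omega
      · rfl
  have hlt : rk' a < rk' b := by
    obtain ⟨h1, rfl⟩ | ⟨h1, rfl⟩ := hrk
    · exact h1
    · rw [Function.update_self, Function.update_of_ne hab]; omega
  by_cases hvb : v = b
  · subst hvb
    rw [Function.update_of_ne hab.symm, if_pos hpb, if_pos hpb, if_pos rfl]
    have : rk' v ≤ rk v + 1 := by
      obtain ⟨-, rfl⟩ | ⟨-, rfl⟩ := hrk
      · omega
      · rw [Function.update_self]
    nlinarith
  · have hne : rk' v = rk v := by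
      obtain ⟨-, rfl⟩ | ⟨-, rfl⟩ := hrk
      · rfl
      · exact Function.update_of_ne hvb _ _
    rw [if_neg hvb, add_zero]
    by_cases hva : v = a
    · subst hva
      rw [Function.update_self, if_neg hb0]
      rw [if_pos hpa, ← hne]
      exact nodePotential_le hK hd hlt
    · rw [Function.update_of_ne hva, hne]
      split_ifs
      · rfl
      · exact nodePotential_anti _ _ _ (hge _)

theorem numRoots_link {a b : ℕ} (ha : a ∈ V) (hb : b ≠ 0) (hpa : par a = 0) :
    numRoots V (Function.update par a b) + 1 = numRoots V par := by
  classical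
  have : {v ∈ V | Function.update par a b v = 0} = {v ∈ V | par v = 0}.erase a := by
    ext v
    simp only [mem_filter, mem_erase, Function.update_apply]
    by_cases hva : v = a
    · simp [hva, hb]
    · simp [hva]
  rw [numRoots, this, numRoots, card_erase_add_one]
  simp [ha, hpa]

end Forest

section DisjointSets

/-! ### Disjoint sets on the machine

Array `0` holds the parents and array `1` the ranks. -/

/-- Puts the root of the node in register `13` into register `14`, and compresses the path. -/
def findProgram : Program :=
  .seq (.assign 14 (.reg 13)) <|
  .seq (.loop (.cell 0 (.reg 14)) (.assign 14 (.cell 0 (.reg 14)))) <|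
  .loop (.cell 0 (.reg 13)) <|
    .seq (.assign 15 (.cell 0 (.reg 13))) <|
    .seq (.store 0 (.reg 13) (.reg 14)) (.assign 13 (.reg 15))

/-- Links the distinct roots in the registers `14` and `16`. -/
def linkProgram : Program :=
  .ite (.op .less (.cell 1 (.reg 14)) (.cell 1 (.reg 16)))
    (.store 0 (.reg 14) (.reg 16)) <|
    .seq (.store 0 (.reg 16) (.reg 14)) <|
    .ite (.op .equal (.cell 1 (.reg 14)) (.cell 1 (.reg 16)))
      (.store 1 (.reg 14) (.op .plus (.cell 1 (.reg 14)) (.const 1))) .skip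

variable {S : Type*} {W n : ℕ} {w : ℕ → S} {V : Finset ℕ} {Rel : ℕ → ℕ → Prop} {ρ : ℕ → ℕ}

/-- An edge of the path costs 6 steps in the walk to the root and 11 in the compressing pass. With
weight 17, the drop of the potential pays for all but `K + 1` edges; the remaining 17 cover the
fixed costs. -/
theorem reach_find {m : State} {K d M : ℕ} (h : Forest V Rel (m.arr 0) (m.arr 1) ρ) (h0 : 0 ∉ V)
    (hW : ∀ v ∈ V, v < W) (hM : ∀ v ∈ V, m.arr 1 v ≤ M) (hx : m.reg 13 ∈ V) :
    Reach W n w findProgram m fun m' T =>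
      m'.reg 14 = ρ (m.reg 13) ∧
      (∀ y, y ≠ 13 → y ≠ 14 → y ≠ 15 → m'.reg y = m.reg y) ∧
      (∀ a, a ≠ 0 → m'.arr a = m.arr a) ∧
      Forest V Rel (m'.arr 0) (m'.arr 1) ρ ∧
      T + 17 * forestPotential V K d M (m'.arr 0) (m'.arr 1) ≤
        17 * forestPotential V K d M (m.arr 0) (m.arr 1) + 17 * (K + 2) := by
  classical
  obtain ⟨t, ht, hpath, hinc⟩ := h.exists_path (m.reg 13)
  set P := m.arr 0 with hP
  set x := m.reg 13 with hxdef
  set y : ℕ → ℕ := fun s => P^[s] x with hy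
  have hysucc : ∀ s, P (y s) = y (s + 1) := fun s => (Function.iterate_succ_apply' P s x).symm
  have hyt : y t = ρ x := ht
  have hρV := h.root_mem x hx
  have hyV : ∀ s ≤ t, y s ∈ V := by
    intro s hs
    obtain hs | rfl := hs.lt_or_eq
    · exact h.mem_left _ (hpath s hs).1
    · exact hyt ▸ hρV
  have hW0 : 0 < W := (Nat.zero_le _).trans_lt (hW x hx)
  have hPW : ∀ s ≤ t, P (y s) < W := by
    intro s hs
    by_cases h1 : P (y s) = 0
    · omega
    · exact hW _ (h.mem_right _ h1)
  have hyne : ∀ s ≤ t, y s ∉ (range s).image y := by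
    intro s hs hc
    obtain ⟨s', hs', he⟩ := mem_image.1 hc
    exact (hinc s' s (mem_range.1 hs') hs).ne (congrArg _ he)
  have hinj : Set.InjOn y (range t) := by
    intro a ha b hb hab
    have ha := mem_range.1 ha
    have hb := mem_range.1 hb
    by_contra hne
    obtain hlt | hlt := Nat.lt_or_gt_of_ne hne
    · exact (hinc a b hlt hb.le).ne (congrArg _ hab)
    · exact (hinc b a hlt ha.le).ne (congrArg _ hab.symm)
  have hNprop : ∀ v ∈ (range t).image y, P v ≠ 0 ∧ ρ v = ρ x := by
    intro v hv
    obtain ⟨s, hs, rfl⟩ := mem_image.1 hv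
    exact hpath s (mem_range.1 hs)
  have hpot := h.compress_potential h0 (K := K) (d := d) hM hNprop <| by
    intro a ha b hb hab
    obtain ⟨s, hs, rfl⟩ := mem_image.1 ha
    obtain ⟨s', hs', rfl⟩ := mem_image.1 hb
    rw [mem_range] at hs hs'
    rw [hysucc, hysucc]
    obtain hlt | rfl | hlt := Nat.lt_trichotomy s s'
    · left
      obtain h1 | h1 : s + 1 < s' ∨ s + 1 = s' := by omega
      · exact (hinc _ _ h1 hs'.le).le
      · rw [h1]
    · exact absurd rfl hab
    · right
      obtain h1 | h1 : s' + 1 < s ∨ s' + 1 = s := by omega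
      · exact (hinc _ _ h1 hs.le).le
      · rw [h1]
  rw [card_image_of_injOn hinj, card_range] at hpot
  refine Reach.seq (Reach.assign (by simpa [Expr.Fits] using hW _ hx) ?_)
  refine Reach.seq (Reach.loop (N := 6 * t)
    (fun N m' => ∃ s ≤ t, N = 6 * (t - s) ∧ m'.arr = m.arr ∧ m'.reg 14 = y s ∧
      ∀ z, z ≠ 14 → m'.reg z = m.reg z) ?_ ?_ ?_ ?_)
  · rintro N m' ⟨s, hs, -, ha, h14, -⟩
    simp only [Expr.Fits, Expr.eval, ha, h14]
    exact ⟨hW _ (hyV s hs), hPW s hs⟩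
  · rintro N m' ⟨s, hs, hN, ha, h14, hr⟩ he
    simp only [Expr.eval, ha, h14] at he
    have hst : s < t := by
      obtain hs | rfl := hs.lt_or_eq
      · exact hs
      · rw [hyt] at he
        exact absurd (h.par_root x) he
    refine Reach.assign ?_ ⟨6 * (t - (s + 1)), ⟨s + 1, hst, rfl, ?_, ?_, ?_⟩, ?_⟩
    · simp only [Expr.Fits, Expr.eval, ha, h14]
      exact ⟨hW _ (hyV s hs), hPW s hs⟩
    · simpa using ha
    · simp only [State.setReg_reg, if_pos, Expr.eval, ha, h14]
      exact hysucc s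
    · intro z hz
      simp [hz, hr]
    · simp only [Expr.cost]
      omega
  · refine ⟨0, Nat.zero_le _, by simp, rfl, by simp [Expr.eval, hy, hxdef],
      fun z hz => by simp [hz]⟩
  rintro N m₁ T₁ ⟨s, hs, hN, ha, h14, hr⟩ he₁ hT₁
  simp only [Expr.eval, ha, h14] at he₁
  have hst : s = t := by
    by_contra hne
    exact (hpath s (by omega)).1 he₁
  subst hst
  rw [hyt] at h14
  refine Reach.loop (N := 11 * s)
    (fun N m' => ∃ u ≤ s, N = 11 * (s - u) ∧
      (m'.arr 0 = fun v => if v ∈ (range u).image y then ρ x else P v) ∧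
      (∀ a, a ≠ 0 → m'.arr a = m.arr a) ∧ m'.reg 13 = y u ∧ m'.reg 14 = ρ x ∧
      ∀ z, z ≠ 13 → z ≠ 14 → z ≠ 15 → m'.reg z = m.reg z) ?_ ?_ ?_ ?_
  · rintro N m' ⟨u, hu, -, ha0, -, h13, -, -⟩
    simp only [Expr.Fits, Expr.eval, ha0, h13, if_neg (hyne u hu)]
    exact ⟨hW _ (hyV u hu), hPW u hu⟩
  · rintro N m' ⟨u, hu, hN, ha0, ha, h13, h14, hr⟩ he
    simp only [Expr.eval, ha0, h13, if_neg (hyne u hu)] at he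
    have hut : u < s := by
      obtain hu | rfl := hu.lt_or_eq
      · exact hu
      · rw [hyt] at he
        exact absurd (h.par_root x) he
    have hval : m'.arr 0 (y u) = P (y u) := by
      rw [ha0]
      exact if_neg (hyne u hu)
    refine Reach.seq (Reach.assign ?_ (Reach.seq (Reach.store ?_ ?_ (Reach.assign ?_
      ⟨11 * (s - (u + 1)), ⟨u + 1, hut, rfl, ?_, ?_, ?_, ?_, ?_⟩, ?_⟩))))
    · simp only [Expr.Fits, Expr.eval, ha0, h13, if_neg (hyne u hu)]
      exact ⟨hW _ (hyV u hu), hPW u hu⟩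
    · simpa [Expr.Fits, h13] using hW _ (hyV u hu)
    · simpa [Expr.Fits, h14] using hW _ hρV
    · simpa [Expr.Fits, Expr.eval, hval, h13] using hPW u hu
    · funext v
      simp only [State.setReg_arr, State.setCell_arr, if_pos, Expr.eval, State.setReg_reg,
        Function.update_apply, ha0, h13, h14, range_add_one, image_insert, mem_insert]
      by_cases hv : v = y u <;> simp [hv]
    · intro a ha'
      simp [ha', ha]
    · simp [Expr.eval, hval, h13, hysucc]
    · simp [h14]
    · intro z h1 h2 h3
      simp [h1, h3, hr z h1 h2 h3]
    · simp only [Expr.cost]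
      omega
  · refine ⟨0, Nat.zero_le _, by simp, ?_, ?_, ?_, h14, ?_⟩
    · simp [ha, ← hP]
    · simp [ha]
    · simp [hr, hy, ← hxdef]
    · intro z _ h2 _
      exact hr z h2
  · rintro N' m' T ⟨u, hu, hN, ha0, ha', h13, h14, hr'⟩ he hT
    simp only [Expr.eval, ha0, h13, if_neg (hyne u hu)] at he
    have hut : u = s := by
      by_contra hne
      exact (hpath u (by omega)).1 he
    subst hut
    refine ⟨h14, hr', ha', ?_, ?_⟩
    · rw [ha0, ha' 1 (by omega)]
      exact h.compress h0 hNprop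
    · rw [ha0, ha' 1 (by omega)]
      simp only [Expr.cost] at hT hT₁ ⊢
      omega

/-- The ranks decide which root goes below the other. The equation of pairs leaves this open, since
the application needs only that `a` is one of the two. -/
theorem reach_link {m : State} {K d M : ℕ} (h : Forest V Rel (m.arr 0) (m.arr 1) ρ) (h0 : 0 ∉ V)
    (hsymm : ∀ u v, Rel u v → Rel v u) (htrans : ∀ u v z, Rel u v → Rel v z → Rel u z)
    (hK : 1 ≤ K) (hd : M < ackermannA K d)
    (hW : ∀ v ∈ V, v < W) (hMW : M + 2 ≤ W) (hM : ∀ v ∈ V, m.arr 1 v ≤ M)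
    (ha : m.reg 14 ∈ V) (hb : m.reg 16 ∈ V)
    (hpa : m.arr 0 (m.reg 14) = 0) (hpb : m.arr 0 (m.reg 16) = 0) (hab : m.reg 14 ≠ m.reg 16)
    (hR : Rel (m.reg 14) (m.reg 16)) :
    Reach W n w linkProgram m fun m' T =>
      m'.reg = m.reg ∧
      (∀ a, a ≠ 0 → a ≠ 1 → m'.arr a = m.arr a) ∧
      (∃ a b, ({a, b} : Set ℕ) = {m.reg 14, m.reg 16} ∧
        Forest V Rel (m'.arr 0) (m'.arr 1) fun v => if ρ v = a then b else ρ v) ∧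
      numRoots V (m'.arr 0) + 1 = numRoots V (m.arr 0) ∧
      T ≤ 25 ∧
      forestPotential V K d M (m'.arr 0) (m'.arr 1) ≤
        forestPotential V K d M (m.arr 0) (m.arr 1) + K := by
  have hA := hW _ ha
  have hB := hW _ hb
  have hMA := hM _ ha
  have hMB := hM _ hb
  have hA0 : m.reg 14 ≠ 0 := fun he => h0 (he ▸ ha)
  have hB0 : m.reg 16 ≠ 0 := fun he => h0 (he ▸ hb)
  refine Reach.ite ?_ (fun he => ?_) (fun he => ?_)
  · simp only [Expr.Fits, Expr.eval]
    exact ⟨⟨hA, by omega⟩, ⟨hB, by omega⟩, BinOp.less_eval_lt (by omega) _ _⟩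
  · simp only [Expr.eval, ne_eq, BinOp.less_eval_eq_zero, not_le] at he
    refine Reach.store hA hB ⟨rfl, ?_, ⟨m.reg 14, m.reg 16, rfl, ?_⟩, ?_, ?_, ?_⟩
    · intro a h1 _
      simp [h1]
    · simpa [Expr.eval] using h.link h0 htrans ha hb hpa hpb hab hR (.inl ⟨he, rfl⟩)
    · simpa [Expr.eval] using numRoots_link ha hB0 hpa
    · simp [Expr.cost]
    · simpa [Expr.eval] using
        link_potential h0 hK hd hb hpa hpb hab (.inl ⟨he, rfl⟩)
  · simp only [Expr.eval, BinOp.less_eval_eq_zero] at he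
    refine Reach.seq (Reach.store hB hA (Reach.ite ?_ (fun he' => ?_) (fun he' => ?_)))
    · simp only [Expr.Fits, Expr.eval, State.setCell_reg, State.setCell_arr, one_ne_zero, if_false]
      exact ⟨⟨hA, by omega⟩, ⟨hB, by omega⟩, BinOp.equal_eval_lt (by omega) _ _⟩
    · simp only [Expr.eval, BinOp.equal_eval_eq_zero, State.setCell_reg, State.setCell_arr,
        one_ne_zero, if_false, ne_eq, not_not] at he'
      refine Reach.store hA ?_ ⟨rfl, ?_, ⟨m.reg 16, m.reg 14, Set.pair_comm _ _, ?_⟩, ?_, ?_, ?_⟩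
      · simp only [Expr.Fits, Expr.eval, BinOp.eval, State.setCell_reg, State.setCell_arr,
          one_ne_zero, if_false]
        omega
      · intro a h1 h2
        simp [h1, h2]
      · simpa [Expr.eval, BinOp.eval] using h.link h0 htrans hb ha hpb hpa hab.symm
          (hsymm _ _ hR) (.inr ⟨he'.symm, rfl⟩)
      · simpa [Expr.eval] using numRoots_link hb hA0 hpb
      · simp [Expr.cost]
      · simpa [Expr.eval, BinOp.eval] using
          link_potential h0 hK hd ha hpb hpa hab.symm (.inr ⟨he'.symm, rfl⟩)
    · simp only [Expr.eval, BinOp.equal_eval_eq_zero, State.setCell_reg, State.setCell_arr,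
        one_ne_zero, if_false] at he'
      have hlt : m.arr 1 (m.reg 16) < m.arr 1 (m.reg 14) := by omega
      refine Reach.skip ⟨rfl, ?_, ⟨m.reg 16, m.reg 14, Set.pair_comm _ _, ?_⟩, ?_, ?_, ?_⟩
      · intro a h1 _
        simp [h1]
      · simpa [Expr.eval, BinOp.eval] using h.link h0 htrans hb ha hpb hpa hab.symm
          (hsymm _ _ hR) (.inl ⟨hlt, rfl⟩)
      · simpa [Expr.eval] using numRoots_link hb hA0 hpb
      · simp [Expr.cost]
      · simpa [Expr.eval] using
          link_potential h0 hK hd ha hpb hpa hab.symm (.inl ⟨hlt, rfl⟩)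

end DisjointSets

section Blocks

/-! ### Sparse sets of positions -/

/-- The lowest `l` digits of `x` in base `4` differ from `3`. -/
def InSparse : ℕ → ℕ → Prop
  | 0, _ => True
  | l + 1, x => x % 4 ≠ 3 ∧ InSparse l (x / 4)

instance : ∀ l x, Decidable (InSparse l x)
  | 0, _ => isTrue trivial
  | l + 1, x => @instDecidableAnd _ _ _ (instDecidableInSparse l (x / 4))

/-- The definition strips the lowest digit, whereas the algorithm inspects the highest relevant one;
this mediates between the two. -/
theorem inSparse_succ_iff (l x : ℕ) :
    InSparse (l + 1) x ↔ InSparse l x ∧ x / 4 ^ l % 4 ≠ 3 := by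
  induction l generalizing x with
  | zero => simp [InSparse]
  | succ l ih =>
    rw [InSparse, ih, InSparse, Nat.div_div_eq_div_mul, ← pow_succ', and_assoc]

theorem InSparse.of_le {l l' x : ℕ} (h : InSparse l' x) (hl : l ≤ l') : InSparse l x := by
  induction l', hl using Nat.le_induction with
  | base => exact h
  | succ k _ ih => exact ih ((inSparse_succ_iff k x).1 h).1

/-- Multiples of `4 ^ l` leave the lowest `l` digits alone. Hence positions stay sparse when a block
is passed over, and so do the starts of the four parts of a block. -/
theorem inSparse_add_mul (l x c : ℕ) : InSparse l (x + c * 4 ^ l) ↔ InSparse l x := by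
  induction l generalizing x with
  | zero => simp [InSparse]
  | succ l ih =>
    have h1 : x + c * 4 ^ (l + 1) = x + 4 * (c * 4 ^ l) := by ring
    rw [InSparse, InSparse, h1, Nat.add_mul_mod_self_left,
      Nat.add_mul_div_left _ _ (by norm_num), ih]

/-- How many steps of length `u = 4 ^ l` lead from positions `p` and `q` that are sparse at level
`l` to positions that are sparse at level `l + 1`. -/
def stepsUp (p q u : ℕ) : ℕ :=
  if p / u % 4 = 3 ∨ q / u % 4 = 3 then if p / u % 4 = 2 ∨ q / u % 4 = 2 then 2 else 1 else 0

theorem stepsUp_le (p q u : ℕ) : stepsUp p q u ≤ 2 := by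
  unfold stepsUp
  split_ifs <;> omega

/-- If one digit is 3, a step turns it into 0. The step is harmful only if the other digit is 2 and
becomes 3; a second step then leaves the digits 1 and 0. -/
theorem inSparse_stepsUp {l p q : ℕ} (hp : InSparse l p) (hq : InSparse l q) :
    InSparse (l + 1) (p + stepsUp p q (4 ^ l) * 4 ^ l) ∧
      InSparse (l + 1) (q + stepsUp p q (4 ^ l) * 4 ^ l) := by
  have h4 : 0 < 4 ^ l := by positivity
  rw [inSparse_succ_iff, inSparse_succ_iff, inSparse_add_mul, inSparse_add_mul,
    Nat.add_mul_div_right _ _ h4, Nat.add_mul_div_right _ _ h4]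
  refine ⟨⟨hp, ?_⟩, hq, ?_⟩ <;> unfold stepsUp <;> split_ifs <;> omega

theorem card_inSparse (l N : ℕ) : #{x ∈ range (N * 4 ^ l) | InSparse l x} = N * 3 ^ l := by
  induction l with
  | zero => simp [InSparse]
  | succ l ih =>
    have h : {x ∈ range (N * 4 ^ (l + 1)) | InSparse (l + 1) x} =
        ({x ∈ range (N * 4 ^ l) | InSparse l x} ×ˢ range 3).image fun z => 4 * z.1 + z.2 := by
      have hp : N * 4 ^ (l + 1) = 4 * (N * 4 ^ l) := by ring
      ext x
      simp only [mem_filter, mem_range, mem_image, mem_product, Prod.exists, InSparse, hp]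
      constructor
      · rintro ⟨h1, h2, h3⟩
        exact ⟨x / 4, x % 4, ⟨⟨by omega, h3⟩, by omega⟩, by omega⟩
      · rintro ⟨y, c, ⟨⟨h1, h2⟩, h3⟩, rfl⟩
        refine ⟨by omega, by omega, ?_⟩
        rwa [show (4 * y + c) / 4 = y by omega]
    rw [h, card_image_of_injOn, card_product, ih, card_range, pow_succ, mul_assoc]
    rintro ⟨a, b⟩ h1 ⟨c, d⟩ h2 h3
    simp only [coe_product, Set.mem_prod, mem_coe, mem_range] at h1 h2
    dsimp only at h3
    rw [Prod.mk.injEq]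
    omega

/-! ### Blocks

The block of level `l` at position `x` is the factor of length `4 ^ l` that begins there. It is
represented by the number `l * (n + 1) + x`. -/

/-- The number of a block. -/
def blockIndex (n l x : ℕ) : ℕ := l * (n + 1) + x

theorem blockIndex_div {n l x : ℕ} (hx : x ≤ n) : blockIndex n l x / (n + 1) = l := by
  rw [blockIndex, mul_comm, Nat.mul_add_div (by omega), Nat.div_eq_of_lt (by omega), add_zero]

theorem blockIndex_mod {n l x : ℕ} (hx : x ≤ n) : blockIndex n l x % (n + 1) = x := by
  rw [blockIndex, mul_comm, Nat.mul_add_mod, Nat.mod_eq_of_lt (by omega)]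

/-- The blocks that begin at sparse positions. -/
def sparseBlocks (n : ℕ) : Finset ℕ :=
  {u ∈ range ((n + 1) * (n + 1)) | 1 ≤ u / (n + 1) ∧ 4 ^ (u / (n + 1)) ≤ 4 * n ∧
    1 ≤ u % (n + 1) ∧ InSparse (u / (n + 1)) (u % (n + 1))}

theorem le_of_four_pow_le {l n : ℕ} (h : 4 ^ l ≤ 4 * n) : l ≤ n := by
  cases l with
  | zero => omega
  | succ l =>
    have := Nat.lt_pow_self (n := l) (show 1 < 4 by norm_num)
    rw [pow_succ] at h
    omega

theorem blockIndex_mem {n l x : ℕ} (hl : 1 ≤ l) (hl' : 4 ^ l ≤ 4 * n) (hx : 1 ≤ x) (hx' : x ≤ n)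
    (h : InSparse l x) : blockIndex n l x ∈ sparseBlocks n := by
  rw [sparseBlocks, mem_filter, mem_range, blockIndex_div hx', blockIndex_mod hx']
  refine ⟨?_, hl, hl', hx, h⟩
  have := Nat.mul_le_mul_right (n + 1) (le_of_four_pow_le hl')
  rw [blockIndex, add_mul]
  omega

theorem zero_notMem_sparseBlocks (n : ℕ) : 0 ∉ sparseBlocks n := by
  simp [sparseBlocks]

theorem lt_of_mem_sparseBlocks {n u : ℕ} (h : u ∈ sparseBlocks n) : u < (n + 1) * (n + 1) :=
  mem_range.1 (mem_filter.1 h).1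

/-- Level `l` contributes at most `(n / 4 ^ l + 1) * 3 ^ l` blocks. From `4 ^ l ≤ 4 * n` follows `1
≤ 4 * n / 4 ^ l`, which turns this into `5 * n * (3 / 4) ^ l`, and the geometric series has sum 4.
-/
theorem card_sparseBlocks_le (n : ℕ) : #(sparseBlocks n) ≤ 20 * n := by
  set L := {l ∈ range (n + 1) | 4 ^ l ≤ 4 * n} with hL
  have h1 : sparseBlocks n ⊆ L.biUnion fun l =>
      ({x ∈ range ((n / 4 ^ l + 1) * 4 ^ l) | InSparse l x}).image (blockIndex n l) := by
    intro u hu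
    rw [sparseBlocks, mem_filter] at hu
    obtain ⟨-, -, h2, -, h4⟩ := hu
    refine mem_biUnion.2 ⟨u / (n + 1), ?_, mem_image.2 ⟨u % (n + 1), ?_, ?_⟩⟩
    · have := le_of_four_pow_le h2
      exact mem_filter.2 ⟨mem_range.2 (by omega), h2⟩
    · refine mem_filter.2 ⟨mem_range.2 ?_, h4⟩
      have h5 := Nat.mod_lt u (show n + 1 > 0 by omega)
      have h6 := Nat.lt_div_mul_add (a := n) (b := 4 ^ (u / (n + 1))) (by positivity)
      rw [add_mul]
      omega
    · rw [blockIndex, mul_comm, Nat.div_add_mod]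
  have h2 : ∀ l ∈ L, (((n / 4 ^ l + 1) * 3 ^ l : ℕ) : ℝ) ≤ 5 * n * (3 / 4 : ℝ) ^ l := by
    intro l hl
    have hl' : (4 : ℝ) ^ l ≤ 4 * n := by exact_mod_cast (mem_filter.1 hl).2
    have h3 : (((n / 4 ^ l : ℕ)) : ℝ) ≤ n / 4 ^ l := by
      simpa using Nat.cast_div_le (α := ℝ) (m := n) (n := 4 ^ l)
    have h4 : (0 : ℝ) < 4 ^ l := by positivity
    have h5 : (1 : ℝ) ≤ 4 * n / 4 ^ l := by rwa [le_div_iff₀ h4, one_mul]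
    have h6 : ((n : ℝ) / 4 ^ l + 4 * n / 4 ^ l) * 3 ^ l = 5 * n * (3 / 4 : ℝ) ^ l := by
      rw [div_pow]; ring
    push_cast
    rw [← h6]
    gcongr
  have h3 : (#(sparseBlocks n) : ℝ) ≤ 20 * n := by
    calc (#(sparseBlocks n) : ℝ) ≤ ∑ l ∈ L, (((n / 4 ^ l + 1) * 3 ^ l : ℕ) : ℝ) := by
          rw [← Nat.cast_sum]
          refine Nat.cast_le.2 ((card_le_card h1).trans (card_biUnion_le.trans ?_))
          exact sum_le_sum fun l _ => card_image_le.trans (card_inSparse _ _).le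
      _ ≤ ∑ l ∈ L, 5 * n * (3 / 4 : ℝ) ^ l := sum_le_sum h2
      _ = 5 * n * ∑ l ∈ L, (3 / 4 : ℝ) ^ l := (mul_sum _ _ _).symm
      _ ≤ 5 * n * 4 := by
          gcongr
          have h4 := (summable_geometric_of_lt_one (r := (3 / 4 : ℝ)) (by norm_num)
            (by norm_num)).sum_le_tsum L fun _ _ => by positivity
          rw [tsum_geometric_of_lt_one (by norm_num) (by norm_num)] at h4
          exact h4.trans (by norm_num)
      _ = 20 * n := by ring
  exact_mod_cast h3

variable {S : Type*}

/-- The blocks of level `l` at `x` and `y` are factors of `w[1..n]` and are equal. -/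
def EqualBlocks (n : ℕ) (w : ℕ → S) (l x y : ℕ) : Prop :=
  x + 4 ^ l ≤ n + 1 ∧ y + 4 ^ l ≤ n + 1 ∧ ∀ d < 4 ^ l, w (x + d) = w (y + d)

/-- Equality of numbered blocks. -/
def BlockRel (n : ℕ) (w : ℕ → S) (u v : ℕ) : Prop :=
  u = v ∨ u / (n + 1) = v / (n + 1) ∧
    EqualBlocks n w (u / (n + 1)) (u % (n + 1)) (v % (n + 1))

/-! ### Equality of blocks as an equivalence relation -/

theorem BlockRel.symm {n : ℕ} {w : ℕ → S} (u v : ℕ) (h : BlockRel n w u v) :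
    BlockRel n w v u := by
  obtain rfl | ⟨h1, h2, h3, h4⟩ := h
  · exact .inl rfl
  · refine .inr ⟨h1.symm, ?_⟩
    rw [← h1]
    exact ⟨h3, h2, fun d hd => (h4 d hd).symm⟩

theorem BlockRel.trans {n : ℕ} {w : ℕ → S} (u v z : ℕ) (h : BlockRel n w u v)
    (h' : BlockRel n w v z) : BlockRel n w u z := by
  obtain rfl | ⟨h1, h2, h3, h4⟩ := h
  · exact h'
  obtain rfl | ⟨h1', h2', h3', h4'⟩ := h'
  · exact .inr ⟨h1, h2, h3, h4⟩
  rw [← h1] at h1' h2' h3' h4'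
  exact .inr ⟨h1', h2, h3', fun d hd => (h4 d hd).trans (h4' d hd)⟩

theorem blockRel_of_equalBlocks {n l x y : ℕ} {w : ℕ → S} (hx : x ≤ n) (hy : y ≤ n)
    (h : EqualBlocks n w l x y) : BlockRel n w (blockIndex n l x) (blockIndex n l y) := by
  refine .inr ?_
  rw [blockIndex_div hx, blockIndex_div hy, blockIndex_mod hx, blockIndex_mod hy]
  exact ⟨rfl, h⟩

/-- Reflexivity holds also for blocks that overrun the word and are not factors; `x ≠ y` rules this
case out. -/
theorem BlockRel.equalBlocks {n l x y : ℕ} {w : ℕ → S} (hx : x ≤ n) (hy : y ≤ n) (hxy : x ≠ y)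
    (h : BlockRel n w (blockIndex n l x) (blockIndex n l y)) : EqualBlocks n w l x y := by
  obtain h | h := h
  · exact absurd (Nat.add_left_cancel h) hxy
  · rw [blockIndex_div hx, blockIndex_mod hx, blockIndex_mod hy] at h
    exact h.2

/-- Related blocks share a level, so they are told apart by their positions, of which there are `n`.
-/
theorem card_le_of_blockRel {n : ℕ} {w : ℕ → S} {v : ℕ} {U : Finset ℕ} (hU : U ⊆ sparseBlocks n)
    (h : ∀ u ∈ U, BlockRel n w v u) : #U ≤ n := by
  have hdiv : ∀ u ∈ U, u / (n + 1) = v / (n + 1) := by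
    intro u hu
    obtain rfl | h' := h u hu
    · rfl
    · exact h'.1.symm
  calc #U = #(U.image fun u => u % (n + 1)) := by
        refine (card_image_of_injOn fun a ha b hb hab => ?_).symm
        rw [← Nat.div_add_mod a (n + 1), ← Nat.div_add_mod b (n + 1), hdiv a ha, hdiv b hb]
        exact congrArg _ hab
    _ ≤ #(Icc 1 n) := by
        refine card_le_card fun x hx => ?_
        obtain ⟨u, hu, rfl⟩ := mem_image.1 hx
        have h1 := (mem_filter.1 (hU hu)).2.2.2.1
        have h2 := Nat.mod_lt u (show n + 1 > 0 by omega)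
        exact mem_Icc.2 ⟨h1, by omega⟩
    _ = n := by simp

end Blocks

section Queries

/-! ### The main loop: programs

Registers `0`–`4`: the input `n`, the query `i`, `j`, `k`, the answer; `5`, `6`: the current
positions; `7`, `8`: the level of the current and of the outermost block; `9`: the length of the
current block; `10`, `11`: the highest level and its block length; `12`: the loop is done. Array `2`
holds for each level the number of blocks that are still to be compared. -/

/-- The block number for the level in register `7` and the position `e`. -/
def blockExpr (e : Expr) : Expr :=
  .op .plus (.op .times (.reg 7) (.op .plus (.reg 0) (.const 1))) e

/-- Puts the roots of the nodes in the registers `20` and `21` into the registers `16` and `14`. -/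
def findTwoProgram : Program :=
  .seq (.assign 13 (.reg 20)) <| .seq findProgram <| .seq (.assign 16 (.reg 14)) <|
  .seq (.assign 13 (.reg 21)) findProgram

/-- Sets the number of blocks that are to be compared at the outermost level. -/
def setCountProgram : Program :=
  .ite (.op .less (.reg 8) (.reg 10))
    (.seq (.assign 17 (.op .rem (.op .quot (.reg 5) (.reg 9)) (.const 4))) <|
      .seq (.assign 18 (.op .rem (.op .quot (.reg 6) (.reg 9)) (.const 4))) <|
      .ite (.op .plus (.op .equal (.reg 17) (.const 3)) (.op .equal (.reg 18) (.const 3)))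
        (.ite (.op .plus (.op .equal (.reg 17) (.const 2)) (.op .equal (.reg 18) (.const 2)))
          (.store 2 (.reg 8) (.const 2))
          (.store 2 (.reg 8) (.const 1)))
        (.store 2 (.reg 8) (.const 0)))
    (.store 2 (.reg 8) (.const 1))

/-- All parts of a block have been compared: the block is recorded as equal. -/
def ascendProgram : Program :=
  .seq (.assign 7 (.op .plus (.reg 7) (.const 1))) <|
  .seq (.assign 9 (.op .times (.reg 9) (.const 4))) <|
  .seq (.assign 20 (blockExpr (.op .monus (.reg 5) (.reg 9)))) <|
  .seq (.assign 21 (blockExpr (.op .monus (.reg 6) (.reg 9)))) <|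
  .seq findTwoProgram linkProgram

/-- Raises the outermost level. -/
def raiseProgram : Program :=
  .seq (.assign 7 (.op .plus (.reg 7) (.const 1))) <|
  .seq (.assign 8 (.op .plus (.reg 8) (.const 1))) <|
  .seq (.assign 9 (.op .times (.reg 9) (.const 4))) setCountProgram

/-- Sets register `19` to `1` if the current blocks are known to be equal, and to `0` otherwise. -/
def knownEqualProgram : Program :=
  .ite (.reg 7)
    (.seq (.assign 20 (blockExpr (.reg 5))) <|
      .seq (.assign 21 (blockExpr (.reg 6))) <|
      .seq findTwoProgram <|
      .assign 19 (.op .equal (.reg 14) (.reg 16)))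
    (.test 19 (.reg 5) (.reg 6))

/-- Passes over the current blocks if they are known to be equal, and otherwise turns to their
first parts. -/
def compareProgram : Program :=
  .seq (.store 2 (.reg 7) (.op .monus (.cell 2 (.reg 7)) (.const 1))) <|
  .ite (.op .less (.reg 0) (.reg 5)) (.assign 12 (.const 1)) <|
  .ite (.op .less (.reg 0) (.reg 6)) (.assign 12 (.const 1)) <|
  .seq knownEqualProgram <|
  .ite (.reg 19)
    (.seq (.assign 5 (.op .plus (.reg 5) (.reg 9))) (.assign 6 (.op .plus (.reg 6) (.reg 9)))) <|
  .ite (.reg 7)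
    (.seq (.assign 7 (.op .monus (.reg 7) (.const 1))) <|
      .seq (.assign 9 (.op .quot (.reg 9) (.const 4))) (.store 2 (.reg 7) (.const 4)))
    (.assign 12 (.const 1))

/-- One iteration of the main loop. -/
def stepProgram : Program :=
  .ite (.op .equal (.cell 2 (.reg 7)) (.const 0))
    (.ite (.op .less (.reg 7) (.reg 8)) ascendProgram <|
      .ite (.op .less (.reg 8) (.reg 10)) raiseProgram (.assign 12 (.const 1)))
    compareProgram

/-! ### The main loop: invariant -/

/-- The end of the current block of level `l'`, when the current level is `l`, the current position
is `p`, and `c u` blocks are still to be compared at level `u`. -/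
def blockEnd (c : ℕ → ℕ) (p l l' : ℕ) : ℕ := p + ∑ u ∈ Ico l l', c u * 4 ^ u

theorem blockEnd_self (c : ℕ → ℕ) (p l : ℕ) : blockEnd c p l l = p := by simp [blockEnd]

theorem blockEnd_succ {c : ℕ → ℕ} {p l l' : ℕ} (h : l < l') :
    blockEnd c p l l' = blockEnd c (p + c l * 4 ^ l) (l + 1) l' := by
  rw [blockEnd, blockEnd, sum_eq_sum_Ico_succ_bot h, add_assoc]

theorem blockEnd_add_one (c : ℕ → ℕ) (p l : ℕ) : blockEnd c p l (l + 1) = p + c l * 4 ^ l := by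
  rw [blockEnd_succ l.lt_succ_self, blockEnd_self]

theorem blockEnd_congr {c c' : ℕ → ℕ} {p l l' : ℕ} (h : ∀ u, l ≤ u → u < l' → c u = c' u) :
    blockEnd c p l l' = blockEnd c' p l l' := by
  rw [blockEnd, blockEnd]
  congr 1
  refine sum_congr rfl fun u hu => ?_
  rw [mem_Ico] at hu
  rw [h u hu.1 hu.2]

/-- What the counter loses the position gains, so the ends of the enclosing blocks stay fixed. -/
theorem blockEnd_pass {c : ℕ → ℕ} {p l l' : ℕ} (h : l < l') (hc : c l ≠ 0) :
    blockEnd (Function.update c l (c l - 1)) (p + 4 ^ l) l l' = blockEnd c p l l' := by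
  rw [blockEnd_succ h, blockEnd_succ h, Function.update_self]
  obtain ⟨e, he⟩ : ∃ e, c l = e + 1 := ⟨c l - 1, by omega⟩
  have h1 : p + 4 ^ l + (c l - 1) * 4 ^ l = p + c l * 4 ^ l := by
    rw [he, Nat.add_sub_cancel]; ring
  rw [h1]
  refine blockEnd_congr fun u hu _ => Function.update_of_ne (by omega) _ _

theorem blockEnd_split {c : ℕ → ℕ} {p l l' : ℕ} (h : l < l') :
    blockEnd (Function.update c l 4) p l l' = blockEnd c (p + 4 ^ (l + 1)) (l + 1) l' := by
  rw [blockEnd_succ h, Function.update_self, show 4 * 4 ^ l = 4 ^ (l + 1) by ring]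
  refine blockEnd_congr fun u hu _ => Function.update_of_ne (by omega) _ _

variable {S : Type*}

/-- The assumptions on the parameters: the word length, the word size, the positions and the highest
level of the query, and the parameters of the potential. -/
structure Setting (W n i j K a d : ℕ) : Prop where
  one_le_i : 1 ≤ i
  i_le : i ≤ n
  one_le_j : 1 ≤ j
  j_le : j ≤ n
  ne : i ≠ j
  pow_le : 4 ^ K ≤ 4 * n
  square_le : (n + 1) * (n + 1) ≤ W
  linear_le : 16 * (n + 1) ≤ W
  one_le_a : 1 ≤ a
  log_lt : Nat.log 2 n < ackermannA a d

/-- What holds throughout a query: `w[i..p-1] = w[j..q-1]` for the current positions `p`, `q`. -/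
structure BaseInv (n : ℕ) (w : ℕ → S) (i j K : ℕ) (ρ : ℕ → ℕ) (m : State) : Prop where
  reg0 : m.reg 0 = n
  reg1 : m.reg 1 = i
  reg11 : m.reg 11 = 4 ^ K
  forest : Forest (sparseBlocks n) (BlockRel n w) (m.arr 0) (m.arr 1) ρ
  shift : m.reg 5 + j = m.reg 6 + i
  i_le : i ≤ m.reg 5
  p_le : m.reg 5 ≤ n + 1
  q_le : m.reg 6 ≤ n + 1
  matched : ∀ t, i + t < m.reg 5 → w (i + t) = w (j + t)

/-- The invariant while the main loop runs. -/
structure LoopInv (n : ℕ) (w : ℕ → S) (i j K : ℕ) (ρ : ℕ → ℕ) (m : State) : Prop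
    extends BaseInv n w i j K ρ m where
  reg10 : m.reg 10 = K
  reg12 : m.reg 12 = 0
  l_le : m.reg 7 ≤ m.reg 8
  L_le : m.reg 8 ≤ K
  reg9 : m.reg 9 = 4 ^ m.reg 7
  p_sparse : InSparse (m.reg 7) (m.reg 5)
  q_sparse : InSparse (m.reg 7) (m.reg 6)
  count_le : ∀ u, m.reg 7 ≤ u → u ≤ m.reg 8 → m.arr 2 u ≤ 4
  -- The blocks that have been cut and not yet completed, one per level. They start at or after `i`
  -- and not beyond `n`, and their roots still differ, so completing one permits a genuine link.
  open_blocks : ∀ l', m.reg 7 < l' → l' ≤ m.reg 8 →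
    InSparse l' (blockEnd (m.arr 2) (m.reg 5) (m.reg 7) l') ∧
    InSparse l' (blockEnd (m.arr 2) (m.reg 6) (m.reg 7) l') ∧
    i + 4 ^ l' ≤ blockEnd (m.arr 2) (m.reg 5) (m.reg 7) l' ∧
    blockEnd (m.arr 2) (m.reg 5) (m.reg 7) l' ≤ n + 4 ^ l' ∧
    blockEnd (m.arr 2) (m.reg 6) (m.reg 7) l' ≤ n + 4 ^ l' ∧
    ρ (blockIndex n l' (blockEnd (m.arr 2) (m.reg 5) (m.reg 7) l' - 4 ^ l')) ≠
      ρ (blockIndex n l' (blockEnd (m.arr 2) (m.reg 6) (m.reg 7) l' - 4 ^ l'))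
  top_sparse : m.reg 8 < K →
    InSparse (m.reg 8 + 1) (blockEnd (m.arr 2) (m.reg 5) (m.reg 7) (m.reg 8 + 1)) ∧
    InSparse (m.reg 8 + 1) (blockEnd (m.arr 2) (m.reg 6) (m.reg 7) (m.reg 8 + 1))
  top_end : m.reg 8 = K → i + 4 ^ K ≤ blockEnd (m.arr 2) (m.reg 5) (m.reg 7) (m.reg 8 + 1)

/-- What holds when the main loop is done. -/
structure DoneInv (n : ℕ) (w : ℕ → S) (i j K : ℕ) (ρ : ℕ → ℕ) (m : State) : Prop
    extends BaseInv n w i j K ρ m where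
  reg12 : m.reg 12 = 1
  halted : n < m.reg 5 ∨ n < m.reg 6 ∨ w (m.reg 5) ≠ w (m.reg 6) ∨ i + 4 ^ K ≤ m.reg 5

/-- The part of the potential that persists between the queries. -/
noncomputable def structurePotential (n a d : ℕ) (m : State) : ℕ :=
  17 * forestPotential (sparseBlocks n) a d (Nat.log 2 n) (m.arr 0) (m.arr 1) +
    100 * (a + 3) * (7 * numRoots (sparseBlocks n) (m.arr 0))

/-- The part of the potential that pays for the current query. -/
def queryPotential (K : ℕ) (m : State) : ℕ :=
  -- A cut adds 4 - 1 comparisons and lowers the level, worth 6. An ascent gives the 6 back and is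
  -- paid by the weight 7 of the root that its link destroys. Raising the outermost level costs 6
  -- and at most 2 new comparisons, against 12. Every iteration thus releases at least one unit.
  ∑ u ∈ Ico (m.reg 7) (m.reg 8 + 1), m.arr 2 u + 6 * m.reg 7 + 12 * (K - m.reg 8) + (1 - m.reg 12)

/-- The potential of the main loop. -/
noncomputable def loopPotential (n a d K : ℕ) (m : State) : ℕ :=
  structurePotential n a d m + 100 * (a + 3) * queryPotential K m

variable {W n i j k K a d : ℕ} {w : ℕ → S} {ρ : ℕ → ℕ} {m : State}

theorem Forest.rk_le_log_sparseBlocks {par rk : ℕ → ℕ}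
    (h : Forest (sparseBlocks n) (BlockRel n w) par rk ρ) :
    ∀ v ∈ sparseBlocks n, rk v ≤ Nat.log 2 n := fun _ hv =>
  h.rk_le_log BlockRel.symm (fun _ _ _ hU hR => card_le_of_blockRel hU hR) hv

theorem reach_findTwo
    (h : Forest (sparseBlocks n) (BlockRel n w) (m.arr 0) (m.arr 1) ρ)
    (hW : (n + 1) * (n + 1) ≤ W) (hu : m.reg 20 ∈ sparseBlocks n)
    (hv : m.reg 21 ∈ sparseBlocks n) :
    Reach W n w findTwoProgram m fun m' T =>
      m'.reg 16 = ρ (m.reg 20) ∧ m'.reg 14 = ρ (m.reg 21) ∧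
      (∀ y, y < 13 → m'.reg y = m.reg y) ∧
      (∀ b, b ≠ 0 → m'.arr b = m.arr b) ∧
      Forest (sparseBlocks n) (BlockRel n w) (m'.arr 0) (m'.arr 1) ρ ∧
      T + structurePotential n a d m' ≤ structurePotential n a d m + 34 * (a + 2) + 6 := by
  have h0 := zero_notMem_sparseBlocks n
  have hVW : ∀ v ∈ sparseBlocks n, v < W := fun v hv => (lt_of_mem_sparseBlocks hv).trans_le hW
  refine Reach.seq (Reach.assign (by simpa [Expr.Fits] using hVW _ hu) ?_)
  refine Reach.seq (Reach.mono (reach_find (K := a) (d := d) (M := Nat.log 2 n) (ρ := ρ)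
    (by simpa using h) h0 hVW
    (by simpa using h.rk_le_log_sparseBlocks) (by simpa [Expr.eval] using hu)) ?_)
  rintro m₁ T₁ ⟨h14, hr, ha, hF, hT⟩
  have hρu : m₁.reg 14 ∈ sparseBlocks n := by
    rw [h14]
    exact h.root_mem _ (by simpa [Expr.eval] using hu)
  have h21 : m₁.reg 21 = m.reg 21 := by rw [hr 21] <;> simp
  refine Reach.seq (Reach.assign (by simpa [Expr.Fits] using hVW _ hρu) ?_)
  refine Reach.seq (Reach.assign (by simpa [Expr.Fits, h21] using hVW _ hv) ?_)
  refine Reach.mono (reach_find (K := a) (d := d) (M := Nat.log 2 n) (ρ := ρ)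
    (by simpa using hF) h0 hVW
    (by simpa using hF.rk_le_log_sparseBlocks) (by simpa [Expr.eval, h21] using hv)) ?_
  rintro m₂ T₂ ⟨h14', hr', ha', hF', hT'⟩
  refine ⟨?_, ?_, ?_, ?_, hF', ?_⟩
  · rw [hr' 16 (by omega) (by omega) (by omega)]
    simp [Expr.eval, h14]
  · rw [h14']
    simp [Expr.eval, h21]
  · intro y hy
    rw [hr' y (by omega) (by omega) (by omega)]
    simp only [State.setReg_reg]
    rw [if_neg (by omega), if_neg (by omega), hr y (by omega) (by omega) (by omega)]
    simp only [State.setReg_reg]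
    rw [if_neg (by omega)]
  · intro b hb
    rw [ha' b hb]
    simp only [State.setReg_arr]
    rw [ha b hb]
    rfl
  · simp only [State.setReg_arr] at hT hT'
    simp only [structurePotential, Expr.cost, hF'.numRoots_eq, h.numRoots_eq]
    omega

/-! ### The main loop: executions -/

theorem BinOp.plus_equal_eval_eq_zero (x y z : ℕ) :
    BinOp.plus.eval (BinOp.equal.eval x z) (BinOp.equal.eval y z) = 0 ↔ ¬ (x = z ∨ y = z) := by
  by_cases h1 : x = z <;> by_cases h2 : y = z <;> simp [BinOp.eval, h1, h2]

theorem BinOp.plus_equal_eval_le (x y z : ℕ) :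
    BinOp.plus.eval (BinOp.equal.eval x z) (BinOp.equal.eval y z) ≤ 2 := by
  by_cases h1 : x = z <;> by_cases h2 : y = z <;> simp [BinOp.eval, h1, h2]

theorem reach_setCount (hW : 4 < W) (h5 : m.reg 5 < W) (h6 : m.reg 6 < W) (h8 : m.reg 8 < W)
    (h9 : m.reg 9 < W) (h10 : m.reg 10 < W) :
    Reach W n w setCountProgram m fun m' T =>
      m'.arr 2 = Function.update (m.arr 2) (m.reg 8)
        (if m.reg 8 < m.reg 10 then stepsUp (m.reg 5) (m.reg 6) (m.reg 9) else 1) ∧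
      (∀ y, y < 13 → m'.reg y = m.reg y) ∧
      (∀ b, b ≠ 2 → m'.arr b = m.arr b) ∧ T ≤ 80 := by
  have hq5 : m.reg 5 / m.reg 9 < W := (Nat.div_le_self _ _).trans_lt h5
  have hq6 : m.reg 6 / m.reg 9 < W := (Nat.div_le_self _ _).trans_lt h6
  have hr5 : m.reg 5 / m.reg 9 % 4 < 4 := Nat.mod_lt _ (by norm_num)
  have hr6 : m.reg 6 / m.reg 9 % 4 < 4 := Nat.mod_lt _ (by norm_num)
  have hfit : ∀ x y z : ℕ, BinOp.plus.eval (BinOp.equal.eval x z) (BinOp.equal.eval y z) < W :=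
    fun x y z => (BinOp.plus_equal_eval_le x y z).trans_lt (by omega)
  refine Reach.ite ⟨h8, h10, BinOp.less_eval_lt (by omega) _ _⟩ (fun hlt => ?_) (fun hlt => ?_)
  · simp only [Expr.eval, ne_eq, BinOp.less_eval_eq_zero, not_le] at hlt
    refine Reach.seq (Reach.assign ?_ (Reach.seq (Reach.assign ?_ ?_)))
    · simp only [Expr.Fits, Expr.eval, BinOp.eval]
      omega
    · simp [Expr.Fits, Expr.eval, BinOp.eval]
      omega
    obtain ⟨m₂, hm₂⟩ : ∃ m₂, m₂ = (m.setReg 17 (m.reg 5 / m.reg 9 % 4)).setReg 18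
      (m.reg 6 / m.reg 9 % 4) := ⟨_, rfl⟩
    have h17 : m₂.reg 17 = m.reg 5 / m.reg 9 % 4 := by simp [hm₂]
    have h18 : m₂.reg 18 = m.reg 6 / m.reg 9 % 4 := by simp [hm₂]
    have hr : ∀ y < 13, m₂.reg y = m.reg y := by
      intro y hy
      rw [hm₂, State.setReg_reg, State.setReg_reg, if_neg (by omega), if_neg (by omega)]
    have harr : m₂.arr = m.arr := by simp [hm₂]
    have hfit' : ∀ z < 4, (Expr.op .plus (.op .equal (.reg 17) (.const z))
        (.op .equal (.reg 18) (.const z))).Fits W m₂ := by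
      intro z hz
      simp only [Expr.Fits, Expr.eval, h17, h18]
      exact ⟨⟨by omega, by omega, BinOp.equal_eval_lt (by omega) _ _⟩,
        ⟨by omega, by omega, BinOp.equal_eval_lt (by omega) _ _⟩, hfit _ _ _⟩
    have hstore : ∀ c, c ≤ 2 → c = stepsUp (m.reg 5) (m.reg 6) (m.reg 9) →
        Reach W n w (.store 2 (.reg 8) (.const c)) m₂ fun m' T' =>
          m'.arr 2 = Function.update (m.arr 2) (m.reg 8)
            (if m.reg 8 < m.reg 10 then stepsUp (m.reg 5) (m.reg 6) (m.reg 9) else 1) ∧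
          (∀ y, y < 13 → m'.reg y = m.reg y) ∧ (∀ b, b ≠ 2 → m'.arr b = m.arr b) ∧
          T' ≤ 4 := by
      intro c hc hcs
      refine Reach.store ?_ (show c < W by omega) ⟨?_, hr, ?_, ?_⟩
      · simpa only [Expr.Fits, hr 8 (by omega)] using h8
      · simp [Expr.eval, harr, hr 8, hlt, hcs]
      · intro b hb
        simp [hb, harr]
      · simp [Expr.cost]
    rw [show (m.setReg 17 (Expr.eval m _)).setReg 18 _ = m₂ by
      rw [hm₂]; simp [Expr.eval, BinOp.eval]]
    refine Reach.ite (hfit' 3 (by omega)) (fun h3 => Reach.ite (hfit' 2 (by omega)) (fun h2 => ?_)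
      (fun h2 => ?_)) (fun h3 => ?_)
    all_goals
      simp only [Expr.eval, h17, h18, BinOp.plus_equal_eval_eq_zero, ne_eq, not_not] at *
    · refine (hstore 2 (by omega) (by rw [stepsUp, if_pos h3, if_pos h2])).mono ?_
      rintro m' T ⟨g1, g2, g3, g4⟩
      refine ⟨g1, g2, g3, ?_⟩
      simp only [Expr.cost]
      omega
    · refine (hstore 1 (by omega) (by rw [stepsUp, if_pos h3, if_neg h2])).mono ?_
      rintro m' T ⟨g1, g2, g3, g4⟩
      refine ⟨g1, g2, g3, ?_⟩
      simp only [Expr.cost]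
      omega
    · refine (hstore 0 (by omega) (by rw [stepsUp, if_neg h3])).mono ?_
      rintro m' T ⟨g1, g2, g3, g4⟩
      refine ⟨g1, g2, g3, ?_⟩
      simp only [Expr.cost]
      omega
  · simp only [Expr.eval, BinOp.less_eval_eq_zero] at hlt
    refine Reach.store h8 (by simp only [Expr.Fits]; omega) ⟨?_, ?_, ?_, ?_⟩
    · simp [Expr.eval, not_lt.2 hlt]
    · simp
    · intro b hb
      simp [hb]
    · simp [Expr.cost]

theorem structurePotential_congr {m m' : State} (h : m'.arr 0 = m.arr 0)
    (h' : m'.arr 1 = m.arr 1) : structurePotential n a d m' = structurePotential n a d m := by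
  simp only [structurePotential, h, h']

theorem structurePotential_setReg (m : State) (x v : ℕ) :
    structurePotential n a d (m.setReg x v) = structurePotential n a d m := rfl

theorem BinOp.equal_eval_le (x y : ℕ) : BinOp.equal.eval x y ≤ 1 :=
  Nat.le_of_lt_succ (BinOp.equal_eval_lt one_lt_two x y)

theorem blockExpr_fits {e : Expr} {x : ℕ} (hW : 16 * (n + 1) ≤ W)
    (h0 : m.reg 0 = n) (hl : m.reg 7 ≤ n) (he : e.Fits W m) (hx : e.eval m = x)
    (hb : blockIndex n (m.reg 7) x < W) : (blockExpr e).Fits W m := by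
  rw [blockIndex] at hb
  simp only [blockExpr, Expr.Fits, Expr.eval, BinOp.eval, h0, hx]
  exact ⟨⟨by omega, ⟨by omega, by omega, by omega⟩, by omega⟩, he, hb⟩

theorem blockExpr_eval {e : Expr} (h0 : m.reg 0 = n) :
    (blockExpr e).eval m = blockIndex n (m.reg 7) (e.eval m) := by
  simp only [blockExpr, Expr.eval, BinOp.eval, h0, blockIndex]

/-- The outcomes are asymmetric: at level 0 a negative answer refutes equality, at higher levels it
says only that the roots differ. A positive answer at a higher level relates the blocks through
their common root. -/
theorem reach_knownEqual (hW : (n + 1) * (n + 1) ≤ W) (hW' : 16 * (n + 1) ≤ W)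
    (h : Forest (sparseBlocks n) (BlockRel n w) (m.arr 0) (m.arr 1) ρ)
    (h0 : m.reg 0 = n) (hl : 4 ^ m.reg 7 ≤ 4 * n) (hp : 1 ≤ m.reg 5) (hp' : m.reg 5 ≤ n)
    (hq : 1 ≤ m.reg 6) (hq' : m.reg 6 ≤ n) (hpq : m.reg 5 ≠ m.reg 6)
    (hps : InSparse (m.reg 7) (m.reg 5)) (hqs : InSparse (m.reg 7) (m.reg 6)) :
    Reach W n w knownEqualProgram m fun m' T =>
      (m'.reg 19 ≤ 1) ∧
      (m'.reg 19 ≠ 0 → EqualBlocks n w (m.reg 7) (m.reg 5) (m.reg 6)) ∧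
      (m'.reg 19 = 0 → m.reg 7 = 0 → w (m.reg 5) ≠ w (m.reg 6)) ∧
      (m'.reg 19 = 0 → m.reg 7 ≠ 0 → ρ (blockIndex n (m.reg 7) (m.reg 5)) ≠
        ρ (blockIndex n (m.reg 7) (m.reg 6))) ∧
      (∀ y, y < 13 → m'.reg y = m.reg y) ∧
      (∀ b, b ≠ 0 → m'.arr b = m.arr b) ∧
      Forest (sparseBlocks n) (BlockRel n w) (m'.arr 0) (m'.arr 1) ρ ∧
      T + structurePotential n a d m' ≤ structurePotential n a d m + 34 * (a + 2) + 50 := by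
  have hln := le_of_four_pow_le hl
  refine Reach.ite (show m.reg 7 < W by omega) (fun hl0 => ?_) (fun hl0 => ?_)
  · change m.reg 7 ≠ 0 at hl0
    have hu := blockIndex_mem (by omega) hl hp hp' hps
    have hv := blockIndex_mem (by omega) hl hq hq' hqs
    have huW := (lt_of_mem_sparseBlocks hu).trans_le hW
    have hvW := (lt_of_mem_sparseBlocks hv).trans_le hW
    refine Reach.seq (Reach.assign (blockExpr_fits hW' h0 hln (show m.reg 5 < W by omega) rfl huW)
      (Reach.seq (Reach.assign (blockExpr_fits hW' (by simpa using h0) (by simpa using hln)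
        (show (State.setReg _ _ _).reg 6 < W by simp; omega) rfl
        (by simpa [Expr.eval] using hvW)) ?_)))
    rw [blockExpr_eval h0, blockExpr_eval (by simpa using h0)]
    obtain ⟨m₂, hm₂⟩ : ∃ m₂, m₂ = (m.setReg 20 (blockIndex n (m.reg 7) (m.reg 5))).setReg 21
      (blockIndex n (m.reg 7) (m.reg 6)) := ⟨_, rfl⟩
    have h20 : m₂.reg 20 = blockIndex n (m.reg 7) (m.reg 5) := by simp [hm₂]
    have h21 : m₂.reg 21 = blockIndex n (m.reg 7) (m.reg 6) := by simp [hm₂]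
    have hr : ∀ y < 13, m₂.reg y = m.reg y := by
      intro y hy
      rw [hm₂, State.setReg_reg, State.setReg_reg, if_neg (by omega), if_neg (by omega)]
    have harr : m₂.arr = m.arr := by simp [hm₂]
    rw [show (m.setReg 20 _).setReg 21 _ = m₂ by rw [hm₂]; simp [Expr.eval]]
    refine Reach.seq (Reach.mono (reach_findTwo (a := a) (d := d) (ρ := ρ) (by rwa [harr]) hW
      (by rwa [h20]) (by rwa [h21])) ?_)
    rintro m₃ T₃ ⟨g1, g2, g3, g4, g5, g6⟩
    rw [h20] at g1
    rw [h21] at g2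
    have hρu := lt_of_mem_sparseBlocks (h.root_mem _ hu)
    have hρv := lt_of_mem_sparseBlocks (h.root_mem _ hv)
    refine Reach.assign ?_ ⟨?_, ?_, fun _ h7 => absurd h7 hl0, ?_, ?_, ?_, ?_, ?_⟩
    · refine ⟨?_, ?_, BinOp.equal_eval_lt (by omega) _ _⟩
      · simp only [Expr.Fits, g2]
        omega
      · simp only [Expr.Fits, g1]
        omega
    · simp only [State.setReg_reg, if_true, Expr.eval]
      exact BinOp.equal_eval_le _ _
    · simp only [State.setReg_reg, if_true, Expr.eval, ne_eq, BinOp.equal_eval_eq_zero, not_not,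
        g1, g2]
      intro he
      refine BlockRel.equalBlocks hp' hq' hpq ((h.rel _ hu).trans _ _ _ ?_)
      rw [← he]
      exact (h.rel _ hv).symm
    · simp only [State.setReg_reg, if_true, Expr.eval, ne_eq, BinOp.equal_eval_eq_zero, g1, g2]
      exact fun he _ => Ne.symm he
    · intro y hy
      rw [State.setReg_reg, if_neg (by omega), g3 y hy, hr y hy]
    · intro b hb
      rw [State.setReg_arr, g4 b hb, harr]
    · rwa [State.setReg_arr]
    · rw [structurePotential_congr (m := m) (m' := m₂) (by rw [harr]) (by rw [harr])] at g6
      rw [structurePotential_setReg]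
      simp only [Expr.cost, blockExpr]
      omega
  · change m.reg 7 = 0 at hl0
    have hfit : ∀ x, m.reg x ≤ n → (Expr.reg x).Fits W m := fun x hx => by
      simp only [Expr.Fits]; omega
    refine Reach.test (hfit 5 hp') (hfit 6 hq') ⟨hp, hp'⟩ ⟨hq, hq'⟩
      ⟨?_, ?_, ?_, fun _ h7 => absurd hl0 h7, ?_, fun _ _ => rfl, h, ?_⟩
    · simp only [State.setReg_reg, if_true]
      split_ifs <;> omega
    · simp only [State.setReg_reg, if_true, Expr.eval]
      intro hw
      have hw' : w (m.reg 5) = w (m.reg 6) := by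
        by_contra hc
        exact hw (if_neg hc)
      rw [hl0]
      refine ⟨by omega, by omega, fun d hd => ?_⟩
      obtain rfl : d = 0 := by omega
      exact hw'
    · simp only [State.setReg_reg, if_true, Expr.eval]
      intro hw _ hc
      exact absurd ((if_pos hc).symm.trans hw) one_ne_zero
    · intro y hy
      rw [State.setReg_reg, if_neg (by omega)]
    · rw [structurePotential_setReg]
      simp only [Expr.cost]
      omega

theorem Setting.four_pow_le (hs : Setting W n i j K a d) {l : ℕ}
    (hl : l ≤ K) : 4 ^ l ≤ 4 * n :=
  (Nat.pow_le_pow_right (by norm_num) hl).trans hs.pow_le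

/-- With the counter exhausted, `top_sparse` applies to the current positions themselves, which are
therefore admissible at the next level. -/
theorem reach_raise (hs : Setting W n i j K a d) (h : LoopInv n w i j K ρ m)
    (hc : m.arr 2 (m.reg 7) = 0) (hl : m.reg 7 = m.reg 8) (hL : m.reg 8 < K) :
    Reach W n w raiseProgram m fun m' T =>
      LoopInv n w i j K ρ m' ∧ T + 30 + loopPotential n a d K m' ≤ loopPotential n a d K m := by
  have hLn := le_of_four_pow_le (hs.four_pow_le (l := m.reg 8 + 1) (by omega))
  have hKn := le_of_four_pow_le hs.pow_le
  have hpw := hs.four_pow_le (l := m.reg 8 + 1) (by omega)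
  have h9 : m.reg 9 * 4 = 4 ^ (m.reg 8 + 1) := by rw [h.reg9, hl, pow_succ]
  have hW := hs.linear_le
  have hp := h.p_le
  have hq := h.q_le
  have h10 := h.reg10
  refine Reach.seq (Reach.assign ?_ (Reach.seq (Reach.assign ?_ (Reach.seq (Reach.assign ?_ ?_)))))
  · simp only [Expr.Fits, Expr.eval, BinOp.eval]
    omega
  · simp [Expr.Fits, Expr.eval, BinOp.eval]
    omega
  · simp [Expr.Fits, Expr.eval, BinOp.eval]
    omega
  obtain ⟨m₂, hm₂⟩ : ∃ m₂, m₂ = ((m.setReg 7 (m.reg 8 + 1)).setReg 8 (m.reg 8 + 1)).setReg 9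
    (4 ^ (m.reg 8 + 1)) := ⟨_, rfl⟩
  have e7 : m₂.reg 7 = m.reg 8 + 1 := by simp [hm₂]
  have e8 : m₂.reg 8 = m.reg 8 + 1 := by simp [hm₂]
  have e9 : m₂.reg 9 = 4 ^ (m.reg 8 + 1) := by simp [hm₂]
  have hr : ∀ y, y ≠ 7 → y ≠ 8 → y ≠ 9 → m₂.reg y = m.reg y := by
    intro y h1 h2 h3
    simp [hm₂, h1, h2, h3]
  have harr : m₂.arr = m.arr := by simp [hm₂]
  rw [show State.setReg (State.setReg (m.setReg 7 _) 8 _) 9 _ = m₂ by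
    rw [hm₂]; simp [Expr.eval, BinOp.eval, hl, ← h9]]
  have e5 := hr 5 (by omega) (by omega) (by omega)
  have e6 := hr 6 (by omega) (by omega) (by omega)
  have e10 := hr 10 (by omega) (by omega) (by omega)
  refine Reach.mono (reach_setCount (by omega) (by omega) (by omega) (by omega) (by omega)
    (by omega)) ?_
  rintro m' T ⟨g1, g2, g3, g4⟩
  rw [e5, e6, e8, e9, e10, harr, h10] at g1
  have f : ∀ y, y < 13 → y ≠ 7 → y ≠ 8 → y ≠ 9 → m'.reg y = m.reg y := fun y hy h1 h2 h3 => by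
    rw [g2 y hy, hr y h1 h2 h3]
  have f7 : m'.reg 7 = m.reg 8 + 1 := by rw [g2 7 (by omega), e7]
  have f8 : m'.reg 8 = m.reg 8 + 1 := by rw [g2 8 (by omega), e8]
  have f9 : m'.reg 9 = 4 ^ (m.reg 8 + 1) := by rw [g2 9 (by omega), e9]
  have f0 := f 0 (by omega) (by omega) (by omega) (by omega)
  have f1 := f 1 (by omega) (by omega) (by omega) (by omega)
  have f5 := f 5 (by omega) (by omega) (by omega) (by omega)
  have f6 := f 6 (by omega) (by omega) (by omega) (by omega)
  have f10 := f 10 (by omega) (by omega) (by omega) (by omega)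
  have f11 := f 11 (by omega) (by omega) (by omega) (by omega)
  have f12 := f 12 (by omega) (by omega) (by omega) (by omega)
  have a0 : m'.arr 0 = m.arr 0 := by rw [g3 0 (by omega), harr]
  have a1 : m'.arr 1 = m.arr 1 := by rw [g3 1 (by omega), harr]
  have htop := h.top_sparse hL
  rw [← hl, blockEnd_add_one, blockEnd_add_one, hc, zero_mul, add_zero, add_zero, hl] at htop
  have hcount : m'.arr 2 (m.reg 8 + 1) ≤ 2 := by
    rw [g1, Function.update_self]
    split_ifs
    · exact stepsUp_le _ _ _
    · omega
  refine ⟨?_, ?_⟩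
  · refine
      { reg0 := by rw [f0, h.reg0]
        reg1 := by rw [f1, h.reg1]
        reg11 := by rw [f11, h.reg11]
        forest := by rw [a0, a1]; exact h.forest
        shift := by rw [f5, f6]; exact h.shift
        i_le := by rw [f5]; exact h.i_le
        p_le := by rw [f5]; exact h.p_le
        q_le := by rw [f6]; exact h.q_le
        matched := by rw [f5]; exact h.matched
        reg10 := by rw [f10, h.reg10]
        reg12 := by rw [f12, h.reg12]
        l_le := by rw [f7, f8]
        L_le := by rw [f8]; omega
        reg9 := by rw [f9, f7]
        p_sparse := by rw [f7, f5]; exact htop.1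
        q_sparse := by rw [f7, f6]; exact htop.2
        count_le := ?_
        open_blocks := fun l' h1 h2 => by omega
        top_sparse := ?_
        top_end := ?_ }
    · intro u hu1 hu2
      obtain rfl : u = m.reg 8 + 1 := by omega
      omega
    · intro hlt
      rw [f8] at hlt
      rw [f5, f6, f7, f8, blockEnd_add_one, blockEnd_add_one, g1, Function.update_self, if_pos hlt]
      exact inSparse_stepsUp htop.1 htop.2
    · intro he
      rw [f8] at he
      rw [f5, f7, f8, blockEnd_add_one, g1, Function.update_self,
        if_neg (by omega), he]
      have := h.i_le
      omega
  · rw [loopPotential, loopPotential, structurePotential_congr a0 a1]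
    have hq : queryPotential K m' + 1 ≤ queryPotential K m := by
      simp only [queryPotential, f7, f8, f12, hl, Nat.Ico_succ_singleton, sum_singleton]
      omega
    have := Nat.mul_le_mul_left (100 * (a + 3)) hq
    rw [mul_add] at this
    simp only [Expr.cost]
    omega

theorem BaseInv.congr {m' : State} (h : BaseInv n w i j K ρ m) (h0 : m'.reg 0 = m.reg 0)
    (h1 : m'.reg 1 = m.reg 1) (h11 : m'.reg 11 = m.reg 11) (h5 : m'.reg 5 = m.reg 5)
    (h6 : m'.reg 6 = m.reg 6)
    (hF : Forest (sparseBlocks n) (BlockRel n w) (m'.arr 0) (m'.arr 1) ρ) :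
    BaseInv n w i j K ρ m' where
  reg0 := by rw [h0, h.reg0]
  reg1 := by rw [h1, h.reg1]
  reg11 := by rw [h11, h.reg11]
  forest := hF
  shift := by rw [h5, h6]; exact h.shift
  i_le := by rw [h5]; exact h.i_le
  p_le := by rw [h5]; exact h.p_le
  q_le := by rw [h6]; exact h.q_le
  matched := by rw [h5]; exact h.matched

theorem structurePotential_setCell_two (m : State) (x v : ℕ) :
    structurePotential n a d (m.setCell 2 x v) = structurePotential n a d m := rfl

/-- A unit of `queryPotential` buys `100 * (a + 3)` steps, enough for the two finds and the fixed
costs of an iteration. -/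
theorem loopPotential_le {m m' : State} {T : ℕ}
    (h : T + structurePotential n a d m' ≤ structurePotential n a d m + 100 * (a + 3))
    (hq : queryPotential K m' + 1 ≤ queryPotential K m) :
    T + loopPotential n a d K m' ≤ loopPotential n a d K m := by
  have := Nat.mul_le_mul_left (100 * (a + 3)) hq
  rw [mul_add] at this
  rw [loopPotential, loopPotential]
  omega

theorem reach_compare (hs : Setting W n i j K a d) (h : LoopInv n w i j K ρ m)
    (hc : m.arr 2 (m.reg 7) ≠ 0) :
    Reach W n w compareProgram m fun m' T =>
      (LoopInv n w i j K ρ m' ∨ DoneInv n w i j K ρ m') ∧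
        T + 30 + loopPotential n a d K m' ≤ loopPotential n a d K m := by
  have hlK := h.l_le.trans h.L_le
  have hpw := hs.four_pow_le hlK
  have hln := le_of_four_pow_le hpw
  have hKn := le_of_four_pow_le hs.pow_le
  have hW := hs.linear_le
  have hp := h.p_le
  have hq := h.q_le
  have hi := h.i_le
  have hi1 := hs.one_le_i
  have hshift := h.shift
  have hj1 := hs.one_le_j
  have hne := hs.ne
  have h0 := h.reg0
  have hc4 := h.count_le _ le_rfl h.l_le
  obtain ⟨m₁, hm₁⟩ : ∃ m₁, m₁ = m.setCell 2 (m.reg 7) (m.arr 2 (m.reg 7) - 1) := ⟨_, rfl⟩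
  have r₁ : m₁.reg = m.reg := by rw [hm₁]; rfl
  have c₁ : m₁.arr 2 = Function.update (m.arr 2) (m.reg 7) (m.arr 2 (m.reg 7) - 1) := by
    simp [hm₁]
  have a₁ : ∀ b, b ≠ 2 → m₁.arr b = m.arr b := fun b hb => by simp [hm₁, hb]
  have p₁ : structurePotential n a d m₁ = structurePotential n a d m := by rw [hm₁]; rfl
  have hF₁ : Forest (sparseBlocks n) (BlockRel n w) (m₁.arr 0) (m₁.arr 1) ρ := by
    rw [a₁ 0 (by omega), a₁ 1 (by omega)]; exact h.forest
  have hsum : ∑ u ∈ Ico (m.reg 7) (m.reg 8 + 1), m₁.arr 2 u + 1 =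
      ∑ u ∈ Ico (m.reg 7) (m.reg 8 + 1), m.arr 2 u := by
    have hlL : m.reg 7 < m.reg 8 + 1 := Nat.lt_succ_of_le h.l_le
    rw [sum_eq_sum_Ico_succ_bot hlL, sum_eq_sum_Ico_succ_bot hlL, c₁,
      Function.update_self]
    have : ∑ u ∈ Ico (m.reg 7 + 1) (m.reg 8 + 1),
        Function.update (m.arr 2) (m.reg 7) (m.arr 2 (m.reg 7) - 1) u =
        ∑ u ∈ Ico (m.reg 7 + 1) (m.reg 8 + 1), m.arr 2 u := by
      refine sum_congr rfl fun u hu => Function.update_of_ne ?_ _ _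
      rw [mem_Ico] at hu
      omega
    omega
  -- The three exits, past the end of the word in either position or at differing symbols, are
  -- treated together. Open blocks are abandoned here, as only `BaseInv` has to survive.
  have hdone : ∀ m₂ : State, ∀ T, (∀ y < 13, m₂.reg y = m.reg y) → m₂.arr 2 = m₁.arr 2 →
      Forest (sparseBlocks n) (BlockRel n w) (m₂.arr 0) (m₂.arr 1) ρ →
      (n < m.reg 5 ∨ n < m.reg 6 ∨ w (m.reg 5) ≠ w (m.reg 6)) →
      T + structurePotential n a d m₂ ≤ structurePotential n a d m + 34 * (a + 2) + 80 →
      Reach W n w (.assign 12 (.const 1)) m₂ fun m' T' =>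
        (LoopInv n w i j K ρ m' ∨ DoneInv n w i j K ρ m') ∧
          T + T' + 60 + loopPotential n a d K m' ≤ loopPotential n a d K m := by
    intro m₂ T hr hc2 hF hend hT
    refine Reach.assign (show 1 < W by omega) ⟨.inr ?_, ?_⟩
    · have e5 : (m₂.setReg 12 (Expr.eval m₂ (.const 1))).reg 5 = m.reg 5 := by simp [hr 5]
      have e6 : (m₂.setReg 12 (Expr.eval m₂ (.const 1))).reg 6 = m.reg 6 := by simp [hr 6]
      refine
        { toBaseInv := h.toBaseInv.congr (by simp [hr 0]) (by simp [hr 1]) (by simp [hr 11])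
            e5 e6 hF
          reg12 := by simp [Expr.eval]
          halted := ?_ }
      rw [e5, e6]
      tauto
    · refine loopPotential_le ?_ ?_
      · rw [structurePotential_setReg]
        simp only [Expr.cost]
        omega
      · simp only [queryPotential, State.setReg_reg, State.setReg_arr, hc2, Expr.eval]
        rw [if_neg (by omega), if_neg (by omega), if_true, hr 7 (by omega), hr 8 (by omega),
          h.reg12]
        omega
  refine Reach.seq (Reach.store (show m.reg 7 < W by omega) ?_ ?_)
  · simp only [Expr.Fits, Expr.eval, BinOp.eval]
    omega
  change Reach W n w _ (m.setCell 2 (m.reg 7) (m.arr 2 (m.reg 7) - 1)) _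
  rw [← hm₁]
  refine Reach.ite ⟨?_, ?_, BinOp.less_eval_lt (by omega) _ _⟩ (fun hlt => ?_) (fun hlt => ?_)
  · simp only [Expr.Fits, r₁]; omega
  · simp only [Expr.Fits, r₁]; omega
  · simp only [Expr.eval, ne_eq, BinOp.less_eval_eq_zero, not_le, r₁] at hlt
    refine (hdone m₁ 0 (fun y _ => by rw [r₁]) rfl hF₁ (.inl (by omega)) (by omega)).mono ?_
    rintro m' T ⟨g1, g2⟩
    refine ⟨g1, ?_⟩
    simp only [Expr.cost]
    omega
  simp only [Expr.eval, BinOp.less_eval_eq_zero, r₁] at hlt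
  refine Reach.ite ⟨?_, ?_, BinOp.less_eval_lt (by omega) _ _⟩ (fun hlt' => ?_) (fun hlt' => ?_)
  · simp only [Expr.Fits, r₁]; omega
  · simp only [Expr.Fits, r₁]; omega
  · simp only [Expr.eval, ne_eq, BinOp.less_eval_eq_zero, not_le, r₁] at hlt'
    refine (hdone m₁ 0 (fun y _ => by rw [r₁]) rfl hF₁ (.inr (.inl (by omega))) (by omega)).mono ?_
    rintro m' T ⟨g1, g2⟩
    refine ⟨g1, ?_⟩
    simp only [Expr.cost]
    omega
  simp only [Expr.eval, BinOp.less_eval_eq_zero, r₁] at hlt'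
  refine Reach.seq (Reach.mono (reach_knownEqual (n := n) (a := a) (d := d) (ρ := ρ) hs.square_le hW
    hF₁ (by rw [r₁, h0]) (by rwa [r₁]) (by rw [r₁]; omega) (by rw [r₁]; omega) (by rw [r₁]; omega)
    (by rw [r₁]; omega) (by rw [r₁]; omega) (by rw [r₁]; exact h.p_sparse)
    (by rw [r₁]; exact h.q_sparse)) ?_)
  rintro m₂ T₂ ⟨g19, gt, gf0, gf1, gr, ga, gF, gT⟩
  simp only [r₁] at gt gf0 gf1 gr
  have c₂ : m₂.arr 2 = m₁.arr 2 := ga 2 (by omega)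
  rw [p₁] at gT
  refine Reach.ite (show m₂.reg 19 < W by omega) (fun h19 => ?_) (fun h19 => ?_)
  · have heq := gt h19
    obtain ⟨q1, q2, q3⟩ := heq
    have e9 := gr 9 (by omega)
    rw [h.reg9] at e9
    refine Reach.seq (Reach.assign ?_ (Reach.assign ?_ ⟨.inl ?_, ?_⟩))
    · simp only [Expr.Fits, Expr.eval, BinOp.eval, gr 5 (by omega), e9]
      omega
    · simp [Expr.Fits, Expr.eval, BinOp.eval, gr 6, e9]
      omega
    · obtain ⟨m₃, hm₃⟩ : ∃ m₃, m₃ = (m₂.setReg 5 (m.reg 5 + 4 ^ m.reg 7)).setReg 6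
        (m.reg 6 + 4 ^ m.reg 7) := ⟨_, rfl⟩
      have f5 : m₃.reg 5 = m.reg 5 + 4 ^ m.reg 7 := by simp [hm₃]
      have f6 : m₃.reg 6 = m.reg 6 + 4 ^ m.reg 7 := by simp [hm₃]
      have fr : ∀ y < 13, y ≠ 5 → y ≠ 6 → m₃.reg y = m.reg y := by
        intro y hy h5 h6
        simp [hm₃, h5, h6, gr y hy]
      have fa : m₃.arr = m₂.arr := by simp [hm₃]
      rw [show State.setReg (m₂.setReg 5 _) 6 _ = m₃ by
        rw [hm₃]; simp [Expr.eval, BinOp.eval, gr 5, gr 6, e9]]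
      have f7 := fr 7 (by omega) (by omega) (by omega)
      have f8 := fr 8 (by omega) (by omega) (by omega)
      have fend : ∀ x l', m.reg 7 < l' → blockEnd (m₃.arr 2) (x + 4 ^ m.reg 7) (m.reg 7) l' =
          blockEnd (m.arr 2) x (m.reg 7) l' := by
        intro x l' hl'
        rw [fa, c₂, c₁, blockEnd_pass hl' hc]
      have hlL := h.l_le
      refine
        { reg0 := by rw [fr 0 (by omega) (by omega) (by omega), h0]
          reg1 := by rw [fr 1 (by omega) (by omega) (by omega), h.reg1]
          reg11 := by rw [fr 11 (by omega) (by omega) (by omega), h.reg11]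
          forest := by rw [fa]; exact gF
          shift := by omega
          i_le := by omega
          p_le := by omega
          q_le := by omega
          matched := ?_
          reg10 := by rw [fr 10 (by omega) (by omega) (by omega), h.reg10]
          reg12 := by rw [fr 12 (by omega) (by omega) (by omega), h.reg12]
          l_le := by omega
          L_le := by rw [f8]; exact h.L_le
          reg9 := by rw [fr 9 (by omega) (by omega) (by omega), h.reg9, f7]
          p_sparse := ?_
          q_sparse := ?_
          count_le := ?_
          open_blocks := ?_
          top_sparse := ?_
          top_end := ?_ }
      · intro t ht
        by_cases htp : i + t < m.reg 5
        · exact h.matched t htp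
        · have := q3 (i + t - m.reg 5) (by omega)
          rwa [show m.reg 5 + (i + t - m.reg 5) = i + t by omega,
            show m.reg 6 + (i + t - m.reg 5) = j + t by omega] at this
      · rw [f7, f5]
        have := (inSparse_add_mul (m.reg 7) (m.reg 5) 1).2 h.p_sparse
        rwa [one_mul] at this
      · rw [f7, f6]
        have := (inSparse_add_mul (m.reg 7) (m.reg 6) 1).2 h.q_sparse
        rwa [one_mul] at this
      · intro u hu1 hu2
        rw [fa, c₂, c₁, Function.update_apply]
        split_ifs
        · omega
        · exact h.count_le u (by omega) (by omega)
      · intro l' h1 h2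
        rw [f7] at h1
        rw [f8] at h2
        rw [f5, f6, f7, fend _ _ h1, fend _ _ h1]
        exact h.open_blocks l' h1 h2
      · rw [f5, f6, f7, f8, fend _ _ (by omega), fend _ _ (by omega)]
        exact h.top_sparse
      · rw [f5, f7, f8, fend _ _ (by omega)]
        exact h.top_end
    · refine loopPotential_le ?_ ?_
      · rw [structurePotential_setReg, structurePotential_setReg]
        simp only [Expr.cost]
        omega
      · simp [queryPotential, c₂, gr 7, gr 8, gr 12]
        omega
  · change m₂.reg 19 = 0 at h19
    refine Reach.ite (show m₂.reg 7 < W by rw [gr 7 (by omega)]; omega)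
      (fun h7 => ?_) (fun h7 => ?_)
    · change m₂.reg 7 ≠ 0 at h7
      rw [gr 7 (by omega)] at h7
      have hneq := gf1 h19 h7
      obtain ⟨e, he⟩ : ∃ e, m.reg 7 = e + 1 := ⟨m.reg 7 - 1, by omega⟩
      have e9 := gr 9 (by omega)
      rw [h.reg9, he, pow_succ] at e9
      have hpe : 4 ^ m.reg 7 = 4 ^ e * 4 := by rw [he, pow_succ]
      refine Reach.seq (Reach.assign ?_ (Reach.seq (Reach.assign ?_
        (Reach.store ?_ (show 4 < W by omega) ⟨.inl ?_, ?_⟩))))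
      · simp only [Expr.Fits, Expr.eval, BinOp.eval, gr 7 (by omega)]
        omega
      · simp [Expr.Fits, Expr.eval, BinOp.eval, e9]
        omega
      · simp [Expr.Fits, Expr.eval, BinOp.eval, gr 7]
        omega
      · obtain ⟨m₃, hm₃⟩ : ∃ m₃, m₃ = ((m₂.setReg 7 e).setReg 9 (4 ^ e)).setCell 2 e 4 :=
          ⟨_, rfl⟩
        have f7 : m₃.reg 7 = e := by simp [hm₃]
        have f9 : m₃.reg 9 = 4 ^ e := by simp [hm₃]
        have fr : ∀ y < 13, y ≠ 7 → y ≠ 9 → m₃.reg y = m.reg y := by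
          intro y hy h5 h6
          simp [hm₃, h5, h6, gr y hy]
        have fc : m₃.arr 2 = Function.update (m₁.arr 2) e 4 := by simp [hm₃, c₂]
        have fa : ∀ b, b ≠ 2 → m₃.arr b = m₂.arr b := by
          intro b hb
          simp [hm₃, hb]
        rw [show State.setCell (State.setReg (m₂.setReg 7 _) 9 _) 2 _ _ = m₃ by
          rw [hm₃]; simp [Expr.eval, BinOp.eval, gr 7, he, e9]]
        have f5 := fr 5 (by omega) (by omega) (by omega)
        have f6 := fr 6 (by omega) (by omega) (by omega)
        have f8 := fr 8 (by omega) (by omega) (by omega)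
        have fend : ∀ x l', m.reg 7 < l' → blockEnd (m₃.arr 2) x e l' =
            blockEnd (m.arr 2) x (m.reg 7) l' := by
          intro x l' hl'
          rw [fc, blockEnd_split (by omega), c₁, ← he, blockEnd_pass hl' hc]
        have fend' : ∀ x, blockEnd (m₃.arr 2) x e (m.reg 7) = x + 4 ^ m.reg 7 := by
          intro x
          rw [he, blockEnd_add_one, fc, Function.update_self]
          ring
        have hlL := h.l_le
        refine
          { toBaseInv := h.toBaseInv.congr (fr 0 (by omega) (by omega) (by omega))
              (fr 1 (by omega) (by omega) (by omega)) (fr 11 (by omega) (by omega) (by omega))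
              f5 f6 (by rw [fa 0 (by omega), fa 1 (by omega)]; exact gF)
            reg10 := by rw [fr 10 (by omega) (by omega) (by omega), h.reg10]
            reg12 := by rw [fr 12 (by omega) (by omega) (by omega), h.reg12]
            l_le := by omega
            L_le := by rw [f8]; exact h.L_le
            reg9 := by rw [f9, f7]
            p_sparse := by rw [f7, f5]; exact h.p_sparse.of_le (by omega)
            q_sparse := by rw [f7, f6]; exact h.q_sparse.of_le (by omega)
            count_le := ?_
            open_blocks := ?_
            top_sparse := ?_
            top_end := ?_ }
        · intro u hu1 hu2
          rw [fc, Function.update_apply]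
          split_ifs
          · omega
          rw [c₁, Function.update_apply]
          split_ifs
          · omega
          · exact h.count_le u (by omega) (by omega)
        · intro l' h1 h2
          rw [f7] at h1
          rw [f8] at h2
          rw [f5, f6, f7]
          -- The block that was just cut becomes the innermost open one; the ends of the others have
          -- not moved.
          obtain h3 | h3 : m.reg 7 = l' ∨ m.reg 7 < l' := by omega
          · subst h3
            have s1 := (inSparse_add_mul (m.reg 7) (m.reg 5) 1).2 h.p_sparse
            have s2 := (inSparse_add_mul (m.reg 7) (m.reg 6) 1).2 h.q_sparse
            rw [one_mul] at s1 s2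
            rw [fend', fend', Nat.add_sub_cancel, Nat.add_sub_cancel]
            exact ⟨s1, s2, by omega, by omega, by omega, hneq⟩
          · rw [fend _ _ h3, fend _ _ h3]
            exact h.open_blocks l' h3 h2
        · rw [f5, f6, f7, f8, fend _ _ (by omega), fend _ _ (by omega)]
          exact h.top_sparse
        · rw [f5, f7, f8, fend _ _ (by omega)]
          exact h.top_end
      · refine loopPotential_le ?_ ?_
        · rw [structurePotential_setCell_two, structurePotential_setReg, structurePotential_setReg]
          simp only [Expr.cost]
          omega
        · have hlL := h.l_le
          have hs2 : ∑ u ∈ Ico e (m.reg 8 + 1), Function.update (m₁.arr 2) e 4 u =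
              4 + ∑ u ∈ Ico (m.reg 7) (m.reg 8 + 1), m₁.arr 2 u := by
            rw [sum_eq_sum_Ico_succ_bot (by omega), Function.update_self, he]
            congr 1
            refine sum_congr rfl fun u hu => Function.update_of_ne ?_ _ _
            rw [mem_Ico] at hu
            omega
          have hq' : queryPotential K (((m₂.setReg 7 e).setReg 9 (4 ^ e)).setCell 2 e 4) + 1 ≤
              queryPotential K m := by
            simp [queryPotential, c₂, gr 8, gr 12]
            omega
          convert hq' using 4 <;> simp [Expr.eval, BinOp.eval, gr 7, he, e9]
    · change m₂.reg 7 = 0 at h7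
      rw [gr 7 (by omega)] at h7
      refine (hdone m₂ T₂ gr c₂ gF (.inr (.inr (gf0 h19 h7))) (by omega)).mono ?_
      rintro m' T ⟨k1, k2⟩
      refine ⟨k1, ?_⟩
      simp only [Expr.cost]
      omega

/-- Trees never mix levels. A link at one level therefore leaves the roots at all other levels as
they are. -/
theorem Forest.root_div {n l x : ℕ} {par rk : ℕ → ℕ}
    (h : Forest (sparseBlocks n) (BlockRel n w) par rk ρ) (hx : x ≤ n)
    (hm : blockIndex n l x ∈ sparseBlocks n) : ρ (blockIndex n l x) / (n + 1) = l := by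
  have h1 := blockIndex_div (l := l) hx
  obtain h2 | ⟨h2, -⟩ := h.rel _ hm
  · rw [← h2, h1]
  · rw [← h2, h1]

/-- The current positions are the ends of the innermost open blocks. These lie within the matched
part and so are equal, while their roots differ by the invariant: the link is legitimate and
destroys a root. The larger open blocks keep distinct roots because they have higher levels. -/
theorem reach_ascend (hs : Setting W n i j K a d) (h : LoopInv n w i j K ρ m)
    (hc : m.arr 2 (m.reg 7) = 0) (hl : m.reg 7 < m.reg 8) :
    Reach W n w ascendProgram m fun m' T =>
      (∃ ρ', LoopInv n w i j K ρ' m') ∧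
        T + 30 + loopPotential n a d K m' ≤ loopPotential n a d K m := by
  obtain ⟨l, hl'⟩ : ∃ l, m.reg 7 + 1 = l := ⟨_, rfl⟩
  have hlK : l ≤ K := by have := h.L_le; omega
  have hpw := hs.four_pow_le hlK
  have hln := le_of_four_pow_le hpw
  have hW := hs.linear_le
  have hWs := hs.square_le
  have hp := h.p_le
  have hq := h.q_le
  have hshift := h.shift
  have h0 := h.reg0
  have hi1 := hs.one_le_i
  have hj1 := hs.one_le_j
  have hne := hs.ne
  have h1pow : 1 ≤ 4 ^ l := Nat.one_le_pow _ _ (by norm_num)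
  have h9 : m.reg 9 * 4 = 4 ^ l := by rw [h.reg9, ← hl', pow_succ]
  have hend : ∀ x, blockEnd (m.arr 2) x (m.reg 7) l = x := by
    intro x
    rw [← hl', blockEnd_add_one, hc, zero_mul, add_zero]
  obtain ⟨o1, o2, o3, o4, o5, o6⟩ := h.open_blocks l (by omega) (by omega)
  rw [hend] at o1 o2 o3 o4 o5
  rw [hend, hend] at o6
  obtain ⟨x, hx⟩ : ∃ x, m.reg 5 = x + 4 ^ l := ⟨m.reg 5 - 4 ^ l, by omega⟩
  obtain ⟨y, hy⟩ : ∃ y, m.reg 6 = y + 4 ^ l := ⟨m.reg 6 - 4 ^ l, by omega⟩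
  have hxs : InSparse l x := by
    rw [← inSparse_add_mul l x 1, one_mul, ← hx]; exact o1
  have hys : InSparse l y := by
    rw [← inSparse_add_mul l y 1, one_mul, ← hy]; exact o2
  rw [hx, hy, Nat.add_sub_cancel, Nat.add_sub_cancel] at o6
  have hu := blockIndex_mem (n := n) (x := x) (by omega) hpw (by omega) (by omega) hxs
  have hv := blockIndex_mem (n := n) (x := y) (by omega) hpw (by omega) (by omega) hys
  have huW := (lt_of_mem_sparseBlocks hu).trans_le hWs
  have hvW := (lt_of_mem_sparseBlocks hv).trans_le hWs
  have hrel : BlockRel n w (blockIndex n l x) (blockIndex n l y) := by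
    refine blockRel_of_equalBlocks (by omega) (by omega) ⟨by omega, by omega, fun t ht => ?_⟩
    have := h.matched (x - i + t) (by omega)
    rwa [show i + (x - i + t) = x + t by omega, show j + (x - i + t) = y + t by omega] at this
  refine Reach.seq (Reach.assign ?_ (Reach.seq (Reach.assign ?_ (Reach.seq (Reach.assign ?_
    (Reach.seq (Reach.assign ?_ ?_)))))))
  · simp only [Expr.Fits, Expr.eval, BinOp.eval]
    omega
  · simp [Expr.Fits, Expr.eval, BinOp.eval]
    omega
  · refine blockExpr_fits (n := n) (x := x) hW (by simpa using h0)
      (by simp [Expr.eval, BinOp.eval]; omega) ?_ ?_ ?_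
    · simp [Expr.Fits, Expr.eval, BinOp.eval]
      omega
    · simp [Expr.eval, BinOp.eval]
      omega
    · simpa [Expr.eval, BinOp.eval, hl'] using huW
  · refine blockExpr_fits (n := n) (x := y) hW (by simpa using h0)
      (by simp [Expr.eval, BinOp.eval]; omega) ?_ ?_ ?_
    · simp [Expr.Fits, Expr.eval, BinOp.eval]
      omega
    · simp [Expr.eval, BinOp.eval]
      omega
    · simpa [Expr.eval, BinOp.eval, hl'] using hvW
  rw [blockExpr_eval (n := n) (by simpa using h0), blockExpr_eval (n := n) (by simpa using h0)]
  obtain ⟨m₂, hm₂⟩ : ∃ m₂, m₂ = (((m.setReg 7 l).setReg 9 (4 ^ l)).setReg 20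
    (blockIndex n l x)).setReg 21 (blockIndex n l y) := ⟨_, rfl⟩
  rw [show State.setReg (State.setReg (State.setReg (m.setReg 7 _) 9 _) 20 _) 21 _ = m₂ by
    rw [hm₂]
    simp [Expr.eval, BinOp.eval, hl', h9, hx, hy]]
  have e20 : m₂.reg 20 = blockIndex n l x := by simp [hm₂]
  have e21 : m₂.reg 21 = blockIndex n l y := by simp [hm₂]
  have e7 : m₂.reg 7 = l := by simp [hm₂]
  have e9 : m₂.reg 9 = 4 ^ l := by simp [hm₂]
  have er : ∀ z < 13, z ≠ 7 → z ≠ 9 → m₂.reg z = m.reg z := by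
    intro z h1 h2 h3
    simp [hm₂, h2, h3, show z ≠ 20 by omega, show z ≠ 21 by omega]
  have ea : m₂.arr = m.arr := by simp [hm₂]
  refine Reach.seq (Reach.mono (reach_findTwo (a := a) (d := d) (ρ := ρ)
    (by rw [ea]; exact h.forest) hWs (by rwa [e20]) (by rwa [e21])) ?_)
  rintro m₃ T₃ ⟨g1, g2, g3, g4, g5, g6⟩
  rw [e20] at g1
  rw [e21] at g2
  rw [structurePotential_congr (m := m) (m' := m₂) (by rw [ea]) (by rw [ea])] at g6
  have hρu := h.forest.root_mem _ hu
  have hρv := h.forest.root_mem _ hv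
  have hlog : Nat.log 2 n ≤ n := Nat.log_le_self 2 n
  refine Reach.mono (reach_link (K := a) (d := d) (M := Nat.log 2 n) g5
    (zero_notMem_sparseBlocks n) BlockRel.symm
    BlockRel.trans hs.one_le_a hs.log_lt
    (fun v hv => (lt_of_mem_sparseBlocks hv).trans_le hWs) (by omega) g5.rk_le_log_sparseBlocks
    (by rwa [g2]) (by rwa [g1]) (by rw [g2]; exact g5.par_root _) (by rw [g1]; exact g5.par_root _)
    (by rw [g1, g2]; exact o6.symm) ?_) ?_
  · rw [g1, g2]
    exact ((h.forest.rel _ hv).symm.trans _ _ _ hrel.symm).trans _ _ _ (h.forest.rel _ hu)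
  rintro m' T ⟨k1, k2, ⟨b, c, hbc, k3⟩, k4, k5, k6⟩
  have f7 : m'.reg 7 = l := by rw [k1, g3 7 (by omega), e7]
  have f9 : m'.reg 9 = 4 ^ l := by rw [k1, g3 9 (by omega), e9]
  have fr : ∀ z < 13, z ≠ 7 → z ≠ 9 → m'.reg z = m.reg z := by
    intro z h1 h2 h3
    rw [k1, g3 z h1, er z h1 h2 h3]
  have f2 : m'.arr 2 = m.arr 2 := by rw [k2 2 (by omega) (by omega), g4 2 (by omega), ea]
  have f5 := fr 5 (by omega) (by omega) (by omega)
  have f6 := fr 6 (by omega) (by omega) (by omega)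
  have f8 := fr 8 (by omega) (by omega) (by omega)
  have f12 := fr 12 (by omega) (by omega) (by omega)
  have fend : ∀ z l', m.reg 7 < l' → blockEnd (m'.arr 2) z l l' =
      blockEnd (m.arr 2) z (m.reg 7) l' := by
    intro z l' h1
    rw [f2, blockEnd_succ h1, hc, zero_mul, add_zero, hl']
  have hb : b / (n + 1) = l := by
    have hb' : b ∈ ({m₃.reg 14, m₃.reg 16} : Set ℕ) := hbc ▸ Set.mem_insert b {c}
    rw [g1, g2] at hb'
    obtain rfl | rfl := hb'
    · exact h.forest.root_div (by omega) hv
    · exact h.forest.root_div (by omega) hu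
  refine ⟨⟨fun v => if ρ v = b then c else ρ v, ?_⟩, ?_⟩
  · refine
      { reg0 := by rw [fr 0 (by omega) (by omega) (by omega), h0]
        reg1 := by rw [fr 1 (by omega) (by omega) (by omega), h.reg1]
        reg11 := by rw [fr 11 (by omega) (by omega) (by omega), h.reg11]
        forest := k3
        shift := by rw [f5, f6]; exact h.shift
        i_le := by rw [f5]; exact h.i_le
        p_le := by rw [f5]; exact h.p_le
        q_le := by rw [f6]; exact h.q_le
        matched := by rw [f5]; exact h.matched
        reg10 := by rw [fr 10 (by omega) (by omega) (by omega), h.reg10]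
        reg12 := by rw [f12, h.reg12]
        l_le := by omega
        L_le := by rw [f8]; exact h.L_le
        reg9 := by rw [f9, f7]
        p_sparse := by rw [f7, f5]; exact o1
        q_sparse := by rw [f7, f6]; exact o2
        count_le := by
          intro u h1 h2
          rw [f2]
          exact h.count_le u (by omega) (by omega)
        open_blocks := ?_
        top_sparse := by
          rw [f5, f6, f7, f8, fend _ _ (by omega), fend _ _ (by omega)]
          exact h.top_sparse
        top_end := by
          rw [f5, f7, f8, fend _ _ (by omega)]
          exact h.top_end }
    intro l' h1 h2
    rw [f7] at h1
    rw [f8] at h2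
    rw [f5, f6, f7, fend _ _ (by omega), fend _ _ (by omega)]
    obtain ⟨s1, s2, s3, s4, s5, s6⟩ := h.open_blocks l' (by omega) h2
    refine ⟨s1, s2, s3, s4, s5, ?_⟩
    obtain ⟨x', hx'⟩ : ∃ x', blockEnd (m.arr 2) (m.reg 5) (m.reg 7) l' = x' + 4 ^ l' :=
      ⟨_, (Nat.sub_add_cancel (by omega)).symm⟩
    have hy0 : blockEnd (m.arr 2) (m.reg 5) (m.reg 7) l' + j =
        blockEnd (m.arr 2) (m.reg 6) (m.reg 7) l' + i := by
      simp only [blockEnd]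
      omega
    obtain ⟨y', hy'⟩ : ∃ y', blockEnd (m.arr 2) (m.reg 6) (m.reg 7) l' = y' + 4 ^ l' :=
      ⟨_, (Nat.sub_add_cancel (by omega)).symm⟩
    rw [hx', hy', Nat.add_sub_cancel, Nat.add_sub_cancel] at s6 ⊢
    rw [hx', ← one_mul (4 ^ l'), inSparse_add_mul] at s1
    rw [hy', ← one_mul (4 ^ l'), inSparse_add_mul] at s2
    have hpw' := hs.four_pow_le (l := l') (h2.trans h.L_le)
    have hx'm := blockIndex_mem (n := n) (x := x') (by omega) hpw' (by omega) (by omega) s1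
    have hy'm := blockIndex_mem (n := n) (x := y') (by omega) hpw' (by omega) (by omega) s2
    have hx'd := h.forest.root_div (by omega) hx'm
    have hy'd := h.forest.root_div (by omega) hy'm
    have hnx : ρ (blockIndex n l' x') ≠ b := by
      intro he
      rw [he] at hx'd
      omega
    have hny : ρ (blockIndex n l' y') ≠ b := by
      intro he
      rw [he] at hy'd
      omega
    rwa [if_neg hnx, if_neg hny]
  · have hq : queryPotential K m' ≤ queryPotential K m + 6 := by
      simp only [queryPotential, f2, f7, f8, f12]
      rw [sum_eq_sum_Ico_succ_bot (show m.reg 7 < m.reg 8 + 1 by omega), hc, hl']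
      omega
    obtain ⟨F, hF⟩ : ∃ F, F = 100 * (a + 3) := ⟨_, rfl⟩
    have h1 : F * queryPotential K m' ≤ F * queryPotential K m + F * 6 := by
      rw [← mul_add]
      exact Nat.mul_le_mul_left F hq
    -- The destroyed root frees 7 units; the link itself raises the weighted forest potential by at
    -- most `17 * a`.
    have h2 : structurePotential n a d m' + F * 7 ≤ structurePotential n a d m₃ + 17 * a := by
      simp only [structurePotential, ← k4, ← hF]
      rw [mul_add 7, mul_add F]
      omega
    simp only [loopPotential, Expr.cost, blockExpr, ← hF]
    omega

theorem reach_step (hs : Setting W n i j K a d) (h : LoopInv n w i j K ρ m) :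
    Reach W n w stepProgram m fun m' T =>
      (∃ ρ', LoopInv n w i j K ρ' m' ∨ DoneInv n w i j K ρ' m') ∧
        T + 10 + loopPotential n a d K m' ≤ loopPotential n a d K m := by
  have hlK := h.l_le.trans h.L_le
  have hKn := le_of_four_pow_le hs.pow_le
  have hW := hs.linear_le
  have hc4 := h.count_le _ le_rfl h.l_le
  have hL := h.L_le
  have hlL := h.l_le
  have h10 := h.reg10
  refine Reach.ite ⟨⟨?_, ?_⟩, ?_, BinOp.equal_eval_lt (by omega) _ _⟩ (fun hc => ?_) (fun hc => ?_)
  · simp only [Expr.Fits]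
    omega
  · simp only [Expr.eval]
    omega
  · simp only [Expr.Fits]
    omega
  · simp only [Expr.eval, ne_eq, BinOp.equal_eval_eq_zero, not_not] at hc
    refine Reach.ite ⟨?_, ?_, BinOp.less_eval_lt (by omega) _ _⟩ (fun hl => ?_) (fun hl => ?_)
    · simp only [Expr.Fits]
      omega
    · simp only [Expr.Fits]
      omega
    · simp only [Expr.eval, ne_eq, BinOp.less_eval_eq_zero, not_le] at hl
      refine (reach_ascend hs h hc hl).mono ?_
      rintro m' T ⟨⟨ρ', g1⟩, g2⟩
      refine ⟨⟨ρ', .inl g1⟩, ?_⟩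
      simp only [Expr.cost]
      omega
    simp only [Expr.eval, BinOp.less_eval_eq_zero] at hl
    refine Reach.ite ⟨?_, ?_, BinOp.less_eval_lt (by omega) _ _⟩ (fun hl' => ?_) (fun hl' => ?_)
    · simp only [Expr.Fits]
      omega
    · simp only [Expr.Fits]
      omega
    · simp only [Expr.eval, ne_eq, BinOp.less_eval_eq_zero, not_le, h10] at hl'
      refine (reach_raise hs h hc (by omega) hl').mono ?_
      rintro m' T ⟨g1, g2⟩
      refine ⟨⟨ρ, .inl g1⟩, ?_⟩
      simp only [Expr.cost]
      omega
    · simp only [Expr.eval, BinOp.less_eval_eq_zero, h10] at hl'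
      have hlK' : m.reg 7 = m.reg 8 := by omega
      have htop := h.top_end (by omega)
      rw [← hlK', blockEnd_add_one, hc, zero_mul, add_zero] at htop
      refine Reach.assign (show 1 < W by omega) ⟨⟨ρ, .inr ?_⟩, ?_⟩
      · exact
          { toBaseInv := h.toBaseInv.congr (by simp) (by simp) (by simp) (by simp) (by simp)
              h.forest
            reg12 := by simp [Expr.eval]
            halted := by
              simp only [State.setReg_reg]
              exact .inr (.inr (.inr htop)) }
      · have hq : queryPotential K (m.setReg 12 (Expr.eval m (.const 1))) + 1 ≤
            queryPotential K m := by
          simp [queryPotential, h.reg12, Expr.eval]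
        refine loopPotential_le ?_ hq
        rw [structurePotential_setReg]
        simp only [Expr.cost]
        omega
  · simp only [Expr.eval, BinOp.equal_eval_eq_zero] at hc
    refine (reach_compare hs h hc).mono ?_
    rintro m' T ⟨g1, g2⟩
    refine ⟨⟨ρ, g1⟩, ?_⟩
    simp only [Expr.cost]
    omega

theorem reach_mainLoop (hs : Setting W n i j K a d)
    (h : LoopInv n w i j K ρ m ∨ DoneInv n w i j K ρ m) :
    Reach W n w (.loop (.op .equal (.reg 12) (.const 0)) stepProgram) m fun m' T =>
      (∃ ρ', DoneInv n w i j K ρ' m') ∧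
        T + structurePotential n a d m' ≤ loopPotential n a d K m + 4 := by
  have hW := hs.linear_le
  refine Reach.loop (N := loopPotential n a d K m)
    (fun N m' => N = loopPotential n a d K m' ∧
      ∃ ρ', LoopInv n w i j K ρ' m' ∨ DoneInv n w i j K ρ' m') ?_ ?_ ⟨rfl, ρ, h⟩ ?_
  · rintro N m' ⟨-, ρ', h'⟩
    have h12 : m'.reg 12 ≤ 1 := h'.elim (fun h' => h'.reg12 ▸ zero_le_one) fun h' => h'.reg12.le
    exact ⟨show m'.reg 12 < W by omega, show 0 < W by omega, BinOp.equal_eval_lt (by omega) _ _⟩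
  · rintro N m' ⟨rfl, ρ', h'⟩ he
    simp only [Expr.eval, ne_eq, BinOp.equal_eval_eq_zero, not_not] at he
    obtain h' | h' := h'
    · refine (reach_step hs h').mono ?_
      rintro m'' T ⟨g1, g2⟩
      refine ⟨_, ⟨rfl, g1⟩, ?_⟩
      simp only [Expr.cost]
      omega
    · have := h'.reg12
      omega
  · rintro N m' T ⟨rfl, ρ', h'⟩ he hT
    simp only [Expr.eval, BinOp.equal_eval_eq_zero] at he
    obtain h' | h' := h'
    · exact absurd h'.reg12 he
    · refine ⟨⟨ρ', h'⟩, ?_⟩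
      simp only [Expr.cost, loopPotential] at hT ⊢
      omega

/-! ### The query program -/

/-- Computes the highest level: the least number that is `k`, or the logarithm of a power of `4`
that is at least `n`. -/
def levelProgram : Program :=
  .loop (.op .times (.op .less (.reg 10) (.reg 3)) (.op .less (.reg 11) (.reg 0))) <|
    .seq (.assign 10 (.op .plus (.reg 10) (.const 1)))
      (.assign 11 (.op .times (.reg 11) (.const 4)))

/-- Initialises the registers. -/
def initProgram : Program :=
  .seq (.assign 5 (.reg 1)) <| .seq (.assign 6 (.reg 2)) <| .seq (.assign 7 (.const 0)) <|
  .seq (.assign 8 (.const 0)) <| .seq (.assign 9 (.const 1)) <| .seq (.assign 10 (.const 0)) <|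
  .seq (.assign 11 (.const 1)) <| .assign 12 (.const 0)

/-- Computes the answer from the final position. -/
def answerProgram : Program :=
  .seq (.assign 4 (.op .monus (.reg 5) (.reg 1))) <|
  .ite (.op .less (.reg 11) (.reg 4)) (.assign 4 (.reg 11)) .skip

/-- Answers a query. -/
def queryProgram : Program :=
  .seq initProgram <| .seq levelProgram <|
  .seq (.ite (.op .equal (.reg 1) (.reg 2))
    (.assign 5 (.op .plus (.reg 0) (.const 1)))
    (.seq setCountProgram (.loop (.op .equal (.reg 12) (.const 0)) stepProgram))) <|
  answerProgram

theorem BinOp.times_less_eval_eq_zero (x y z t : ℕ) :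
    BinOp.times.eval (BinOp.less.eval x y) (BinOp.less.eval z t) = 0 ↔ ¬ (x < y ∧ z < t) := by
  by_cases h1 : x < y <;> by_cases h2 : z < t <;> simp [BinOp.eval, h1, h2]

theorem BinOp.times_less_eval_le (x y z t : ℕ) :
    BinOp.times.eval (BinOp.less.eval x y) (BinOp.less.eval z t) ≤ 1 := by
  by_cases h1 : x < y <;> by_cases h2 : z < t <;> simp [BinOp.eval, h1, h2]

theorem reach_init (hW : 1 < W) (h1 : m.reg 1 < W) (h2 : m.reg 2 < W) :
    Reach W n w initProgram m fun m' T =>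
      (∀ y < 5, m'.reg y = m.reg y) ∧ m'.reg 5 = m.reg 1 ∧ m'.reg 6 = m.reg 2 ∧ m'.reg 7 = 0 ∧
      m'.reg 8 = 0 ∧ m'.reg 9 = 1 ∧ m'.reg 10 = 0 ∧ m'.reg 11 = 1 ∧ m'.reg 12 = 0 ∧
      m'.arr = m.arr ∧ T = 16 := by
  have h0 : 0 < W := by omega
  refine Reach.seq (Reach.assign h1 (Reach.seq (Reach.assign ?_ (Reach.seq (Reach.assign h0
    (Reach.seq (Reach.assign h0 (Reach.seq (Reach.assign hW (Reach.seq (Reach.assign h0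
    (Reach.seq (Reach.assign hW (Reach.assign h0 ?_))))))))))))))
  · simpa [Expr.Fits] using h2
  · refine ⟨?_, ?_⟩
    · intro y hy
      simp only [State.setReg_reg]
      repeat rw [if_neg (by omega)]
    · simp [Expr.eval, Expr.cost]

/-- Stopping at the first power of 4 that reaches `n` keeps `4 ^ K ≤ 4 * n`, however large `k` may
be, so all blocks of the query are nodes or single symbols. Each round takes 16 steps. -/
theorem reach_level (hn : 1 ≤ n) (hW : 16 * (n + 1) ≤ W) (h0 : m.reg 0 = n) (h3 : m.reg 3 < W)
    (h10 : m.reg 10 = 0) (h11 : m.reg 11 = 1) :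
    Reach W n w levelProgram m fun m' T =>
      ∃ K ≤ m.reg 3, m'.reg 10 = K ∧ m'.reg 11 = 4 ^ K ∧ 4 ^ K ≤ 4 * n ∧
        (K = m.reg 3 ∨ n ≤ 4 ^ K) ∧
        (∀ y, y ≠ 10 → y ≠ 11 → m'.reg y = m.reg y) ∧ m'.arr = m.arr ∧ T ≤ 16 * m.reg 3 + 8 := by
  refine Reach.loop (N := 16 * m.reg 3)
    (fun N m' => ∃ K ≤ m.reg 3, N = 16 * (m.reg 3 - K) ∧ m'.reg 10 = K ∧ m'.reg 11 = 4 ^ K ∧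
      4 ^ K ≤ 4 * n ∧ (∀ y, y ≠ 10 → y ≠ 11 → m'.reg y = m.reg y) ∧ m'.arr = m.arr) ?_ ?_ ?_ ?_
  · rintro N m' ⟨K, hK, -, e10, e11, hp, hr, ha⟩
    have e0 := hr 0 (by omega) (by omega)
    have e3 := hr 3 (by omega) (by omega)
    refine ⟨⟨?_, ?_, BinOp.less_eval_lt (by omega) _ _⟩,
      ⟨?_, ?_, BinOp.less_eval_lt (by omega) _ _⟩,
      (BinOp.times_less_eval_le _ _ _ _).trans_lt (by omega)⟩ <;> simp only [Expr.Fits] <;> omega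
  · rintro N m' ⟨K, hK, hN, e10, e11, hp, hr, ha⟩ he
    have e0 := hr 0 (by omega) (by omega)
    have e3 := hr 3 (by omega) (by omega)
    simp only [Expr.eval, ne_eq, BinOp.times_less_eval_eq_zero, not_not, e0, e3, e10, e11, h0] at he
    refine Reach.seq (Reach.assign ?_ (Reach.assign ?_
      ⟨16 * (m.reg 3 - (K + 1)), ⟨K + 1, by omega, rfl, ?_, ?_, ?_, ?_, ?_⟩, ?_⟩))
    · simp only [Expr.Fits, Expr.eval, BinOp.eval]
      omega
    · simp [Expr.Fits, Expr.eval, BinOp.eval]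
      omega
    · simp [Expr.eval, BinOp.eval, e10]
    · simp [Expr.eval, BinOp.eval, e11, pow_succ]
    · rw [pow_succ]
      omega
    · intro y h1 h2
      simp [h1, h2, hr]
    · simpa using ha
    · simp only [Expr.cost]
      omega
  · exact ⟨0, by omega, by omega, h10, by simpa using h11, by omega, fun _ _ _ => rfl, rfl⟩
  · rintro N m' T ⟨K, hK, hN, e10, e11, hp, hr, ha⟩ he hT
    have e0 := hr 0 (by omega) (by omega)
    have e3 := hr 3 (by omega) (by omega)
    simp only [Expr.eval, BinOp.times_less_eval_eq_zero, e0, e3, e10, e11, h0] at he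
    refine ⟨K, hK, e10, e11, hp, by omega, hr, ha, ?_⟩
    simp only [Expr.cost] at hT
    omega

/-- A stop at a mismatch or at the end of the word makes `p - i` the exact `LCE`; otherwise `4 ^ K`
symbols have matched and the minimum removes any excess. If `K ≠ k`, then `n ≤ 4 ^ K`, and neither
bound cuts off anything. -/
theorem min_eq_shortLCE {p q : ℕ} (hi : 1 ≤ i) (hin : i ≤ p) (hp : p ≤ n + 1) (hq : q ≤ n + 1)
    (hs : p + j = q + i) (hm : ∀ t, i + t < p → w (i + t) = w (j + t))
    (hend : n < p ∨ n < q ∨ w p ≠ w q ∨ i + 4 ^ K ≤ p) (hKk : K ≤ k) (hK : K = k ∨ n ≤ 4 ^ K) :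
    min (p - i) (4 ^ K) = shortLCE n w (4 ^ k) i j := by
  have hmem : p - i ∈ {l : ℕ | i + l ≤ n + 1 ∧ j + l ≤ n + 1 ∧ ∀ t < l, w (i + t) = w (j + t)} :=
    ⟨by omega, by omega, fun t ht => hm t (by omega)⟩
  have hbdd : BddAbove {l : ℕ | i + l ≤ n + 1 ∧ j + l ≤ n + 1 ∧ ∀ t < l, w (i + t) = w (j + t)} :=
    ⟨n, fun l hl => by have := hl.1; omega⟩
  have hge : p - i ≤ lce n w i j := le_csSup hbdd hmem
  have hlce := Nat.sSup_mem ⟨_, hmem⟩ hbdd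
  change lce n w i j ∈ _ at hlce
  obtain ⟨l1, l2, l3⟩ := hlce
  have hpow : 4 ^ K ≤ 4 ^ k := Nat.pow_le_pow_right (by norm_num) hKk
  have hcase : lce n w i j = p - i ∨ 4 ^ K ≤ p - i := by
    by_contra! hc
    obtain ⟨hc1, hc2⟩ := hc
    have h1 := l3 (p - i) (by omega)
    rw [show i + (p - i) = p by omega, show j + (p - i) = q by omega] at h1
    obtain h2 | h2 | h2 | h2 := hend
    · omega
    · omega
    · exact h2 h1
    · omega
  rw [shortLCE]
  obtain rfl | hK := hK <;> omega

theorem reach_answer {x y : ℕ} (h1 : m.reg 1 = y) (h5 : m.reg 5 = x) (h11 : m.reg 11 = 4 ^ K)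
    (hx : x < W) (hy : y < W) (hK : 4 ^ K < W) (hW : 1 < W) :
    Reach W n w answerProgram m fun m' T =>
      m'.reg 4 = min (x - y) (4 ^ K) ∧ m'.reg 0 = m.reg 0 ∧ m'.arr = m.arr ∧ T ≤ 12 := by
  obtain ⟨m₄, hm₄⟩ : ∃ m₄, m₄ = m.setReg 4 (x - y) := ⟨_, rfl⟩
  have k4 : m₄.reg 4 = x - y := by simp [hm₄]
  have k11 : m₄.reg 11 = 4 ^ K := by simp [hm₄, h11]
  have k0 : m₄.reg 0 = m.reg 0 := by simp [hm₄]
  have ka : m₄.arr = m.arr := by simp [hm₄]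
  refine Reach.seq (Reach.assign ?_ ?_)
  · simp only [Expr.Fits, Expr.eval, BinOp.eval]
    omega
  rw [show State.setReg m 4 _ = m₄ by rw [hm₄]; simp [Expr.eval, BinOp.eval, h1, h5]]
  refine Reach.ite ⟨?_, ?_, BinOp.less_eval_lt hW _ _⟩ (fun hlt => ?_) (fun hlt => ?_)
  · simp only [Expr.Fits]
    omega
  · simp only [Expr.Fits]
    omega
  · simp only [Expr.eval, ne_eq, BinOp.less_eval_eq_zero, not_le, k11, k4] at hlt
    refine Reach.assign (show m₄.reg 11 < W by omega) ⟨?_, by simpa using k0, ka, ?_⟩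
    · simp only [State.setReg_reg, if_true, Expr.eval, k11]
      omega
    · simp [Expr.cost]
  · simp only [Expr.eval, BinOp.less_eval_eq_zero, k11, k4] at hlt
    refine Reach.skip ⟨by omega, k0, ka, ?_⟩
    simp [Expr.cost]

theorem reach_query (hn : 1 ≤ n) (hWs : (n + 1) * (n + 1) ≤ W) (hW : 16 * (n + 1) ≤ W)
    (ha : 1 ≤ a) (hd : Nat.log 2 n < ackermannA a d) {Q : Query} (hQ : Q.Valid n) (hk : Q.k < W)
    (h0 : m.reg 0 = n) (h : Forest (sparseBlocks n) (BlockRel n w) (m.arr 0) (m.arr 1) ρ) :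
    Reach W n w queryProgram (m.present Q) fun m' T =>
      m'.reg 4 = Q.answer n w ∧ m'.reg 0 = n ∧
      (∃ ρ', Forest (sparseBlocks n) (BlockRel n w) (m'.arr 0) (m'.arr 1) ρ') ∧
      T + structurePotential n a d m' ≤
        structurePotential n a d m + 100 * (a + 3) * (13 * (Q.k + 1)) := by
  obtain ⟨⟨i1, i2⟩, j1, j2⟩ := hQ
  obtain ⟨m₀, hm₀⟩ : ∃ m₀, m₀ = m.present Q := ⟨_, rfl⟩
  have b0 : m₀.reg 0 = n := by simpa [hm₀, State.present] using h0
  have b1 : m₀.reg 1 = Q.i := by simp [hm₀, State.present]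
  have b2 : m₀.reg 2 = Q.j := by simp [hm₀, State.present]
  have b3 : m₀.reg 3 = Q.k := by simp [hm₀, State.present]
  have ba : m₀.arr = m.arr := by simp [hm₀, State.present]
  rw [← hm₀]
  refine Reach.seq (Reach.mono (reach_init (by omega) (by omega) (by omega)) ?_)
  rintro m₁ T₁ ⟨cr, c5, c6, c7, c8, c9, c10, c11, c12, ca, rfl⟩
  have c0 := cr 0 (by omega)
  have c1 := cr 1 (by omega)
  have c2 := cr 2 (by omega)
  have c3 := cr 3 (by omega)
  refine Reach.seq (Reach.mono (reach_level hn hW (by omega) (by omega) c10 c11) ?_)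
  rintro m₂ T₂ ⟨K, hKk, e10, e11, hp, hK, er, ea, hT₂⟩
  have hKn := le_of_four_pow_le hp
  have e0 := er 0 (by omega) (by omega)
  have e1 := er 1 (by omega) (by omega)
  have e2 := er 2 (by omega) (by omega)
  have e5 := er 5 (by omega) (by omega)
  have e6 := er 6 (by omega) (by omega)
  have e7 := er 7 (by omega) (by omega)
  have e8 := er 8 (by omega) (by omega)
  have e9 := er 9 (by omega) (by omega)
  have e12 := er 12 (by omega) (by omega)
  rw [c3, b3] at hKk hK hT₂
  have earr : m₂.arr = m.arr := by rw [ea, ca, ba]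
  have hstr : structurePotential n a d m₂ = structurePotential n a d m :=
    structurePotential_congr (by rw [earr]) (by rw [earr])
  have hfin : ∀ m₃ : State, ∀ T ρ', m₃.reg 0 = n → m₃.reg 1 = Q.i → m₃.reg 11 = 4 ^ K →
      Forest (sparseBlocks n) (BlockRel n w) (m₃.arr 0) (m₃.arr 1) ρ' → m₃.reg 5 ≤ n + 1 →
      min (m₃.reg 5 - Q.i) (4 ^ K) = Q.answer n w →
      T + structurePotential n a d m₃ ≤ structurePotential n a d m +
        100 * (a + 3) * (12 * Q.k + 3) + 100 →
      Reach W n w answerProgram m₃ fun m' T' =>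
          m'.reg 4 = Q.answer n w ∧ m'.reg 0 = n ∧
          (∃ ρ', Forest (sparseBlocks n) (BlockRel n w) (m'.arr 0) (m'.arr 1) ρ') ∧
          16 + (T₂ + (T + T')) + structurePotential n a d m' ≤
            structurePotential n a d m + 100 * (a + 3) * (13 * (Q.k + 1)) := by
    intro m₃ T ρ' g0 g1 g11 gF g5 gans gT
    -- The main loop starts with at most `12 * k + 3` units. The remaining `k + 10` units pay for
    -- the initialisation, the search for the level and the answer.
    have hbound : 100 * (a + 3) * (12 * Q.k + 3) + 300 * (Q.k + 10) ≤
        100 * (a + 3) * (13 * (Q.k + 1)) := by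
      have e : 100 * (a + 3) * (13 * (Q.k + 1)) =
          100 * (a + 3) * (12 * Q.k + 3) + 100 * (a + 3) * (Q.k + 10) := by ring
      rw [e]
      exact Nat.add_le_add_left (Nat.mul_le_mul_right _ (by omega)) _
    refine (reach_answer g1 rfl g11 (by omega) (by omega) (by omega) (by omega)).mono ?_
    rintro m' T' ⟨k4, k0, ka, kT⟩
    refine ⟨k4.trans gans, k0.trans g0, ⟨ρ', by rwa [ka]⟩, ?_⟩
    rw [structurePotential_congr (m := m₃) (m' := m') (by rw [ka]) (by rw [ka])]
    omega
  have hF₂ : Forest (sparseBlocks n) (BlockRel n w) (m₂.arr 0) (m₂.arr 1) ρ := by rwa [earr]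
  have hWpos : 4 < W := by omega
  refine Reach.seq (Reach.ite ⟨?_, ?_, BinOp.equal_eval_lt (by omega) _ _⟩ (fun hij => ?_)
    (fun hij => ?_))
  · simp only [Expr.Fits]
    omega
  · simp only [Expr.Fits]
    omega
  · simp only [Expr.eval, ne_eq, BinOp.equal_eval_eq_zero, not_not] at hij
    -- Equal positions would share a node even for a block that overruns the word, so this case
    -- bypasses the forest: the match extends to position `n + 1`.
    have hij' : Q.i = Q.j := by omega
    obtain ⟨m₃, hm₃⟩ : ∃ m₃, m₃ = m₂.setReg 5 (n + 1) := ⟨_, rfl⟩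
    have g5 : m₃.reg 5 = n + 1 := by simp [hm₃]
    have g0 : m₃.reg 0 = n := by
      simp [hm₃]
      omega
    have g1 : m₃.reg 1 = Q.i := by
      simp [hm₃]
      omega
    refine Reach.assign ?_ ?_
    · simp only [Expr.Fits, Expr.eval, BinOp.eval]
      omega
    rw [show State.setReg m₂ 5 _ = m₃ by rw [hm₃]; simp [Expr.eval, BinOp.eval, e0, c0, b0]]
    refine (hfin m₃ ((Expr.op BinOp.equal (.reg 1) (.reg 2)).cost + 1 +
      ((Expr.op BinOp.plus (.reg 0) (.const 1)).cost + 1)) ρ g0 g1 (by simpa [hm₃] using e11)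
      (by rw [hm₃]; exact hF₂) (by omega) ?_ ?_).mono ?_
    · rw [g5]
      exact min_eq_shortLCE (q := n + 1) i1 (by omega) le_rfl le_rfl (by omega)
        (fun t _ => by rw [hij']) (.inl (by omega)) hKk hK
    · rw [hm₃, structurePotential_setReg, hstr]
      simp only [Expr.cost]
      omega
    · rintro m' T' ⟨p1, p2, p3, p4⟩
      exact ⟨p1, p2, p3, by simp only [Expr.cost] at p4 ⊢; omega⟩
  · simp only [Expr.eval, BinOp.equal_eval_eq_zero] at hij
    have hs : Setting W n Q.i Q.j K a d :=
      ⟨i1, i2, j1, j2, by omega, hp, hWs, hW, ha, hd⟩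
    refine Reach.seq (Reach.mono (reach_setCount hWpos (by omega) (by omega) (by omega) (by omega)
      (by omega)) ?_)
    rintro m₃ T₃ ⟨g2, gr, ga, gT⟩
    have g0 := gr 0 (by omega)
    have g1 := gr 1 (by omega)
    have g5 := gr 5 (by omega)
    have g6 := gr 6 (by omega)
    have g7 := gr 7 (by omega)
    have g8 := gr 8 (by omega)
    have g9 := gr 9 (by omega)
    have g10 := gr 10 (by omega)
    have g11 := gr 11 (by omega)
    have g12 := gr 12 (by omega)
    rw [e8, c8, e10] at g2
    have z7 : m₃.reg 7 = 0 := by omega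
    have z8 : m₃.reg 8 = 0 := by omega
    have z9 : m₃.reg 9 = 4 ^ 0 := by rw [pow_zero]; omega
    have y9 : m₂.reg 9 = 4 ^ 0 := by rw [pow_zero]; omega
    have hcount : m₃.arr 2 0 ≤ 2 := by
      rw [g2, Function.update_self]
      split_ifs
      · exact stepsUp_le _ _ _
      · omega
    have hInv : LoopInv n w Q.i Q.j K ρ m₃ :=
      { reg0 := by omega
        reg1 := by omega
        reg11 := by rw [g11, e11]
        forest := by
          rw [ga 0 (by omega), ga 1 (by omega)]
          exact hF₂
        shift := by omega
        i_le := by omega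
        p_le := by omega
        q_le := by omega
        matched := fun t ht => by omega
        reg10 := by omega
        reg12 := by omega
        l_le := by omega
        L_le := by omega
        reg9 := by rw [z9, z7]
        p_sparse := by rw [z7]; trivial
        q_sparse := by rw [z7]; trivial
        count_le := fun u _ hu => by
          obtain rfl : u = 0 := by omega
          omega
        open_blocks := fun l' h1 h2 => by omega
        top_sparse := fun hlt => by
          rw [z8] at hlt
          rw [z7, z8, blockEnd_add_one, blockEnd_add_one, g2, Function.update_self, if_pos hlt, y9,
            g5, g6]
          exact inSparse_stepsUp trivial trivial
        top_end := fun he => by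
          rw [z8] at he
          rw [z7, z8, blockEnd_add_one, g2, Function.update_self, if_neg (by omega), ← he]
          omega }
    refine Reach.mono (reach_mainLoop hs (.inl hInv)) ?_
    rintro m₄ T₄ ⟨⟨ρ', hD⟩, hT₄⟩
    have hstr₃ : structurePotential n a d m₃ = structurePotential n a d m := by
      rw [← hstr]
      exact structurePotential_congr (ga 0 (by omega)) (ga 1 (by omega))
    have hqp : queryPotential K m₃ ≤ 12 * Q.k + 3 := by
      simp only [queryPotential, z7, z8, Nat.Ico_succ_singleton, sum_singleton]
      omega
    have hmul := Nat.mul_le_mul_left (100 * (a + 3)) hqp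
    refine (hfin m₄ _ ρ' hD.reg0 hD.reg1 hD.reg11 hD.forest hD.p_le
      (min_eq_shortLCE i1 hD.i_le hD.p_le hD.q_le hD.shift hD.matched hD.halted hKk hK) ?_).mono
      fun _ _ h => h
    simp only [Expr.cost]
    rw [loopPotential, hstr₃] at hT₄
    omega

/-! ### The main theorem -/

theorem exists_serves (hn : 1 ≤ n) (hWs : (n + 1) * (n + 1) ≤ W) (hW : 16 * (n + 1) ≤ W)
    (ha : 1 ≤ a) (hd : Nat.log 2 n < ackermannA a d) (Qs : List Query)
    (hQ : ∀ Q ∈ Qs, Q.Valid n) (hk : ∀ Q ∈ Qs, Q.k < W) (m : State) (ρ : ℕ → ℕ) (h0 : m.reg 0 = n)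
    (h : Forest (sparseBlocks n) (BlockRel n w) (m.arr 0) (m.arr 1) ρ) :
    ∃ T, Serves W n w queryProgram m Qs (Qs.map (Query.answer n w)) T ∧
      T ≤ structurePotential n a d m + 100 * (a + 3) * (13 * totalSize Qs) := by
  induction Qs generalizing m ρ with
  | nil => exact ⟨0, .nil m, Nat.zero_le _⟩
  | cons Q Qs ih =>
    obtain ⟨m₁, T₁, hx, hans, h0', ⟨ρ', hF⟩, hT₁⟩ := reach_query hn hWs hW ha hd
      (hQ Q List.mem_cons_self) (hk Q List.mem_cons_self) h0 h
    obtain ⟨T₂, hserve, hT₂⟩ := ih (fun Q' hQ' => hQ Q' (List.mem_cons_of_mem _ hQ'))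
      (fun Q' hQ' => hk Q' (List.mem_cons_of_mem _ hQ')) m₁ ρ' h0' hF
    refine ⟨T₁ + T₂, ?_, ?_⟩
    · rw [List.map_cons, ← hans]
      exact .cons m m₁ Q Qs _ T₁ T₂ hx hserve
    · have e : 100 * (a + 3) * (13 * totalSize (Q :: Qs)) =
          100 * (a + 3) * (13 * (Q.k + 1)) + 100 * (a + 3) * (13 * totalSize Qs) := by
        simp only [totalSize, List.map_cons, List.sum_cons]
        ring
      omega

theorem onlineAlgorithm_run (hn : 1 ≤ n) (Qs : List Query) (hQ : ∀ Q ∈ Qs, Q.Valid n)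
    (hW : (n + 1) ^ 5 ≤ W) (hk : ∀ Q ∈ Qs, Q.k < W) :
    ∃ T, (OnlineAlgorithm.mk .skip queryProgram).Run W n w Qs (Qs.map (Query.answer n w)) T ∧
      T ≤ 70000 * ((n + totalSize Qs) * inverseAckermann (n + totalSize Qs) n) := by
  obtain ⟨s, hs⟩ : ∃ s, s = totalSize Qs := ⟨_, rfl⟩
  rw [← hs]
  obtain ⟨a, ha⟩ : ∃ a, a = inverseAckermann (n + s) n := ⟨_, rfl⟩
  obtain ⟨d, hd⟩ : ∃ d, d = (n + s) / n := ⟨_, rfl⟩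
  have ha1 : 1 ≤ a := ha ▸ (inverseAckermann_mem (Nat.le_add_right n s) hn).1
  have hlog : Nat.log 2 n < ackermannA a d :=
    ha ▸ hd ▸ log_lt_ackermannA (Nat.le_add_right n s) hn
  have hWs : (n + 1) * (n + 1) ≤ W := by
    rw [← pow_two]
    exact (Nat.pow_le_pow_right (by omega) (by norm_num)).trans hW
  -- As `n + 1 ≥ 2`, four of the five factors provide the 16.
  have hWl : 16 * (n + 1) ≤ W := by
    refine le_trans ?_ hW
    rw [pow_succ]
    exact Nat.mul_le_mul_right _ (Nat.pow_le_pow_left (show 2 ≤ n + 1 by omega) 4)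
  -- Zero-initialised arrays already represent the forest of singletons, so the preprocessing is
  -- empty.
  obtain ⟨T, hserve, hT⟩ := exists_serves (w := w) hn hWs hWl ha1 hlog Qs hQ hk (initialState n) id
    rfl (Forest.init fun v _ => .inl rfl)
  refine ⟨1 + T, ⟨initialState n, 1, T, .skip _, hserve, rfl⟩, ?_⟩
  rw [← ha]
  have hinit : structurePotential n a d (initialState n) =
      17 * (#(sparseBlocks n) * (a * 2 + d)) + 100 * (a + 3) * (7 * #(sparseBlocks n)) := by
    simp only [structurePotential, initialState]
    rw [forestPotential_init, numRoots_init]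
  -- This is why the column is `⌊(n + s)/n⌋`: the share `d` in the potential of each of the `O(n)`
  -- blocks sums to `O(n + s)`.
  have hnd : n * d ≤ n + s := hd ▸ Nat.mul_div_le _ _
  have hcard := card_sparseBlocks_le n
  rw [hinit, ← hs] at hT
  have h1 : #(sparseBlocks n) * (a * 2 + d) ≤ 60 * ((n + s) * a) := by
    calc #(sparseBlocks n) * (a * 2 + d) ≤ 20 * n * (a * 2 + d) := Nat.mul_le_mul_right _ hcard
      _ = 40 * (n * a) + 20 * (n * d) := by ring
      _ ≤ 40 * ((n + s) * a) + 20 * ((n + s) * a) := by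
          exact Nat.add_le_add
            (Nat.mul_le_mul_left _ (Nat.mul_le_mul_right _ (Nat.le_add_right n s)))
            (Nat.mul_le_mul_left _ (hnd.trans (Nat.le_mul_of_pos_right _ ha1)))
      _ = _ := by ring
  have h2 : 100 * (a + 3) * (7 * #(sparseBlocks n)) ≤ 56000 * ((n + s) * a) := by
    calc 100 * (a + 3) * (7 * #(sparseBlocks n)) ≤ 100 * (4 * a) * (7 * (20 * (n + s))) := by
          gcongr <;> omega
      _ = _ := by ring
  have h3 : 100 * (a + 3) * (13 * s) ≤ 5200 * ((n + s) * a) := by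
    calc 100 * (a + 3) * (13 * s) ≤ 100 * (4 * a) * (13 * (n + s)) := by
          gcongr <;> omega
      _ = _ := by ring
  -- The constants add up to `1 + 17 * 60 + 56000 + 5200 ≤ 70000`.
  have h4 : 1 ≤ (n + s) * a := Nat.mul_pos (by omega) ha1
  omega

end Queries

end LCE

theorem mainTheorem5 :
    (∃ (alg : LCE.OnlineAlgorithm) (b C : ℕ),
      ∀ (S : Type*) (n : ℕ) (w : ℕ → S) (Qs : List LCE.Query) (W : ℕ),
        1 ≤ n → (∀ Q ∈ Qs, Q.Valid n) →
        -- machine words have at least `b * log (n + 1)` bits, and the queries fit in them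
        (n + 1) ^ b ≤ W → (∀ Q ∈ Qs, Q.k < W) →
        ∃ T : ℕ, alg.Run W n w Qs (Qs.map (LCE.Query.answer n w)) T ∧
          T ≤ C * ((n + LCE.totalSize Qs) *
            LCE.inverseAckermann (n + LCE.totalSize Qs) n)) ∧
    (∃ C : ℕ, ∀ n s : ℕ, 1 ≤ n → (2 ≤ n ∨ 1 ≤ s) →
      (n + s) * LCE.inverseAckermann (n + s) n ≤ C * (n * LCE.logStar n + s)) :=
  ⟨⟨⟨.skip, LCE.queryProgram⟩, 5, 70000, fun _ _ _ Qs _ hn hQ hW hk =>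
    LCE.onlineAlgorithm_run hn Qs hQ hW hk⟩, LCE.inverseAckermann_bound⟩
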